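/- **Setting.** Let $q\in\mathbb C\setminus\{0\}$ with $|q|\neq 1$; fix a logarithm $L$ of $q$ and put $q^z=e^{Lz}$. Let $i,k\ge 1$, $n\ge i+k+1$, and let $\gamma_1,\dots,\gamma_n>\tfrac12$ be real. Write $[z]_q=\frac{q^z-q^{-z}}{q-q^{-1}}$, $\sigma^{(g)}_m=[m+g-\frac12]_q-(-1)^m[g-\frac12]_q$, $\gamma_{[a;b]}=\gamma_a+\dots+\gamma_b$, and $|\mathbf j_m|=j_1+\dots+j_m$. Let $W^{(\gamma)}$ be the vector space with basis $|m\rangle_\gamma$, $m\in\mathbb N$, with the $\mathfrak{osp}_q(1|2)$-action $$A_+|m\rangle=\sqrt{\sigma^{(\gamma)}_{m+1}}\,|m+1\rangle,\quad A_-|m\rangle=\sqrt{\sigma^{(\gamma)}_{m}}\,|m-1\rangle,\quad K|m\rangle=q^{\frac12(m+\gamma)}|m\rangle,\quad P|m\rangle=(-1)^m|m\rangle$$ (principal square roots). Equip $W^{(\gamma_1)}\otimes\dots\otimes W^{(\gamma_n)}$ with the bilinear form $\langle\cdot|\cdot\rangle$ for which the vectors $|m_1\rangle\otimes\dots\otimes|m_n\rangle$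 are orthonormal (for $q>0$ all vectors below are real and this is the inner product). On the positions $a,\dots,b$ put $(A_\pm)_{[a;b]}=\sum_{\ell=a}^b (K^{-1})^{\otimes(\ell-a)}\otimes A_\pm\otimes(KP)^{\otimes(b-\ell)}$, $K_{[a;b]}=K^{\otimes(b-a+1)}$, $P_{[a;b]}=P^{\otimes(b-a+1)}$ (acting as the identity on the other positions), and $$\Gamma^q_{[a;b]}=\Big(-(A_+)_{[a;b]}(A_-)_{[a;b]}+\tfrac{q^{-1/2}}{q-q^{-1}}K_{[a;b]}^2-\tfrac{q^{1/2}}{q-q^{-1}}K_{[a;b]}^{-2}\Big)P_{[a;b]} .$$ For $r\ge1$, $i+r\le n$, let $\mathcal Y_{i,r}$ be the algebra generated by $\Gamma^q_{[1;m]}$ ($2\le m\le i$ or $i+r\le m\le n$, $m\geq 2$) and $\Gamma^q_{[i+1;i+m]}$ ($2\le m\le r$). **The vectors.** *Coupling step:* for an offset $o$, $m\ge2$, vectors $f(0),f(1),\dots$ on the positions $o+1,\dots,o+m-1$ and $p\in\mathbb N$ let $$\mathcal E_{o,m}^{\mathbf j}(f,p)=(A_+)^p_{[o+1;o+m]}\sum_{t=0}^{j_{m-1}}c_t\,f(t)\otimes|j_{m-1}-t\rangle_{\gamma_{o+m}},$$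 $$c_t=(-1)^{t(j_{m-1}+\frac{t-1}2)}q^{-\frac t2(|\mathbf j_{m-1}|+\gamma_{[o+1;o+m]}-1)}\prod_{\ell=0}^{t-1}\frac{\sqrt{\sigma^{(\gamma_{o+m})}_{j_{m-1}-\ell}}}{\sigma_{\ell+1}^{(|\mathbf j_{m-2}|+\gamma_{[o+1;o+m-1]})}} .$$ Put $\psi_o^{(1)}(p)=\prod_{\ell=1}^p\sqrt{\sigma_\ell^{(\gamma_{o+1})}}\,|p\rangle_{\gamma_{o+1}}$ and $\psi_o^{(m)}(j_1,\dots,j_{m-1},p)=\mathcal E^{\mathbf j}_{o,m}\big(\psi_o^{(m-1)}(j_1,\dots,j_{m-2},\cdot),p\big)$. With $\mathbf h=(j_1,\dots,j_{i-1})$, $\mathbf k=(j_i,\dots,j_{i+r-2})$, $s=j_{i+r-1}$, and with $|\mathbf h|,|\mathbf k|$ the sums of their entries, put $$\Theta^{(i,r,1)}(j_1,\dots,j_{i+r-1},t)=(A_+)_{[1;i+r]}^t\sum_{p=0}^s(-1)^p\frac{\beta_{s-p+1}\cdots\beta_s}{\alpha_1\cdots\alpha_p}\,\psi_0^{(i)}(\mathbf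 h,p)\otimes\psi_i^{(r)}(\mathbf k,s-p),$$ $\alpha_p=(-1)^{|\mathbf k|+s-p}q^{\frac12(\gamma_{[i+1;i+r]}+s-p+|\mathbf k|)}\sigma_p^{(|\mathbf h|+\gamma_{[1;i]})}$, $\beta_p=q^{-\frac12(\gamma_{[1;i]}+s-p+|\mathbf h|)}\sigma_p^{(|\mathbf k|+\gamma_{[i+1;i+r]})}$, and $\Theta^{(i,r,d+1)}(j_1,\dots,j_{i+r+d-1},N)=\mathcal E^{\mathbf j}_{0,i+r+d}\big(\Theta^{(i,r,d)}(j_1,\dots,j_{i+r+d-2},\cdot),N\big)$ for $d\geq 1$. For $\mathbf j\in\mathbb N^{n-1}$ let $|\mathbf j^{(i,r)}\rangle=\eta_{\mathbf j}\,\Theta^{(i,r,n-i-r+1)}(\mathbf j,0)$, where $\eta_{\mathbf j}$ is any constant with $\langle\mathbf j^{(i,r)}|\mathbf j^{(i,r)}\rangle=1$ (so it is determined up to sign). **Connection coefficients.** For $\mathbf j'=\mathbf j^{(i,k+1)}$ and $0\le x\le j'_{i+k-1}+j'_{i+k}$ let $\mathbf j'[x]$ be $\mathbf j'$ with the entries $i+k-1,\,i+k$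 replaced by $x,\ j'_{i+k-1}+j'_{i+k}-x$. Let $\omega_{\mathbf j'}=\langle\mathbf j'^{(i,k+1)}|\mathbf j'[0]^{(i,k)}\rangle$ and $G_x(\mathbf j')=\langle\mathbf j'^{(i,k+1)}|\mathbf j'[x]^{(i,k)}\rangle/\omega_{\mathbf j'}$. For $\mathbf j=\mathbf j^{(i,k)}$ put $$\begin{aligned} a&=(-q)^{|\mathbf j_{i+k-2}|-|\mathbf j_{i-1}|}q^{\gamma_{[i+1;i+k+1]}-\frac12},& b&=-(-q)^{-|\mathbf j_{i+k}|+|\mathbf j_{i-1}|}q^{-\gamma_{[i+1;i+k+1]}+\frac12},\\ c&=-(-q)^{|\mathbf j_{i+k}|+|\mathbf j_{i-1}|}q^{2\gamma_{[1;i]}+\gamma_{[i+1;i+k+1]}-\frac12},& d&=(-q)^{|\mathbf j_{i+k-2}|-|\mathbf j_{i-1}|}q^{\gamma_{[i+1;i+k]}-\gamma_{i+k+1}+\frac12}, \end{aligned}$$ $$A_s=-\frac{(1+(-q)^sab)(1-(-q)^sac)(1-(-q)^sad)(1-(-q)^{s-1}abcd)}{a(1-(-q)^{2s-1}abcd)(1-(-q)^{2s}abcd)},$$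 $$C_s=\frac{a(1-(-q)^s)(1-(-q)^{s-1}bc)(1-(-q)^{s-1}bd)(1+(-q)^{s-1}cd)}{(1-(-q)^{2s-2}abcd)(1-(-q)^{2s-1}abcd)} .$$ For $j_{i+k-1}\ge1$ let $\mathbf j-\mathbf h_{i+k-1}$ be $\mathbf j$ with $j_{i+k-1}$ lowered and $j_{i+k}$ raised by $1$. In the renormalization $$\widehat G_x(\mathbf j')=(-a)^x\Big(\prod_{\ell=1}^x\sqrt{A_{\ell-1}C_\ell}\Big)G_x(\mathbf j')\qquad(\mathbf j=\mathbf j'[x])$$ the square roots are those of the tridiagonal action: $\sqrt{A_{\ell-1}C_\ell}=(q-q^{-1})\,\langle\mathbf j-\mathbf h_{i+k-1}|\,\Gamma^q_{[i+1;i+k+1]}\,|\mathbf j\rangle$ for $\mathbf j=\mathbf j'[\ell]$, with both vectors in the basis $|\cdot^{(i,k)}\rangle$. With $(a;p)_m=\prod_{l=0}^{m-1}(1-ap^l)$, $(a_1,\dots,a_s;p)_m=\prod_{l=1}^s(a_l;p)_m$, the $p$-Racah polynomial is $$r_m(x;a,b,c,N|p)=(ap,bcp,p^{-N};p)_m\Big(\frac{p^N}{c}\Big)^{\frac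 m2}{}_4\phi_3\!\left(\begin{matrix}p^{-m},abp^{m+1},p^{-x},cp^{x-N}\\ ap,bcp,p^{-N}\end{matrix}\Big|\,p,p\right).$$ **Proposition.** 1. Normalization constants exist for both families. Whatever they are, $|\mathbf j^{(i,r)}\rangle$ ($r\in\{k,k+1\}$) is a joint eigenvector of the generators of $\mathcal Y_{i,r}$: $\Gamma^q_{[1;m]}$ has the eigenvalue $(-1)^{|\mathbf j_{m-1}|}\big[|\mathbf j_{m-1}|+\gamma_{[1;m]}-\frac12\big]_q$ and $\Gamma^q_{[i+1;i+m]}$ has the eigenvalue $(-1)^{|\mathbf j_{i+m-2}|-|\mathbf j_{i-1}|}\big[|\mathbf j_{i+m-2}|-|\mathbf j_{i-1}|+\gamma_{[i+1;i+m]}-\frac12\big]_q$; moreover $K_{[1;n]}$ has the eigenvalue $q^{\frac12(|\mathbf j_{n-1}|+\gamma_{[1;n]})}$. 2. For all $\mathbf j$ with $j_{i+k-1}\ge1$ the number $(q-q^{-1})\langle\mathbf j-\mathbf h_{i+k-1}|\Gamma^q_{[i+1;i+k+1]}|\mathbf j\rangle$ is a square root of $A_{\ell-1}C_\ell$, $\ell=j_{i+k-1}$;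 and for every prescribed choice of these square roots (for instance the principal ones) there are normalization constants of the $(i,k)$-family for which it is the prescribed one. 3. For all normalization constants, and all $\mathbf j=\mathbf j^{(i,k)}$, $\mathbf j'=\mathbf j^{(i,k+1)}$ with $j_\ell=j'_\ell$ for $\ell\ne i+k-1,i+k$ and $j_{i+k-1}+j_{i+k}=j'_{i+k-1}+j'_{i+k}$, one has $\omega_{\mathbf j'}\neq0$ and $$\widehat G_{j_{i+k-1}}(\mathbf j')=F_{i,k}\;r_{j'_{i+k-1}}\big(j_{i+k-1};\gamma,\delta,\beta,\widetilde N\,\big|\,-q\big),$$ where $\widetilde N=|\mathbf j_{i+k}|-|\mathbf j_{i+k-2}|$, $\beta=q^{-1}cd$, $\gamma=-q^{-1}ad$, $\delta=-a/d$ and $$F_{i,k}=\frac{\big(\beta(-q)^{-\widetilde N}\big)^{j'_{i+k-1}/2}}{\big(\beta(-q)^{-j_{i+k}};-q\big)_{j_{i+k-1}}}\;\frac{\big(-\gamma q,-\beta\delta q,(-q)^{-\widetilde N};-q\big)_{j_{i+k-1}}}{\big(-\gamma q,-\beta\delta q,(-q)^{-\widetilde N};-q\big)_{j'_{i+k-1}}}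 .$$ Here the half-integer powers in $F_{i,k}$ and in $r_{j'_{i+k-1}}$ are read as $\rho^{\,j'_{i+k-1}}$ and $(\rho^{-1})^{\,j'_{i+k-1}}$, with the same, arbitrary, square root $\rho$ of $\beta(-q)^{-\widetilde N}$. -/

import Mathlib

noncomputable section

namespace QBI

open MvPolynomial

/-! ## Scalars

A complex number `q` is given through a logarithm `L`, so `q = exp L`, and `q ^ z` means
`exp (L * z)` for every complex exponent `z`. -/

/-- `q ^ z`. -/
def qpow (L z : ℂ) : ℂ := Complex.exp (L * z)

/-- `q` itself. -/
def qq (L : ℂ) : ℂ := Complex.exp L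

/-- The `q`-number `[z]_q = (q ^ z - q ^ (-z)) / (q - q⁻¹)`. -/
def qnum (L z : ℂ) : ℂ := (qpow L z - qpow L (-z)) / (qq L - (qq L)⁻¹)

/-- `σ_m^{(g)} = [m + g - 1/2]_q - (-1)^m [g - 1/2]_q`. -/
def sigma (L : ℂ) (m : ℕ) (g : ℝ) : ℂ :=
  qnum L ((m : ℂ) + (g : ℂ) - 1 / 2) - (-1) ^ m * qnum L ((g : ℂ) - 1 / 2)

/-- `γ_{[a;b]} = γ_a + ⋯ + γ_b`. -/
def gsum (γ : ℕ → ℝ) (a b : ℕ) : ℝ := ∑ l ∈ Finset.Icc a b, γ l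

/-- `|j_m| = j_1 + ⋯ + j_m`. -/
def psum (j : ℕ → ℕ) (m : ℕ) : ℕ := ∑ l ∈ Finset.Icc 1 m, j l

/-! ## The coupled module

`W^{(γ)}` has the basis `|m⟩`, `m ∈ ℕ`, so `W^{(γ_a)} ⊗ ⋯ ⊗ W^{(γ_b)}` has the basis
`|m_a⟩ ⊗ ⋯ ⊗ |m_b⟩`. The latter vector is written as the monomial `X_a ^ m_a ⋯ X_b ^ m_b`; the tensor
product of two vectors that live on disjoint sets of positions is then their product, and the coupled
module of the positions `1, …, n` is the span of the monomials in `X_1, …, X_n`. The monomials in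
all the `X_l` together span the space `Fock`, on which every operator below acts as the identity on
the tensor factors outside its set of positions. -/

/-- The space spanned by all the monomials `|m⟩ = |m_1⟩ ⊗ |m_2⟩ ⊗ ⋯` (finitely many `m_l ≠ 0`). -/
abbrev Fock : Type := MvPolynomial ℕ ℂ

/-- The basis vector `|m_1⟩ ⊗ |m_2⟩ ⊗ ⋯`. -/
def bvec (m : ℕ →₀ ℕ) : Fock := monomial m (1 : ℂ)

/-- The linear operator with prescribed values on the basis vectors. -/
def onBasis (f : (ℕ →₀ ℕ) → Fock) : Module.End ℂ Fock :=
  (basisMonomials ℕ ℂ).constr ℂ f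

/-- The bilinear form for which the basis vectors are orthonormal. On vectors with real coordinates
it is the inner product. -/
def pair (v w : Fock) : ℂ := ∑ m ∈ v.support, v.coeff m * w.coeff m

/-- `K` on the positions in `S` (tensor product of the operators `K |m⟩ = q^{(m+γ)/2} |m⟩`). -/
def opK (L : ℂ) (γ : ℕ → ℝ) (S : Finset ℕ) : Module.End ℂ Fock :=
  onBasis fun m => qpow L ((1 / 2) * ∑ t ∈ S, ((m t : ℂ) + (γ t : ℂ))) • bvec m

/-- `K⁻¹` on the positions in `S`. -/
def opKinv (L : ℂ) (γ : ℕ → ℝ) (S : Finset ℕ) : Module.End ℂ Fock :=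
  onBasis fun m => qpow L (-((1 / 2) * ∑ t ∈ S, ((m t : ℂ) + (γ t : ℂ)))) • bvec m

/-- `P` on the positions in `S` (tensor product of the operators `P |m⟩ = (-1)^m |m⟩`). -/
def opP (S : Finset ℕ) : Module.End ℂ Fock :=
  onBasis fun m => ((-1 : ℂ) ^ (∑ t ∈ S, m t)) • bvec m

/-- `A₊` at the position `l`: `A₊ |m⟩ = √σ_{m+1} |m+1⟩`. -/
def siteUp (L : ℂ) (γ : ℕ → ℝ) (l : ℕ) : Module.End ℂ Fock :=
  onBasis fun m => Complex.sqrt (sigma L (m l + 1) (γ l)) • bvec (m + Finsupp.single l 1)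

/-- `A₋` at the position `l`: `A₋ |m⟩ = √σ_m |m-1⟩` (which is zero for `m = 0`, since `σ_0 = 0`). -/
def siteDown (L : ℂ) (γ : ℕ → ℝ) (l : ℕ) : Module.End ℂ Fock :=
  onBasis fun m => Complex.sqrt (sigma L (m l) (γ l)) • bvec (m - Finsupp.single l 1)

/-- `(A₊)_{[a;b]} = ∑_l K⁻¹ ⊗ ⋯ ⊗ K⁻¹ ⊗ A₊ ⊗ KP ⊗ ⋯ ⊗ KP`, with `A₊` at the position `l`:
the iterated coproduct of `A₊`. -/
def opUp (L : ℂ) (γ : ℕ → ℝ) (a b : ℕ) : Module.End ℂ Fock :=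
  ∑ l ∈ Finset.Icc a b,
    opKinv L γ (Finset.Ico a l) * siteUp L γ l * (opK L γ (Finset.Ioc l b) * opP (Finset.Ioc l b))

/-- `(A₋)_{[a;b]}`, the iterated coproduct of `A₋`. -/
def opDown (L : ℂ) (γ : ℕ → ℝ) (a b : ℕ) : Module.End ℂ Fock :=
  ∑ l ∈ Finset.Icc a b,
    opKinv L γ (Finset.Ico a l) * siteDown L γ l * (opK L γ (Finset.Ioc l b) * opP (Finset.Ioc l b))

/-- The operator `Γ_{[a;b]}^q`, the iterated coproduct of the Casimir element
`(-A₊ A₋ + (q^{-1/2} K² - q^{1/2} K⁻²) / (q - q⁻¹)) P`. -/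
def opGamma (L : ℂ) (γ : ℕ → ℝ) (a b : ℕ) : Module.End ℂ Fock :=
  (-(opUp L γ a b * opDown L γ a b)
    + (qpow L (-(1 / 2)) / (qq L - (qq L)⁻¹)) • opK L γ (Finset.Icc a b) ^ 2
    - (qpow L (1 / 2) / (qq L - (qq L)⁻¹)) • opKinv L γ (Finset.Icc a b) ^ 2)
  * opP (Finset.Icc a b)

/-! ## The joint eigenvectors

An index vector `(j_1, …, j_{n-1})` is a sequence `j : ℕ → ℕ` of which only these entries matter. -/

/-- The coefficient `c_k` (also called `d_k`, `e_k`) of the step that couples the positions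
`o+1, …, o+m-1` with the position `o+m`. -/
def coupleCoeff (L : ℂ) (γ : ℕ → ℝ) (o m : ℕ) (j : ℕ → ℕ) (k : ℕ) : ℂ :=
  (-1) ^ (k * j (m - 1) + k * (k - 1) / 2)
    * qpow L (-((k : ℂ) / 2) * ((psum j (m - 1) : ℂ) + (gsum γ (o + 1) (o + m) : ℂ) - 1))
    * ∏ l ∈ Finset.range k,
        (Complex.sqrt (sigma L (j (m - 1) - l) (γ (o + m)))
          / sigma L (l + 1) ((psum j (m - 2) : ℝ) + gsum γ (o + 1) (o + m - 1)))

/-- The coupling step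
`(A₊)_{[o+1;o+m]}^p ∑_{k ≤ j_{m-1}} c_k f(k) ⊗ |j_{m-1} - k⟩_{γ_{o+m}}`. -/
def coupleStep (L : ℂ) (γ : ℕ → ℝ) (o m : ℕ) (j : ℕ → ℕ) (f : ℕ → Fock) (p : ℕ) : Fock :=
  (opUp L γ (o + 1) (o + m) ^ p)
    (∑ k ∈ Finset.range (j (m - 1) + 1),
      coupleCoeff L γ o m j k • (f k * (X (o + m)) ^ (j (m - 1) - k)))

/-- The vector `ψ^{(m)}(j_1, …, j_{m-1}, p)` on the positions `o+1, …, o+m`. The offset `o = 0` gives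
the vectors `ψ^{(i)}`, the offset `o = i` gives the vectors `φ^{(r)}`. The value at `m = 0` is
never used. -/
def psi (L : ℂ) (γ : ℕ → ℝ) (o : ℕ) : ℕ → (ℕ → ℕ) → ℕ → Fock
  | 0, _, _ => 0
  | 1, _, p => (∏ l ∈ Finset.Icc 1 p, Complex.sqrt (sigma L l (γ (o + 1)))) • (X (o + 1)) ^ p
  | m + 2, j, p => coupleStep L γ o (m + 2) j (psi L γ o (m + 1) j) p

/-- The coefficient `α_p`, with `H = |h|`, `κ = |k|`. -/
def alphaCoeff (L : ℂ) (γ : ℕ → ℝ) (i r H κ s p : ℕ) : ℂ :=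
  (-1) ^ (κ + s - p)
    * qpow L ((1 / 2) * ((gsum γ (i + 1) (i + r) : ℂ) + (s : ℂ) - (p : ℂ) + (κ : ℂ)))
    * sigma L p ((H : ℝ) + gsum γ 1 i)

/-- The coefficient `β_{p}`, with `H = |h|`, `κ = |k|`. -/
def betaCoeff (L : ℂ) (γ : ℕ → ℝ) (i r H κ s p : ℕ) : ℂ :=
  qpow L (-(1 / 2) * ((gsum γ 1 i : ℂ) + (s : ℂ) - (p : ℂ) + (H : ℂ)))
    * sigma L p ((κ : ℝ) + gsum γ (i + 1) (i + r))

/-- `ε_p = (-1)^p (β_{s-p+1} ⋯ β_s) / (α_1 ⋯ α_p)`. -/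
def epsCoeff (L : ℂ) (γ : ℕ → ℝ) (i r H κ s p : ℕ) : ℂ :=
  (-1) ^ p * (∏ l ∈ Finset.Icc (s - p + 1) s, betaCoeff L γ i r H κ s l)
    / ∏ l ∈ Finset.Icc 1 p, alphaCoeff L γ i r H κ s l

/-- `Ψ^{(i,r)}(h, k, s, t)` with `h = (j_1, …, j_{i-1})`, `k = (j_i, …, j_{i+r-2})`, `s = j_{i+r-1}`. -/
def bigPsi (L : ℂ) (γ : ℕ → ℝ) (i r : ℕ) (j : ℕ → ℕ) (t : ℕ) : Fock :=
  (opUp L γ 1 (i + r) ^ t)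
    (∑ p ∈ Finset.range (j (i + r - 1) + 1),
      epsCoeff L γ i r (psum j (i - 1)) (∑ l ∈ Finset.Icc i (i + r - 2), j l) (j (i + r - 1)) p
        • (psi L γ 0 i j p * psi L γ i r (fun l => j (i - 1 + l)) (j (i + r - 1) - p)))

/-- `Θ^{(i,r,d+1)}(j_1, …, j_{i+r+d-1}, N)`, a vector on the positions `1, …, i+r+d`. -/
def theta (L : ℂ) (γ : ℕ → ℝ) (i r : ℕ) (j : ℕ → ℕ) : ℕ → ℕ → Fock
  | 0, N => bigPsi L γ i r j N
  | d + 1, N => coupleStep L γ 0 (i + r + d + 1) j (theta L γ i r j d) N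

/-- The vector `|j^{(i,r)}⟩ = |j^{(i,r)}; 0⟩` of `W^{(γ_1)} ⊗ ⋯ ⊗ W^{(γ_n)}` for the family
`η` of normalization constants. -/
def ket (L : ℂ) (γ : ℕ → ℝ) (n i r : ℕ) (η : (ℕ → ℕ) → ℂ) (j : ℕ → ℕ) : Fock :=
  η j • theta L γ i r j (n - i - r) 0

/-- The constants `η` normalize all the vectors `|j^{(i,r)}⟩`. -/
def IsNormalization (L : ℂ) (γ : ℕ → ℝ) (n i r : ℕ) (η : (ℕ → ℕ) → ℂ) : Prop :=
  ∀ j : ℕ → ℕ, pair (ket L γ n i r η j) (ket L γ n i r η j) = 1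

/-- `v` is a joint eigenvector of the generators of `𝒴_{i,r}` and of `K_{[1;n]}`, for the eigenvalues
that belong to the index vector `j`. -/
def IsJointEigenvector (L : ℂ) (γ : ℕ → ℝ) (n i r : ℕ) (j : ℕ → ℕ) (v : Fock) : Prop :=
  (∀ m ∈ Finset.Icc 2 n, (m ≤ i ∨ i + r ≤ m) →
    opGamma L γ 1 m v
      = ((-1) ^ psum j (m - 1)
          * qnum L ((psum j (m - 1) : ℂ) + (gsum γ 1 m : ℂ) - 1 / 2)) • v) ∧
  (∀ m ∈ Finset.Icc 2 r,
    opGamma L γ (i + 1) (i + m) v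
      = ((-1) ^ (psum j (i + m - 2) - psum j (i - 1))
          * qnum L ((psum j (i + m - 2) : ℂ) - (psum j (i - 1) : ℂ)
              + (gsum γ (i + 1) (i + m) : ℂ) - 1 / 2)) • v) ∧
  opK L γ (Finset.Icc 1 n) v
    = qpow L ((1 / 2) * ((psum j (n - 1) : ℂ) + (gsum γ 1 n : ℂ))) • v

/-! ## Connection coefficients -/

/-- `j` with the entry `i+k-1` replaced by `x` and the entry `i+k` adjusted so that the sum of the two
stays the same (used for `x ≤ j_{i+k-1} + j_{i+k}`). -/
def reindex (i k : ℕ) (j : ℕ → ℕ) (x : ℕ) : ℕ → ℕ :=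
  Function.update (Function.update j (i + k - 1) x) (i + k) (j (i + k - 1) + j (i + k) - x)

/-- `ω_{j'}`, the connection coefficient of `j' = j^{(i,k+1)}` with the vector of the other basis whose
entry `i+k-1` is zero. -/
def omega (L : ℂ) (γ : ℕ → ℝ) (n i k : ℕ) (η η' : (ℕ → ℕ) → ℂ) (j' : ℕ → ℕ) : ℂ :=
  pair (ket L γ n i (k + 1) η' j') (ket L γ n i k η (reindex i k j' 0))

/-- `G_x(j^{(i,k+1)})`, so that `⟨j^{(i,k+1)}|j^{(i,k)}⟩ = ω G_x` with `x = j^{(i,k)}_{i+k-1}`. -/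
def connG (L : ℂ) (γ : ℕ → ℝ) (n i k : ℕ) (η η' : (ℕ → ℕ) → ℂ) (x : ℕ) (j' : ℕ → ℕ) : ℂ :=
  pair (ket L γ n i (k + 1) η' j') (ket L γ n i k η (reindex i k j' x)) / omega L γ n i k η η' j'

/-- `a^{(i,k)}`. -/
def parA (L : ℂ) (γ : ℕ → ℝ) (i k : ℕ) (j : ℕ → ℕ) : ℂ :=
  (-qq L) ^ ((psum j (i + k - 2) : ℤ) - (psum j (i - 1) : ℤ))
    * qpow L ((gsum γ (i + 1) (i + k + 1) : ℂ) - 1 / 2)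

/-- `b^{(i,k)}`. -/
def parB (L : ℂ) (γ : ℕ → ℝ) (i k : ℕ) (j : ℕ → ℕ) : ℂ :=
  -(-qq L) ^ (-(psum j (i + k) : ℤ) + (psum j (i - 1) : ℤ))
    * qpow L (-(gsum γ (i + 1) (i + k + 1) : ℂ) + 1 / 2)

/-- `c^{(i,k)}`. -/
def parC (L : ℂ) (γ : ℕ → ℝ) (i k : ℕ) (j : ℕ → ℕ) : ℂ :=
  -(-qq L) ^ ((psum j (i + k) : ℤ) + (psum j (i - 1) : ℤ))
    * qpow L (2 * (gsum γ 1 i : ℂ) + (gsum γ (i + 1) (i + k + 1) : ℂ) - 1 / 2)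

/-- `d^{(i,k)}`. -/
def parD (L : ℂ) (γ : ℕ → ℝ) (i k : ℕ) (j : ℕ → ℕ) : ℂ :=
  (-qq L) ^ ((psum j (i + k - 2) : ℤ) - (psum j (i - 1) : ℤ))
    * qpow L ((gsum γ (i + 1) (i + k) : ℂ) - (γ (i + k + 1) : ℂ) + 1 / 2)

/-- `A_s` as a function of `p = -q` and `a, b, c, d`. -/
def coefA (p a b c d : ℂ) (s : ℤ) : ℂ :=
  -((1 + p ^ s * a * b) * (1 - p ^ s * a * c) * (1 - p ^ s * a * d) * (1 - p ^ (s - 1) * a * b * c * d))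
    / (a * (1 - p ^ (2 * s - 1) * a * b * c * d) * (1 - p ^ (2 * s) * a * b * c * d))

/-- `C_s` as a function of `p = -q` and `a, b, c, d`. -/
def coefC (p a b c d : ℂ) (s : ℤ) : ℂ :=
  a * (1 - p ^ s) * (1 - p ^ (s - 1) * b * c) * (1 - p ^ (s - 1) * b * d) * (1 + p ^ (s - 1) * c * d)
    / ((1 - p ^ (2 * s - 2) * a * b * c * d) * (1 - p ^ (2 * s - 1) * a * b * c * d))

/-- The number `A_{s-1} C_s` for `s = j_{i+k-1}`, where `j = j^{(i,k)}`. -/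
def prodAC (L : ℂ) (γ : ℕ → ℝ) (i k : ℕ) (j : ℕ → ℕ) : ℂ :=
  coefA (-qq L) (parA L γ i k j) (parB L γ i k j) (parC L γ i k j) (parD L γ i k j)
      ((j (i + k - 1) : ℤ) - 1)
    * coefC (-qq L) (parA L γ i k j) (parB L γ i k j) (parC L γ i k j) (parD L γ i k j)
      (j (i + k - 1) : ℤ)

/-- `(q - q⁻¹) U_j`, where `U_j = ⟨j - 𝐡_{i+k-1}| Γ_{[i+1;i+k+1]} |j⟩` is the coefficient of
`|j - 𝐡_{i+k-1}⟩` in the tridiagonal action on the basis `|j^{(i,k)}⟩`, with `j_{i+k-1} ≥ 1`. -/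
def rootAC (L : ℂ) (γ : ℕ → ℝ) (n i k : ℕ) (η : (ℕ → ℕ) → ℂ) (j : ℕ → ℕ) : ℂ :=
  (qq L - (qq L)⁻¹)
    * pair (ket L γ n i k η (reindex i k j (j (i + k - 1) - 1)))
        (opGamma L γ (i + 1) (i + k + 1) (ket L γ n i k η j))

/-- The renormalized coefficient `Ĝ_x(j^{(i,k+1)})`, where `x = j_{i+k-1}`, `j = j^{(i,k)}` and
`j' = j^{(i,k+1)}`. The number `R j` is the square root of `A_{s-1} C_s`, `s = j_{i+k-1}`, in use. -/
def connGhat (L : ℂ) (γ : ℕ → ℝ) (n i k : ℕ) (η η' : (ℕ → ℕ) → ℂ) (R : (ℕ → ℕ) → ℂ)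
    (j j' : ℕ → ℕ) : ℂ :=
  (-parA L γ i k j) ^ j (i + k - 1)
    * (∏ l ∈ Finset.Icc 1 (j (i + k - 1)), R (reindex i k j l))
    * connG L γ n i k η η' (j (i + k - 1)) j'

/-! ## The `(-q)`-Racah polynomials -/

/-- The `p`-Pochhammer symbol `(a;p)_n`. -/
def poch (p a : ℂ) (n : ℕ) : ℂ := ∏ l ∈ Finset.range n, (1 - a * p ^ l)

/-- The basic hypergeometric series `₄φ₃`. -/
def phi43 (a₁ a₂ a₃ a₄ b₁ b₂ b₃ p z : ℂ) : ℂ :=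
  ∑' t : ℕ, (poch p a₁ t * poch p a₂ t * poch p a₃ t * poch p a₄ t)
    / (poch p b₁ t * poch p b₂ t * poch p b₃ t * poch p p t) * z ^ t

/-- The `p`-Racah polynomial `r_n(x; a, b, c, N | p)`, where `ρ` is the square root of `p ^ N / c` by
which the factor `(p ^ N / c)^{n/2}` is read as `ρ ^ n`. -/
def racah (p : ℂ) (n x : ℕ) (a b c : ℂ) (N : ℕ) (ρ : ℂ) : ℂ :=
  poch p (a * p) n * poch p (b * c * p) n * poch p (p ^ (-(N : ℤ))) n * ρ ^ n
    * phi43 (p ^ (-(n : ℤ))) (a * b * p ^ (n + 1)) (p ^ (-(x : ℤ))) (c * p ^ ((x : ℤ) - (N : ℤ)))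
        (a * p) (b * c * p) (p ^ (-(N : ℤ))) p p

/-- `β^{(i,k)} = q⁻¹ c d`. -/
def parBeta (L : ℂ) (γ : ℕ → ℝ) (i k : ℕ) (j : ℕ → ℕ) : ℂ :=
  (qq L)⁻¹ * parC L γ i k j * parD L γ i k j

/-- `γ^{(i,k)} = -q⁻¹ a d`. -/
def parGamma (L : ℂ) (γ : ℕ → ℝ) (i k : ℕ) (j : ℕ → ℕ) : ℂ :=
  -(qq L)⁻¹ * parA L γ i k j * parD L γ i k j

/-- `δ^{(i,k)} = -a / d`. -/
def parDelta (L : ℂ) (γ : ℕ → ℝ) (i k : ℕ) (j : ℕ → ℕ) : ℂ :=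
  -(parA L γ i k j / parD L γ i k j)

/-- `Ñ^{(i,k)} = |j_{i+k}| - |j_{i+k-2}|`, a sum of two entries of `j`, in particular not negative. -/
def parN (i k : ℕ) (j : ℕ → ℕ) : ℕ := psum j (i + k) - psum j (i + k - 2)

/-- The proportionality coefficient `F_{i,k}`, with `j = j^{(i,k)}`, `j' = j^{(i,k+1)}`; `ρ` is the square
root of `β (-q)^{-Ñ}` by which the half-integer power in it is read. -/
def factorF (L : ℂ) (γ : ℕ → ℝ) (i k : ℕ) (j j' : ℕ → ℕ) (ρ : ℂ) : ℂ :=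
  let p : ℂ := -qq L
  let u : ℂ := -parGamma L γ i k j * qq L
  let v : ℂ := -parBeta L γ i k j * parDelta L γ i k j * qq L
  let w : ℂ := p ^ (-(parN i k j : ℤ))
  let x : ℕ := j (i + k - 1)
  let x' : ℕ := j' (i + k - 1)
  ρ ^ x' / poch p (parBeta L γ i k j * p ^ (-(j (i + k) : ℤ))) x
    * ((poch p u x * poch p v x * poch p w x) / (poch p u x' * poch p v x' * poch p w x'))

end QBI

end

/-!
The idea is that all vectors in the statement are lowest weight vectors, so that everything reduces
to three coupled lowest weight modules, where two overlapping Casimir operators form a Leonard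
pair.

The operators on one position satisfy the relations of `osp_q(1|2)` (`OspRel`, `ospRel_site`), and
so do the iterated coproducts on every interval (`ospRel_interval`). Hence `Γ` on an interval
commutes with `A₊` and `A₋` on every larger interval (`opGamma_commute_opUp`,
`opGamma_commute_opDown`). A coupling step turns lowest weight sequences `v p = A₊^p v 0`,
`A₋ v 0 = 0`, into another one: the two explicit families of coefficients are solutions of one and
the same two-term recursion (`isCoupling_stepCoeff`, `isCoupling_epsCoeff`, `isLW_coupled`). On a
lowest weight sequence `Γ` is the scalar that the degree prescribes, so the vectors are joint
eigenvectors (`isJointEigenvector_ket`). They are not isotropic, since inside a product of two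
lowest weight modules the descendants of the coupled vectors are eigenvectors with distinct
eigenvalues (`casimir_eigenvalue_injective`, `form_coupled_ne_zero`); so normalizations exist.

The outer coupling steps, common to both families, multiply the bilinear form by a constant
(`exists_form_outer`). What remains is the space of lowest weight vectors of given degree in a
product of three lowest weight modules, with `S = Γ_{[1;i+k]}` diagonal in one basis and
`T = Γ_{[i+1;i+k+1]}` in the other. In the coordinates `zeta`, the pairings with the vectors
`v x ⊗ u 0 ⊗ t (N - x)`, both operators are bidiagonal, in opposite directions (`SplitPair`,
`splitPair_lowestTrip`). This alone determines the entries of the symmetric tridiagonal matrix of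
`T` in the orthonormal eigenbasis of `S`, the off-diagonal ones up to sign
(`SplitPair.matrix_self`, `SplitPair.matrix_succ_sq`). With the explicit coefficients they become
the numbers `A_s` and `C_s` (`IsRacahData`, `isRacahData`). All divisions in this step are by
numbers of the form `1 - z` with `|z|` a nonzero power of `|q|`, by `γ > 1/2` and `|q| ≠ 1`
(`HasDeg`).

The pairings of an eigenvector of `T` with the eigenbasis of `S` therefore satisfy a three-term
recursion. It is the difference equation of the `p`-Racah polynomials with `p = -q`
(`racSum_difference`, `racah_recursion`, `form_eq_racSum`, `racah_eq_racSum`), which gives the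
connection coefficients (`connGhat_eq`). Along a chain of index vectors the signs of the basis
vectors can be chosen one after the other, which realizes every choice of the square roots
(`exists_rootAC_eq`).
-/

noncomputable section

namespace QBI

open MvPolynomial

/-! ### The quantum superalgebra relations -/

section Osp

variable {A : Type*} [Ring A] [Algebra ℂ A]

/-- The defining relations of `osp_q(1|2)` with `s = q^{1/2}`, for elements of an algebra that stand
for `A₊`, `A₋`, `K`, `K⁻¹` and `P`. -/
structure OspRel (s : ℂ) (E F K K' P : A) : Prop where
  KK' : K * K' = 1
  K'K : K' * K = 1
  KP : K * P = P * K
  PP : P * P = 1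
  KE : K * E = s • (E * K)
  KF : K * F = s⁻¹ • (F * K)
  PE : P * E = -(E * P)
  PF : P * F = -(F * P)
  EF : E * F + F * E = ((s + s⁻¹) / (s ^ 2 - (s ^ 2)⁻¹)) • (K * K - K' * K')

namespace OspRel

variable {s : ℂ} {E F K K' P : A}

lemma K'P (h : OspRel s E F K K' P) : K' * P = P * K' := by
  calc K' * P = K' * (P * (K * K')) := by rw [h.KK', mul_one]
    _ = K' * (K * P) * K' := by rw [h.KP]; simp only [mul_assoc]
    _ = P * K' := by rw [← mul_assoc K' K, h.K'K, one_mul]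

lemma K'E (h : OspRel s E F K K' P) (hs : s ≠ 0) : K' * E = s⁻¹ • (E * K') := by
  have : E * K' = s • (K' * E) := by
    calc E * K' = K' * (K * E) * K' := by rw [← mul_assoc K' K, h.K'K, one_mul]
      _ = s • (K' * E) := by
        rw [h.KE]; simp only [mul_smul_comm, smul_mul_assoc, mul_assoc, h.KK', mul_one]
  rw [this, smul_smul, inv_mul_cancel₀ hs, one_smul]

lemma K'F (h : OspRel s E F K K' P) (hs : s ≠ 0) : K' * F = s • (F * K') := by
  have : F * K' = s⁻¹ • (K' * F) := by
    calc F * K' = K' * (K * F) * K' := by rw [← mul_assoc K' K, h.K'K, one_mul]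
      _ = s⁻¹ • (K' * F) := by
        rw [h.KF]; simp only [mul_smul_comm, smul_mul_assoc, mul_assoc, h.KK', mul_one]
  rw [this, smul_smul, mul_inv_cancel₀ hs, one_smul]

end OspRel

/-- The Casimir element `Γ = (-A₊ A₋ + (q^{-1/2} K² - q^{1/2} K⁻²) / (q - q⁻¹)) P`. -/
def casimir (s : ℂ) (E F K K' P : A) : A :=
  (-(E * F) + (s⁻¹ / (s ^ 2 - (s ^ 2)⁻¹)) • K ^ 2 - (s / (s ^ 2 - (s ^ 2)⁻¹)) • K' ^ 2) * P

section Casimir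

variable {s : ℂ} {E F K K' P : A}

lemma OspRel.casimir_E (h : OspRel s E F K K' P) (hs : s ≠ 0) :
    Commute (casimir s E F K K' P) E := by
  have KE := h.KE
  have K'E := h.K'E hs
  have KE' : ∀ x, K * (E * x) = s • (E * (K * x)) := fun x => by
    rw [← mul_assoc, h.KE, smul_mul_assoc, mul_assoc]
  have K'E' : ∀ x, K' * (E * x) = s⁻¹ • (E * (K' * x)) := fun x => by
    rw [← mul_assoc, K'E, smul_mul_assoc, mul_assoc]
  have e : E * (F * (E * P)) = -(E * (E * (F * P)))
      + E * ((((s + s⁻¹) / (s ^ 2 - (s ^ 2)⁻¹)) • (K * K - K' * K')) * P) := by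
    rw [← h.EF]; noncomm_ring
  simp only [mul_sub, sub_mul, smul_mul_assoc, mul_smul_comm, mul_assoc] at e
  unfold casimir Commute SemiconjBy
  simp only [pow_two, add_mul, sub_mul, mul_add, mul_sub, neg_mul, mul_neg, smul_mul_assoc,
    mul_smul_comm, mul_assoc, h.PE, KE', K'E', e, smul_smul, smul_neg]
  have h1 : s * s ≠ 0 := mul_ne_zero hs hs
  match_scalars <;> field_simp <;> ring

lemma OspRel.casimir_F (h : OspRel s E F K K' P) (hs : s ≠ 0) :
    Commute (casimir s E F K K' P) F := by
  have KF' : ∀ x, K * (F * x) = s⁻¹ • (F * (K * x)) := fun x => by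
    rw [← mul_assoc, h.KF, smul_mul_assoc, mul_assoc]
  have K'F' : ∀ x, K' * (F * x) = s • (F * (K' * x)) := fun x => by
    rw [← mul_assoc, h.K'F hs, smul_mul_assoc, mul_assoc]
  have e : E * (F * (F * P)) = -(F * (E * (F * P)))
      + ((((s + s⁻¹) / (s ^ 2 - (s ^ 2)⁻¹)) • (K * K - K' * K')) * (F * P)) := by
    rw [← h.EF]; noncomm_ring
  simp only [sub_mul, smul_mul_assoc, mul_smul_comm, mul_assoc, KF', K'F', smul_smul,
    smul_sub] at e
  unfold casimir Commute SemiconjBy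
  simp only [pow_two, add_mul, sub_mul, mul_add, mul_sub, neg_mul, mul_neg, smul_mul_assoc,
    mul_smul_comm, mul_assoc, h.PF, KF', K'F', e, smul_smul, smul_neg]
  match_scalars <;> field_simp <;> ring

lemma OspRel.casimir_K (h : OspRel s E F K K' P) (hs : s ≠ 0) :
    Commute (casimir s E F K K' P) K := by
  have hEF : Commute K (E * F) := by
    rw [Commute, SemiconjBy, ← mul_assoc, h.KE, smul_mul_assoc, mul_assoc, h.KF, mul_smul_comm,
      smul_smul, mul_inv_cancel₀ hs, one_smul, mul_assoc]
  have hK' : Commute K K' := h.KK'.trans h.K'K.symm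
  exact ((((hEF.neg_right.add_right (((Commute.refl K).pow_right 2).smul_right _)).sub_right
    ((hK'.pow_right 2).smul_right _)).mul_right h.KP)).symm

lemma OspRel.casimir_K' (h : OspRel s E F K K' P) (hs : s ≠ 0) :
    Commute (casimir s E F K K' P) K' := by
  have hEF : Commute K' (E * F) := by
    rw [Commute, SemiconjBy, ← mul_assoc, h.K'E hs, smul_mul_assoc, mul_assoc, h.K'F hs,
      mul_smul_comm, smul_smul, inv_mul_cancel₀ hs, one_smul, mul_assoc]
  have hK' : Commute K' K := h.K'K.trans h.KK'.symm
  exact ((((hEF.neg_right.add_right ((hK'.pow_right 2).smul_right _)).sub_right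
    (((Commute.refl K').pow_right 2).smul_right _)).mul_right h.K'P)).symm

lemma OspRel.commute_P (h : OspRel s E F K K' P) : Commute P (E * F) := by
  rw [Commute, SemiconjBy, ← mul_assoc, h.PE, neg_mul, mul_assoc, h.PF, mul_neg, neg_neg,
    mul_assoc]

lemma OspRel.casimir_P (h : OspRel s E F K K' P) : Commute (casimir s E F K K' P) P :=
  ((((h.commute_P.neg_right.add_right
    ((Commute.pow_right (show Commute P K from h.KP.symm) 2).smul_right _)).sub_right
    ((Commute.pow_right (show Commute P K' from h.K'P.symm) 2).smul_right _)).mul_right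
      (Commute.refl P))).symm

end Casimir

/-- The coproduct of the generators satisfies the relations again: two commuting copies of the
relations combine to a third one. -/
lemma OspRel.coproduct {s : ℂ} (hs : s ≠ 0) {E₁ F₁ K₁ K₁' P₁ E₂ F₂ K₂ K₂' P₂ : A}
    (h₁ : OspRel s E₁ F₁ K₁ K₁' P₁) (h₂ : OspRel s E₂ F₂ K₂ K₂' P₂)
    (hc : ∀ x ∈ ({E₁, F₁, K₁, K₁', P₁} : Set A), ∀ y ∈ ({E₂, F₂, K₂, K₂', P₂} : Set A),
      Commute x y) :
    OspRel s (E₁ * (K₂ * P₂) + K₁' * E₂) (F₁ * (K₂ * P₂) + K₁' * F₂) (K₁ * K₂) (K₁' * K₂')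
      (P₁ * P₂) := by
  simp only [Set.mem_insert_iff, Set.mem_singleton_iff, forall_eq_or_imp, forall_eq] at hc
  obtain ⟨⟨c1, c2, c3, c4, c5⟩, ⟨c6, c7, c8, c9, c10⟩, ⟨c11, c12, c13, c14, c15⟩,
    ⟨c16, c17, c18, c19, c20⟩, c21, c22, c23, c24, c25⟩ := hc
  -- elements of the second copy move to the right, then `P`, `K` move to the right in each copy
  have sw : ∀ {x y : A}, Commute x y → ∀ z, y * (x * z) = x * (y * z) := fun h z => by
    rw [← mul_assoc, ← h.eq, mul_assoc]
  have sm : ∀ {x y : A} {t : ℂ}, x * y = t • (y * x) → ∀ z, x * (y * z) = t • (y * (x * z)) :=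
    fun h z => by rw [← mul_assoc, h, smul_mul_assoc, mul_assoc]
  have sn : ∀ {x y : A}, x * y = -(y * x) → ∀ z, x * (y * z) = -(y * (x * z)) :=
    fun h z => by rw [← mul_assoc, h, neg_mul, mul_assoc]
  have so : ∀ {x y : A}, x * y = 1 → ∀ z, x * (y * z) = z :=
    fun h z => by rw [← mul_assoc, h, one_mul]
  have se : ∀ {x y : A}, x * y = y * x → ∀ z, x * (y * z) = y * (x * z) :=
    fun h z => by rw [← mul_assoc, h, mul_assoc]
  have swaps := And.intro (sw c1) <| And.intro (sw c2) <| And.intro (sw c3) <| And.intro (sw c4) <|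
    And.intro (sw c5) <| And.intro (sw c6) <| And.intro (sw c7) <| And.intro (sw c8) <|
    And.intro (sw c9) <| And.intro (sw c10) <| And.intro (sw c11) <| And.intro (sw c12) <|
    And.intro (sw c13) <| And.intro (sw c14) <| And.intro (sw c15) <| And.intro (sw c16) <|
    And.intro (sw c17) <| And.intro (sw c18) <| And.intro (sw c19) <| And.intro (sw c20) <|
    And.intro (sw c21) <| And.intro (sw c22) <| And.intro (sw c23) <| And.intro (sw c24) (sw c25)
  refine ⟨?_, ?_, ?_, ?_, ?_, ?_, ?_, ?_, ?_⟩
  · simp only [mul_assoc, swaps, h₂.KK', h₁.KK', mul_one]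
  · simp only [mul_assoc, swaps, h₂.K'K, h₁.K'K, mul_one]
  · simp only [mul_assoc, swaps, h₂.KP, se h₁.KP]
  · simp only [mul_assoc, swaps, h₂.PP, h₁.PP, mul_one]
  · simp only [mul_add, add_mul, mul_assoc, swaps, sm h₁.KE, so h₁.KK', so h₁.K'K, h₂.KE,
      se h₂.KP, h₂.KP, mul_smul_comm, smul_add]
  · simp only [mul_add, add_mul, mul_assoc, swaps, sm h₁.KF, so h₁.KK', so h₁.K'K, h₂.KF,
      se h₂.KP, h₂.KP, mul_smul_comm, smul_add]
  · simp only [mul_add, add_mul, mul_assoc, swaps, sn h₁.PE, se h₁.K'P, h₂.PE,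
      h₂.KP, mul_neg, neg_add]
  · simp only [mul_add, add_mul, mul_assoc, swaps, sn h₁.PF, se h₁.K'P, h₂.PF,
      h₂.KP, mul_neg, neg_add]
  · have e1 : F₁ * E₁ = -(E₁ * F₁)
      + ((s + s⁻¹) / (s ^ 2 - (s ^ 2)⁻¹)) • (K₁ * K₁ - K₁' * K₁') := by rw [← h₁.EF]; abel
    have e2 : F₂ * E₂ = -(E₂ * F₂)
      + ((s + s⁻¹) / (s ^ 2 - (s ^ 2)⁻¹)) • (K₂ * K₂ - K₂' * K₂') := by rw [← h₂.EF]; abel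
    have e1' : ∀ z, F₁ * (E₁ * z) = -(E₁ * (F₁ * z))
      + ((s + s⁻¹) / (s ^ 2 - (s ^ 2)⁻¹)) • (K₁ * (K₁ * z) - K₁' * (K₁' * z)) := fun z => by
      rw [← mul_assoc, e1]; simp only [add_mul, neg_mul, smul_mul_assoc, sub_mul, mul_assoc]
    have KP' := h₂.KP.symm
    simp only [mul_add, add_mul, mul_sub, mul_assoc, swaps, sm (h₁.K'E hs), sm (h₁.K'F hs),
      sm h₂.KE, sm h₂.KF, h₂.PE, h₂.PF, se KP', h₂.PP, mul_one, e1', e2, mul_neg, mul_smul_comm,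
      smul_sub]
    match_scalars <;> field_simp <;> ring

end Osp

/-! ### Scalars -/

lemma qpow_add (L x y : ℂ) : qpow L (x + y) = qpow L x * qpow L y := by
  simp [qpow, mul_add, Complex.exp_add]

lemma qpow_zero (L : ℂ) : qpow L 0 = 1 := by simp [qpow]

lemma qpow_ne_zero (L x : ℂ) : qpow L x ≠ 0 := Complex.exp_ne_zero _

lemma qpow_neg (L x : ℂ) : qpow L (-x) = (qpow L x)⁻¹ := by
  simp [qpow, Complex.exp_neg]

lemma qpow_sub (L x y : ℂ) : qpow L (x - y) = qpow L x / qpow L y := by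
  rw [sub_eq_add_neg, qpow_add, qpow_neg, div_eq_mul_inv]

lemma qq_ne_zero (L : ℂ) : qq L ≠ 0 := Complex.exp_ne_zero _

lemma qpow_one (L : ℂ) : qpow L 1 = qq L := by simp [qpow, qq]

lemma qpow_natCast (L : ℂ) (n : ℕ) : qpow L n = qq L ^ n := by
  rw [qpow, qq, ← Complex.exp_nat_mul, mul_comm]

/-- `q^{1/2}`. -/
def sq (L : ℂ) : ℂ := qpow L (1 / 2)

lemma sq_ne_zero (L : ℂ) : sq L ≠ 0 := qpow_ne_zero _ _

lemma sq_sq (L : ℂ) : sq L ^ 2 = qq L := by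
  rw [sq, pow_two, ← qpow_add, ← qpow_one]; norm_num

lemma sqrt_mul_sqrt (z : ℂ) : Complex.sqrt z * Complex.sqrt z = z := by
  rw [Complex.sqrt, ← pow_two, ← Complex.cpow_nat_mul]; simp

lemma sigma_zero (L : ℂ) (g : ℝ) : sigma L 0 g = 0 := by simp [sigma]

/-- The consecutive `σ`'s add up to the eigenvalue of the anticommutator of `A₊` and `A₋`. -/
lemma sigma_succ_add_sigma (L : ℂ) (m : ℕ) (g : ℝ) :
    sigma L (m + 1) g + sigma L m g
      = (sq L + (sq L)⁻¹) / (sq L ^ 2 - (sq L ^ 2)⁻¹)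
        * (qpow L (m + g) - qpow L (-(m + g))) := by
  have e1 : qpow L ((m : ℂ) + 1 + g - 1 / 2) = qpow L (m + g) * sq L := by
    rw [sq, ← qpow_add]; congr 1; ring
  have e2 : qpow L (-((m : ℂ) + 1 + g - 1 / 2)) = qpow L (-(m + g)) * (sq L)⁻¹ := by
    rw [sq, ← qpow_neg, ← qpow_add]; congr 1; ring
  have e3 : qpow L ((m : ℂ) + g - 1 / 2) = qpow L (m + g) * (sq L)⁻¹ := by
    rw [sq, ← qpow_neg, ← qpow_add, sub_eq_add_neg]
  have e4 : qpow L (-((m : ℂ) + g - 1 / 2)) = qpow L (-(m + g)) * sq L := by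
    rw [sq, ← qpow_add]; congr 1; ring
  simp only [sigma, qnum, Nat.cast_add, Nat.cast_one, e1, e2, e3, e4, sq_sq, pow_succ (-1 : ℂ)]
  ring

/-! ### Operators on the coupled module -/

lemma onBasis_bvec (f : (ℕ →₀ ℕ) → Fock) (m : ℕ →₀ ℕ) : onBasis f (bvec m) = f m := by
  have : bvec m = basisMonomials ℕ ℂ m := by simp [bvec, coe_basisMonomials]
  rw [onBasis, this, Module.Basis.constr_basis]

lemma end_ext {M : Type*} [AddCommMonoid M] [Module ℂ M] {T T' : Fock →ₗ[ℂ] M}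
    (h : ∀ m, T (bvec m) = T' (bvec m)) : T = T' :=
  (basisMonomials ℕ ℂ).ext fun m => by simpa [coe_basisMonomials, bvec] using h m

lemma bvec_mul (m m' : ℕ →₀ ℕ) : bvec m * bvec m' = bvec (m + m') := by
  simp [bvec, monomial_mul]

/-- The operator that is diagonal in the monomial basis, with the eigenvalues `c m`. -/
def diag (c : (ℕ →₀ ℕ) → ℂ) : Module.End ℂ Fock := onBasis fun m => c m • bvec m

lemma diag_bvec (c : (ℕ →₀ ℕ) → ℂ) (m : ℕ →₀ ℕ) : diag c (bvec m) = c m • bvec m :=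
  onBasis_bvec _ _

lemma diag_mul (c c' : (ℕ →₀ ℕ) → ℂ) : diag c * diag c' = diag (fun m => c m * c' m) :=
  end_ext fun m => by
    simp [Module.End.mul_apply, diag_bvec, smul_smul, mul_comm]

lemma diag_commute (c c' : (ℕ →₀ ℕ) → ℂ) : Commute (diag c) (diag c') := by
  simp only [Commute, SemiconjBy, diag_mul, mul_comm]

lemma diag_one : diag (fun _ => 1) = 1 := end_ext fun m => by simp [diag_bvec]

lemma siteUp_bvec (L : ℂ) (γ : ℕ → ℝ) (l : ℕ) (m : ℕ →₀ ℕ) :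
    siteUp L γ l (bvec m)
      = Complex.sqrt (sigma L (m l + 1) (γ l)) • bvec (m + Finsupp.single l 1) :=
  onBasis_bvec _ _

lemma siteDown_bvec (L : ℂ) (γ : ℕ → ℝ) (l : ℕ) (m : ℕ →₀ ℕ) :
    siteDown L γ l (bvec m)
      = Complex.sqrt (sigma L (m l) (γ l)) • bvec (m - Finsupp.single l 1) :=
  onBasis_bvec _ _

lemma sqrt_sigma_zero (L : ℂ) (g : ℝ) : Complex.sqrt (sigma L 0 g) = 0 := by
  rw [sigma_zero, Complex.sqrt, Complex.zero_cpow (by norm_num)]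

lemma diag_mul_siteUp {L : ℂ} {γ : ℕ → ℝ} {l : ℕ} {c : (ℕ →₀ ℕ) → ℂ} {t : ℂ}
    (h : ∀ m, c (m + Finsupp.single l 1) = t * c m) :
    diag c * siteUp L γ l = t • (siteUp L γ l * diag c) :=
  end_ext fun m => by
    simp only [Module.End.mul_apply, LinearMap.smul_apply, diag_bvec, siteUp_bvec, map_smul,
      smul_smul, h]
    congr 1; ring

lemma diag_mul_siteDown {L : ℂ} {γ : ℕ → ℝ} {l : ℕ} {c : (ℕ →₀ ℕ) → ℂ} {t : ℂ}
    (h : ∀ m, c m = t * c (m + Finsupp.single l 1)) :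
    diag c * siteDown L γ l = t • (siteDown L γ l * diag c) :=
  end_ext fun m => by
    simp only [Module.End.mul_apply, LinearMap.smul_apply, diag_bvec, siteDown_bvec, map_smul,
      smul_smul]
    rcases Nat.eq_zero_or_pos (m l) with h0 | h0
    · simp [h0, sqrt_sigma_zero]
    · have hm : m - Finsupp.single l 1 + Finsupp.single l 1 = m :=
        tsub_add_cancel_of_le (by simpa [Finsupp.single_le_iff] using Nat.succ_le_of_lt h0)
      have := h (m - Finsupp.single l 1)
      rw [hm] at this
      rw [this]
      congr 1; ring

lemma diag_commute_siteUp {L : ℂ} {γ : ℕ → ℝ} {l : ℕ} {c : (ℕ →₀ ℕ) → ℂ}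
    (h : ∀ m, c (m + Finsupp.single l 1) = c m) : Commute (diag c) (siteUp L γ l) := by
  have := diag_mul_siteUp (L := L) (γ := γ) (l := l) (c := c) (t := 1) (by simpa using h)
  rwa [one_smul] at this

lemma diag_commute_siteDown {L : ℂ} {γ : ℕ → ℝ} {l : ℕ} {c : (ℕ →₀ ℕ) → ℂ}
    (h : ∀ m, c (m + Finsupp.single l 1) = c m) : Commute (diag c) (siteDown L γ l) := by
  have := diag_mul_siteDown (L := L) (γ := γ) (l := l) (c := c) (t := 1)
    (by simpa using fun m => (h m).symm)
  rwa [one_smul] at this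

lemma siteUp_commute {L : ℂ} {γ : ℕ → ℝ} {l l' : ℕ} (h : l ≠ l') :
    Commute (siteUp L γ l) (siteUp L γ l') :=
  end_ext fun m => by
    simp [Module.End.mul_apply, siteUp_bvec, smul_smul, h, h.symm, mul_comm, add_right_comm]

lemma siteDown_commute {L : ℂ} {γ : ℕ → ℝ} {l l' : ℕ} (h : l ≠ l') :
    Commute (siteDown L γ l) (siteDown L γ l') :=
  end_ext fun m => by
    simp [Module.End.mul_apply, siteDown_bvec, smul_smul, h, h.symm, mul_comm, tsub_right_comm]

lemma siteUp_siteDown_commute {L : ℂ} {γ : ℕ → ℝ} {l l' : ℕ} (h : l ≠ l') :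
    Commute (siteUp L γ l) (siteDown L γ l') :=
  end_ext fun m => by
    have : m - Finsupp.single l' 1 + Finsupp.single l 1
        = m + Finsupp.single l 1 - Finsupp.single l' 1 := by
      ext t
      by_cases h1 : t = l <;> by_cases h2 : t = l' <;>
        simp_all [Finsupp.single_apply, eq_comm]
    simp [Module.End.mul_apply, siteUp_bvec, siteDown_bvec, smul_smul, h, h.symm, mul_comm, this]

/-- The eigenvalues of `K` on the positions in `S`. -/
def cK (L : ℂ) (γ : ℕ → ℝ) (S : Finset ℕ) (m : ℕ →₀ ℕ) : ℂ :=
  qpow L ((1 / 2) * ∑ t ∈ S, ((m t : ℂ) + (γ t : ℂ)))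

/-- The eigenvalues of `P` on the positions in `S`. -/
def cP (S : Finset ℕ) (m : ℕ →₀ ℕ) : ℂ := (-1 : ℂ) ^ (∑ t ∈ S, m t)

lemma opK_eq (L : ℂ) (γ : ℕ → ℝ) (S : Finset ℕ) : opK L γ S = diag (cK L γ S) := rfl

lemma opKinv_eq (L : ℂ) (γ : ℕ → ℝ) (S : Finset ℕ) :
    opKinv L γ S = diag (fun m => (cK L γ S m)⁻¹) := by
  simp only [opKinv, diag, cK, qpow_neg]

lemma opP_eq (S : Finset ℕ) : opP S = diag (cP S) := rfl

lemma cK_ne_zero (L : ℂ) (γ : ℕ → ℝ) (S : Finset ℕ) (m : ℕ →₀ ℕ) : cK L γ S m ≠ 0 :=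
  qpow_ne_zero _ _

lemma cK_union (L : ℂ) (γ : ℕ → ℝ) {S T : Finset ℕ} (h : Disjoint S T) (m : ℕ →₀ ℕ) :
    cK L γ (S ∪ T) m = cK L γ S m * cK L γ T m := by
  rw [cK, Finset.sum_union h, mul_add, qpow_add, cK, cK]

lemma cP_union {S T : Finset ℕ} (h : Disjoint S T) (m : ℕ →₀ ℕ) :
    cP (S ∪ T) m = cP S m * cP T m := by
  rw [cP, Finset.sum_union h, pow_add, cP, cP]

lemma cK_add_single (L : ℂ) (γ : ℕ → ℝ) (S : Finset ℕ) (m : ℕ →₀ ℕ) (l : ℕ) :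
    cK L γ S (m + Finsupp.single l 1) = (if l ∈ S then sq L else 1) * cK L γ S m := by
  have : ∑ t ∈ S, (((m + Finsupp.single l 1 : ℕ →₀ ℕ) t : ℂ) + (γ t : ℂ))
      = ∑ t ∈ S, ((m t : ℂ) + (γ t : ℂ)) + if l ∈ S then 1 else 0 := by
    have : ∀ t, (((m + Finsupp.single l 1 : ℕ →₀ ℕ) t : ℂ) + (γ t : ℂ))
        = ((m t : ℂ) + (γ t : ℂ)) + if l = t then 1 else 0 := fun t => by
      simp only [Finsupp.add_apply, Finsupp.single_apply]; split_ifs <;> push_cast <;> ring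
    rw [Finset.sum_congr rfl fun t _ => this t, Finset.sum_add_distrib]; simp
  rw [cK, this, mul_add, qpow_add, mul_comm, ← cK]
  split_ifs <;> simp [sq, qpow_zero]

lemma cP_add_single (S : Finset ℕ) (m : ℕ →₀ ℕ) (l : ℕ) :
    cP S (m + Finsupp.single l 1) = (if l ∈ S then -1 else 1) * cP S m := by
  have : ∑ t ∈ S, (m + Finsupp.single l 1 : ℕ →₀ ℕ) t = ∑ t ∈ S, m t + if l ∈ S then 1 else 0 := by
    simp only [Finsupp.add_apply, Finset.sum_add_distrib, Finsupp.single_apply]; simp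
  rw [cP, this, pow_add, mul_comm, ← cP]
  split_ifs <;> simp

lemma opK_commute_siteDown {L : ℂ} {γ : ℕ → ℝ} {l : ℕ} {S : Finset ℕ} (h : l ∉ S) :
    Commute (opK L γ S) (siteDown L γ l) := by
  exact diag_commute_siteDown (c := cK L γ S)
    fun m => by simp [cK_add_single, h]

lemma opKinv_commute_siteDown {L : ℂ} {γ : ℕ → ℝ} {l : ℕ} {S : Finset ℕ} (h : l ∉ S) :
    Commute (opKinv L γ S) (siteDown L γ l) := by
  rw [opKinv_eq]
  exact diag_commute_siteDown
    fun m => by simp [cK_add_single, h]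

lemma opP_commute_siteDown {L : ℂ} {γ : ℕ → ℝ} {l : ℕ} {S : Finset ℕ} (h : l ∉ S) :
    Commute (opP S) (siteDown L γ l) := by
  exact diag_commute_siteDown (c := cP S)
    fun m => by simp [cP_add_single, h]

lemma opK_commute_opKinv (L : ℂ) (γ : ℕ → ℝ) (S T : Finset ℕ) :
    Commute (opK L γ S) (opKinv L γ T) :=
  diag_commute _ _

lemma opK_commute_opP (L : ℂ) (γ : ℕ → ℝ) (S T : Finset ℕ) : Commute (opK L γ S) (opP T) :=
  diag_commute _ _

lemma opKinv_commute_opP (L : ℂ) (γ : ℕ → ℝ) (S T : Finset ℕ) : Commute (opKinv L γ S) (opP T) :=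
  diag_commute _ _

lemma opK_union (L : ℂ) (γ : ℕ → ℝ) {S T : Finset ℕ} (h : Disjoint S T) :
    opK L γ (S ∪ T) = opK L γ S * opK L γ T := by
  simp only [opK_eq, diag_mul, ← cK_union L γ h]

lemma opKinv_union (L : ℂ) (γ : ℕ → ℝ) {S T : Finset ℕ} (h : Disjoint S T) :
    opKinv L γ (S ∪ T) = opKinv L γ S * opKinv L γ T := by
  simp only [opKinv_eq, diag_mul, cK_union L γ h, mul_inv]

lemma opP_union {S T : Finset ℕ} (h : Disjoint S T) : opP (S ∪ T) = opP S * opP T := by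
  simp only [opP_eq, diag_mul, ← cP_union h]

lemma opK_empty (L : ℂ) (γ : ℕ → ℝ) : opK L γ ∅ = 1 := by
  rw [opK_eq, ← diag_one]; congr 1; funext m; simp [cK, qpow_zero]

lemma opKinv_empty (L : ℂ) (γ : ℕ → ℝ) : opKinv L γ ∅ = 1 := by
  rw [opKinv_eq, ← diag_one]; congr 1; funext m; simp [cK, qpow_zero]

lemma opP_empty : opP ∅ = 1 := by
  rw [opP_eq, ← diag_one]; congr 1

lemma opUp_self (L : ℂ) (γ : ℕ → ℝ) (l : ℕ) : opUp L γ l l = siteUp L γ l := by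
  simp [opUp, opKinv_empty, opK_empty, opP_empty]

lemma opDown_self (L : ℂ) (γ : ℕ → ℝ) (l : ℕ) : opDown L γ l l = siteDown L γ l := by
  simp [opDown, opKinv_empty, opK_empty, opP_empty]

lemma Icc_split {a b c : ℕ} (h1 : a ≤ c + 1) (h2 : c ≤ b) :
    Finset.Icc a b = Finset.Icc a c ∪ Finset.Icc (c + 1) b := by
  ext t; simp only [Finset.mem_union, Finset.mem_Icc]; omega

lemma Icc_disj (a b c : ℕ) : Disjoint (Finset.Icc a c) (Finset.Icc (c + 1) b) := by
  rw [Finset.disjoint_left]; intro t; simp only [Finset.mem_Icc]; omega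

/-- An iterated coproduct, split between the positions `c` and `c + 1`. -/
lemma sum_split (L : ℂ) (γ : ℕ → ℝ) {s : ℕ → Module.End ℂ Fock} {a b c : ℕ}
    (h1 : a ≤ c + 1) (h2 : c ≤ b) :
    ∑ l ∈ Finset.Icc a b,
        opKinv L γ (Finset.Ico a l) * s l * (opK L γ (Finset.Ioc l b) * opP (Finset.Ioc l b))
      = (∑ l ∈ Finset.Icc a c,
          opKinv L γ (Finset.Ico a l) * s l * (opK L γ (Finset.Ioc l c) * opP (Finset.Ioc l c)))
          * (opK L γ (Finset.Icc (c + 1) b) * opP (Finset.Icc (c + 1) b))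
        + opKinv L γ (Finset.Icc a c) * ∑ l ∈ Finset.Icc (c + 1) b,
          opKinv L γ (Finset.Ico (c + 1) l) * s l
            * (opK L γ (Finset.Ioc l b) * opP (Finset.Ioc l b)) := by
  rw [Icc_split h1 h2, Finset.sum_union (Icc_disj a b c)]
  refine congrArg₂ (· + ·) ?_ ?_
  · refine Eq.trans (Finset.sum_congr rfl fun l hl => ?_) (Finset.sum_mul ..).symm
    rw [Finset.mem_Icc] at hl
    have e : Finset.Ioc l b = Finset.Ioc l c ∪ Finset.Icc (c + 1) b := by
      ext t; simp only [Finset.mem_union, Finset.mem_Icc, Finset.mem_Ioc]; omega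
    have d : Disjoint (Finset.Ioc l c) (Finset.Icc (c + 1) b) := by
      rw [Finset.disjoint_left]; intro t; simp only [Finset.mem_Icc, Finset.mem_Ioc]; omega
    rw [e, opK_union _ _ d, opP_union d]
    simp only [mul_assoc]
    rw [← mul_assoc (opK L γ (Finset.Icc (c + 1) b)) (opP _), (opK_commute_opP _ _ _ _).eq,
      mul_assoc]
  · refine Eq.trans (Finset.sum_congr rfl fun l hl => ?_) (Finset.mul_sum ..).symm
    rw [Finset.mem_Icc] at hl
    have e : Finset.Ico a l = Finset.Icc a c ∪ Finset.Ico (c + 1) l := by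
      ext t; simp only [Finset.mem_union, Finset.mem_Icc, Finset.mem_Ico]; omega
    have d : Disjoint (Finset.Icc a c) (Finset.Ico (c + 1) l) := by
      rw [Finset.disjoint_left]; intro t; simp only [Finset.mem_Icc, Finset.mem_Ico]; omega
    rw [e, opKinv_union _ _ d]
    simp only [mul_assoc]

lemma opUp_split (L : ℂ) (γ : ℕ → ℝ) {a b c : ℕ} (h1 : a ≤ c + 1) (h2 : c ≤ b) :
    opUp L γ a b = opUp L γ a c * (opK L γ (Finset.Icc (c + 1) b) * opP (Finset.Icc (c + 1) b))
      + opKinv L γ (Finset.Icc a c) * opUp L γ (c + 1) b :=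
  sum_split L γ h1 h2

lemma opDown_split (L : ℂ) (γ : ℕ → ℝ) {a b c : ℕ} (h1 : a ≤ c + 1) (h2 : c ≤ b) :
    opDown L γ a b
      = opDown L γ a c * (opK L γ (Finset.Icc (c + 1) b) * opP (Finset.Icc (c + 1) b))
      + opKinv L γ (Finset.Icc a c) * opDown L γ (c + 1) b :=
  sum_split L γ h1 h2

/-! ### Operators on intervals of positions -/

section Interval

variable (L : ℂ) (γ : ℕ → ℝ)

/-- Operators that are built from site operators at positions in `S` and from diagonal operators
whose eigenvalues do not depend on the other positions. -/
def ActsOn (S : Finset ℕ) (T : Module.End ℂ Fock) : Prop :=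
  T ∈ Algebra.adjoin ℂ ({D | (∃ l ∈ S, D = siteUp L γ l ∨ D = siteDown L γ l) ∨
    ∃ c : (ℕ →₀ ℕ) → ℂ, (∀ l ∉ S, ∀ m, c (m + Finsupp.single l 1) = c m) ∧ D = diag c} :
    Set (Module.End ℂ Fock))

variable {L γ}

lemma ActsOn.siteUp {S : Finset ℕ} {l : ℕ} (h : l ∈ S) : ActsOn L γ S (siteUp L γ l) :=
  Algebra.subset_adjoin (Or.inl ⟨l, h, Or.inl rfl⟩)

lemma ActsOn.siteDown {S : Finset ℕ} {l : ℕ} (h : l ∈ S) : ActsOn L γ S (siteDown L γ l) :=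
  Algebra.subset_adjoin (Or.inl ⟨l, h, Or.inr rfl⟩)

lemma ActsOn.opK {S U : Finset ℕ} (h : U ⊆ S) : ActsOn L γ S (opK L γ U) :=
  Algebra.subset_adjoin (Or.inr ⟨cK L γ U, fun l hl m => by
    rw [cK_add_single, if_neg fun e => hl (h e), one_mul], rfl⟩)

lemma ActsOn.opKinv {S U : Finset ℕ} (h : U ⊆ S) : ActsOn L γ S (opKinv L γ U) :=
  Algebra.subset_adjoin (Or.inr ⟨fun m => (cK L γ U m)⁻¹, fun l hl m => by
    simp only []; rw [cK_add_single, if_neg fun e => hl (h e), one_mul], opKinv_eq _ _ _⟩)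

lemma ActsOn.opP {S U : Finset ℕ} (h : U ⊆ S) : ActsOn L γ S (opP U) :=
  Algebra.subset_adjoin (Or.inr ⟨cP U, fun l hl m => by
    rw [cP_add_single, if_neg fun e => hl (h e), one_mul], rfl⟩)

lemma ActsOn.opUp (a b : ℕ) : ActsOn L γ (Finset.Icc a b) (opUp L γ a b) :=
  Subalgebra.sum_mem _ fun l hl => by
    rw [Finset.mem_Icc] at hl
    refine mul_mem (mul_mem (ActsOn.opKinv ?_) (ActsOn.siteUp ?_))
      (mul_mem (ActsOn.opK ?_) (ActsOn.opP ?_))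
    · intro t; simp only [Finset.mem_Icc, Finset.mem_Ico]; omega
    · simpa using hl
    all_goals intro t; simp only [Finset.mem_Icc, Finset.mem_Ioc]; omega

lemma ActsOn.opDown (a b : ℕ) : ActsOn L γ (Finset.Icc a b) (opDown L γ a b) :=
  Subalgebra.sum_mem _ fun l hl => by
    rw [Finset.mem_Icc] at hl
    refine mul_mem (mul_mem (ActsOn.opKinv ?_) (ActsOn.siteDown ?_))
      (mul_mem (ActsOn.opK ?_) (ActsOn.opP ?_))
    · intro t; simp only [Finset.mem_Icc, Finset.mem_Ico]; omega
    · simpa using hl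
    all_goals intro t; simp only [Finset.mem_Icc, Finset.mem_Ioc]; omega

lemma ActsOn.opGamma (a b : ℕ) : ActsOn L γ (Finset.Icc a b) (opGamma L γ a b) :=
  mul_mem (sub_mem (add_mem (neg_mem (mul_mem (ActsOn.opUp a b) (ActsOn.opDown a b)))
    (Subalgebra.smul_mem _ (pow_mem (ActsOn.opK subset_rfl) 2) _))
    (Subalgebra.smul_mem _ (pow_mem (ActsOn.opKinv subset_rfl) 2) _)) (ActsOn.opP subset_rfl)

/-- Operators on disjoint sets of positions commute. -/
lemma ActsOn.commute {S S' : Finset ℕ} {T T' : Module.End ℂ Fock} (h : ActsOn L γ S T)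
    (h' : ActsOn L γ S' T') (hd : Disjoint S S') : Commute T T' := by
  refine Algebra.commute_of_mem_adjoin_of_forall_mem_commute h' fun D' hD' => ?_
  refine (Algebra.commute_of_mem_adjoin_of_forall_mem_commute h fun D hD => ?_).symm
  rw [Finset.disjoint_left] at hd
  obtain ⟨l, hl, hD⟩ | ⟨c, hc, rfl⟩ := hD
  · obtain ⟨l', hl', hD'⟩ | ⟨c', hc', rfl⟩ := hD'
    · have hne : l ≠ l' := fun e => hd (e ▸ hl) hl'
      rcases hD with rfl | rfl <;> rcases hD' with rfl | rfl
      · exact (siteUp_commute hne).symm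
      · exact (siteUp_siteDown_commute hne).symm
      · exact siteUp_siteDown_commute hne.symm
      · exact (siteDown_commute hne).symm
    · rcases hD with rfl | rfl
      · exact diag_commute_siteUp (hc' l (hd hl))
      · exact diag_commute_siteDown (hc' l (hd hl))
  · obtain ⟨l', hl', rfl | rfl⟩ | ⟨c', hc', rfl⟩ := hD'
    · exact (diag_commute_siteUp (hc l' fun e => hd e hl')).symm
    · exact (diag_commute_siteDown (hc l' fun e => hd e hl')).symm
    · exact diag_commute _ _

/-- An operator on the positions in `S` is linear over the polynomials in the other variables. -/
lemma ActsOn.mul_bvec {S : Finset ℕ} {T : Module.End ℂ Fock} (h : ActsOn L γ S T)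
    {m : ℕ →₀ ℕ} (hm : ∀ l ∈ S, m l = 0) (f : Fock) : T (f * bvec m) = T f * bvec m := by
  let M : Module.End ℂ Fock := LinearMap.mulRight ℂ (bvec m)
  suffices Commute M T from (LinearMap.congr_fun this.eq f).symm
  refine Algebra.commute_of_mem_adjoin_of_forall_mem_commute h fun D hD => ?_
  refine end_ext fun n => ?_
  simp only [Module.End.mul_apply, M, LinearMap.mulRight_apply, bvec_mul]
  obtain ⟨l, hl, rfl | rfl⟩ | ⟨c, hc, rfl⟩ := hD
  · simp [siteUp_bvec, bvec_mul, hm l hl, add_right_comm]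
  · have e : n + m - Finsupp.single l 1 = n - Finsupp.single l 1 + m := by
      ext t
      by_cases h1 : t = l
      · subst h1; simp [hm t hl]
      · simp [Ne.symm h1]
    simp [siteDown_bvec, bvec_mul, hm l hl, e]
  · have : ∀ m : ℕ →₀ ℕ, (∀ l ∈ S, m l = 0) → c (n + m) = c n := by
      intro m
      induction m using Finsupp.induction with
      | zero => simp
      | single_add l k m hl hk ih =>
        intro hm
        have hl' : l ∉ S := fun e => by
          have := hm l e
          rw [Finsupp.add_apply, Finsupp.single_eq_same] at this; omega
        have hm' : ∀ t ∈ S, m t = 0 := fun t ht => by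
          have := hm t ht
          simp only [Finsupp.add_apply] at this; omega
        have : ∀ k : ℕ, c (n + (Finsupp.single l k + m)) = c (n + m) := fun k => by
          induction k with
          | zero => simp
          | succ k ih =>
            rw [Finsupp.single_add, ← ih, ← hc l hl' (n + (Finsupp.single l k + m))]
            congr 1; abel
        rw [this, ih hm']
    simp [diag_bvec, bvec_mul, this m hm]

/-- The operators on one position represent `osp_q(1|2)`. -/
lemma ospRel_site (L : ℂ) (γ : ℕ → ℝ) (l : ℕ) :
    OspRel (sq L) (siteUp L γ l) (siteDown L γ l) (opK L γ {l}) (opKinv L γ {l}) (opP {l}) where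
  KK' := by
    rw [opK_eq, opKinv_eq, diag_mul, ← diag_one]
    congr 1; funext m; exact mul_inv_cancel₀ (cK_ne_zero _ _ _ _)
  K'K := by
    rw [opK_eq, opKinv_eq, diag_mul, ← diag_one]
    congr 1; funext m; exact inv_mul_cancel₀ (cK_ne_zero _ _ _ _)
  KP := diag_commute _ _
  PP := by
    rw [opP_eq, diag_mul, ← diag_one]
    congr 1; funext m; rw [cP, ← mul_pow]; norm_num
  KE := diag_mul_siteUp (c := cK L γ {l}) fun m => by simp [cK_add_single]
  KF := diag_mul_siteDown (c := cK L γ {l}) fun m => by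
    rw [cK_add_single, if_pos (Finset.mem_singleton_self l), ← mul_assoc,
      inv_mul_cancel₀ (sq_ne_zero L), one_mul]
  PE := by
    rw [← neg_one_smul ℂ]; exact diag_mul_siteUp (c := cP {l}) fun m => by
      rw [cP_add_single, if_pos (Finset.mem_singleton_self l)]
  PF := by
    rw [← neg_one_smul ℂ]; exact diag_mul_siteDown (c := cP {l}) fun m => by
      rw [cP_add_single, if_pos (Finset.mem_singleton_self l)]; ring
  EF := by
    refine end_ext fun m => ?_
    have hK : cK L γ {l} m * cK L γ {l} m = qpow L (m l + γ l) := by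
      rw [cK, ← qpow_add]; congr 1; rw [Finset.sum_singleton]; ring
    have h1 : siteDown L γ l (siteUp L γ l (bvec m)) = sigma L (m l + 1) (γ l) • bvec m := by
      simp only [siteUp_bvec, siteDown_bvec, map_smul, smul_smul, Finsupp.add_apply,
        Finsupp.single_eq_same, sqrt_mul_sqrt, add_tsub_cancel_right]
    have h2 : siteUp L γ l (siteDown L γ l (bvec m)) = sigma L (m l) (γ l) • bvec m := by
      rcases Nat.eq_zero_or_pos (m l) with h0 | h0
      · simp [siteDown_bvec, h0, sigma_zero]
      · have hm : m - Finsupp.single l 1 + Finsupp.single l 1 = m :=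
          tsub_add_cancel_of_le (by simpa [Finsupp.single_le_iff] using Nat.succ_le_of_lt h0)
        have h3 : m l - 1 + 1 = m l := by omega
        simp only [siteUp_bvec, siteDown_bvec, map_smul, smul_smul, Finsupp.tsub_apply,
          Finsupp.single_eq_same, h3, sqrt_mul_sqrt, hm]
    simp only [LinearMap.add_apply, LinearMap.smul_apply, LinearMap.sub_apply, Module.End.mul_apply,
      h1, h2, opK_eq, opKinv_eq, diag_bvec, map_smul, smul_smul, ← sub_smul, ← add_smul,
      ← mul_inv, hK, ← qpow_neg]
    rw [add_comm, sigma_succ_add_sigma]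

lemma opGamma_eq (L : ℂ) (γ : ℕ → ℝ) (a b : ℕ) :
    opGamma L γ a b = casimir (sq L) (opUp L γ a b) (opDown L γ a b) (opK L γ (Finset.Icc a b))
      (opKinv L γ (Finset.Icc a b)) (opP (Finset.Icc a b)) := by
  rw [opGamma, casimir, sq_sq, sq, qpow_neg]

/-- The iterated coproducts on an interval represent `osp_q(1|2)`. -/
lemma ospRel_interval (L : ℂ) (γ : ℕ → ℝ) {a b : ℕ} (h : a ≤ b) :
    OspRel (sq L) (opUp L γ a b) (opDown L γ a b) (opK L γ (Finset.Icc a b))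
      (opKinv L γ (Finset.Icc a b)) (opP (Finset.Icc a b)) := by
  induction b, h using Nat.le_induction with
  | base => simpa [opUp_self, opDown_self] using ospRel_site L γ a
  | succ b h ih =>
    have hs := ospRel_site L γ (b + 1)
    have e : Finset.Icc (b + 1) (b + 1) = {b + 1} := Finset.Icc_self _
    have hd : Disjoint (Finset.Icc a b) {b + 1} := e ▸ Icc_disj a (b + 1) b
    have e' : Finset.Icc a (b + 1) = Finset.Icc a b ∪ {b + 1} := by
      rw [Icc_split (c := b) (by omega) (by omega), e]
    rw [opUp_split L γ (c := b) (by omega) (by omega),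
      opDown_split L γ (c := b) (by omega) (by omega), e', e,
      opK_union _ _ hd, opKinv_union _ _ hd, opP_union hd, opUp_self, opDown_self]
    refine OspRel.coproduct (sq_ne_zero L) ih hs fun x hx y hy => ?_
    have hx' : ActsOn L γ (Finset.Icc a b) x := by
      simp only [Set.mem_insert_iff, Set.mem_singleton_iff] at hx
      rcases hx with rfl | rfl | rfl | rfl | rfl
      exacts [ActsOn.opUp _ _, ActsOn.opDown _ _, ActsOn.opK subset_rfl, ActsOn.opKinv subset_rfl,
        ActsOn.opP subset_rfl]
    have hy' : ActsOn L γ {b + 1} y := by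
      simp only [Set.mem_insert_iff, Set.mem_singleton_iff] at hy
      rcases hy with rfl | rfl | rfl | rfl | rfl
      exacts [ActsOn.siteUp (by simp), ActsOn.siteDown (by simp), ActsOn.opK subset_rfl,
        ActsOn.opKinv subset_rfl, ActsOn.opP subset_rfl]
    exact hx'.commute hy' hd

/-- `Γ_{[c;d]}` commutes with every iterated coproduct over `[a;b]` that contains `[c;d]`, if it
does so for `[c;d]` itself. -/
lemma opGamma_commute_of_split (L : ℂ) (γ : ℕ → ℝ) {T : ℕ → ℕ → Module.End ℂ Fock}
    (hT : ∀ a b, ActsOn L γ (Finset.Icc a b) (T a b))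
    (hsplit : ∀ {a b c : ℕ}, a ≤ c + 1 → c ≤ b →
      T a b = T a c * (opK L γ (Finset.Icc (c + 1) b) * opP (Finset.Icc (c + 1) b))
        + opKinv L γ (Finset.Icc a c) * T (c + 1) b)
    {a b c d : ℕ} (hac : a ≤ c + 1) (hcd : c + 1 ≤ d) (hdb : d ≤ b)
    (h : Commute (opGamma L γ (c + 1) d) (T (c + 1) d)) :
    Commute (opGamma L γ (c + 1) d) (T a b) := by
  have R := ospRel_interval L γ hcd
  have hs := sq_ne_zero L
  have hK : Commute (opGamma L γ (c + 1) d) (opK L γ (Finset.Icc (c + 1) d)) := by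
    rw [opGamma_eq]; exact R.casimir_K hs
  have hK' : Commute (opGamma L γ (c + 1) d) (opKinv L γ (Finset.Icc (c + 1) d)) := by
    rw [opGamma_eq]; exact R.casimir_K' hs
  have hP : Commute (opGamma L γ (c + 1) d) (opP (Finset.Icc (c + 1) d)) := by
    rw [opGamma_eq]; exact R.casimir_P
  have hG := ActsOn.opGamma (L := L) (γ := γ) (c + 1) d
  have d1 := (Icc_disj a d c).symm
  have d2 := Icc_disj (c + 1) b d
  rw [hsplit (c := d) (by omega) hdb, hsplit (a := a) (b := d) (c := c) hac
    (by omega), Icc_split (a := a) (b := d) (c := c) hac (by omega),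
    opKinv_union _ _ (Icc_disj _ _ _)]
  refine Commute.add_right (Commute.mul_right (Commute.add_right (Commute.mul_right ?_
    (hK.mul_right hP)) (Commute.mul_right ?_ h)) (Commute.mul_right ?_ ?_))
    (Commute.mul_right (Commute.mul_right ?_ hK') ?_)
  · exact hG.commute (hT _ _) d1
  · exact hG.commute (ActsOn.opKinv subset_rfl) d1
  · exact hG.commute (ActsOn.opK subset_rfl) d2
  · exact hG.commute (ActsOn.opP subset_rfl) d2
  · exact hG.commute (ActsOn.opKinv subset_rfl) d1
  · exact hG.commute (hT _ _) d2

/-- `Γ` on an interval commutes with `A₊` on every larger interval. -/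
lemma opGamma_commute_opUp (L : ℂ) (γ : ℕ → ℝ) {a b c d : ℕ} (hac : a ≤ c + 1) (hcd : c + 1 ≤ d)
    (hdb : d ≤ b) : Commute (opGamma L γ (c + 1) d) (opUp L γ a b) :=
  opGamma_commute_of_split L γ ActsOn.opUp (opUp_split L γ) hac hcd hdb <| by
    rw [opGamma_eq]; exact (ospRel_interval L γ hcd).casimir_E (sq_ne_zero L)

lemma opGamma_commute_opDown (L : ℂ) (γ : ℕ → ℝ) {a b c d : ℕ} (hac : a ≤ c + 1)
    (hcd : c + 1 ≤ d) (hdb : d ≤ b) : Commute (opGamma L γ (c + 1) d) (opDown L γ a b) :=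
  opGamma_commute_of_split L γ ActsOn.opDown (opDown_split L γ) hac hcd hdb <| by
    rw [opGamma_eq]; exact (ospRel_interval L γ hcd).casimir_F (sq_ne_zero L)

end Interval

/-! ### The bilinear form -/

/-- The bilinear form `pair` as a bilinear map. -/
def form : Fock →ₗ[ℂ] Fock →ₗ[ℂ] ℂ := (basisMonomials ℕ ℂ).constr ℂ fun m => lcoeff ℂ m

lemma form_bvec_left (m : ℕ →₀ ℕ) (w : Fock) : form (bvec m) w = w.coeff m := by
  have : bvec m = basisMonomials ℕ ℂ m := by simp [bvec, coe_basisMonomials]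
  rw [form, this, Module.Basis.constr_basis]; rfl

lemma form_bvec (m m' : ℕ →₀ ℕ) : form (bvec m) (bvec m') = if m = m' then 1 else 0 := by
  classical
  rw [form_bvec_left, bvec, coeff_monomial]; simp only [eq_comm]

lemma pair_eq_form (v w : Fock) : pair v w = form v w := by
  have hv : v = ∑ m ∈ v.support, v.coeff m • bvec m := by
    conv_lhs => rw [v.as_sum]
    exact Finset.sum_congr rfl fun m _ => by rw [bvec, smul_monomial, smul_eq_mul, mul_one]
  conv_rhs => rw [hv]
  simp [pair, map_sum, form_bvec_left]

lemma form_symm (v w : Fock) : form v w = form w v := by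
  have : form = form.flip := by
    refine end_ext fun m => end_ext fun m' => ?_
    rw [LinearMap.flip_apply, form_bvec, form_bvec]; simp only [eq_comm]
  rw [this, LinearMap.flip_apply, ← this]

/-- `T'` is the transpose of `T`. -/
def IsTranspose (T T' : Module.End ℂ Fock) : Prop := ∀ v w, form (T v) w = form v (T' w)

namespace IsTranspose

lemma of_bvec {T T' : Module.End ℂ Fock}
    (h : ∀ m m', form (T (bvec m)) (bvec m') = form (bvec m) (T' (bvec m'))) :
    IsTranspose T T' := by
  have : form ∘ₗ T = form.compl₂ T' := end_ext fun m => end_ext fun m' => h m m'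
  intro v w
  exact LinearMap.congr_fun (LinearMap.congr_fun this v) w

lemma mul {T T' U U' : Module.End ℂ Fock} (h : IsTranspose T T') (h' : IsTranspose U U') :
    IsTranspose (T * U) (U' * T') := fun v w => by
  rw [Module.End.mul_apply, h, h', Module.End.mul_apply]

lemma add {T T' U U' : Module.End ℂ Fock} (h : IsTranspose T T') (h' : IsTranspose U U') :
    IsTranspose (T + U) (T' + U') := fun v w => by
  simp [h v w, h' v w]

lemma sub {T T' U U' : Module.End ℂ Fock} (h : IsTranspose T T') (h' : IsTranspose U U') :
    IsTranspose (T - U) (T' - U') := fun v w => by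
  simp [h v w, h' v w]

lemma neg {T T' : Module.End ℂ Fock} (h : IsTranspose T T') : IsTranspose (-T) (-T') :=
  fun v w => by
  simp [h v w]

lemma smul {T T' : Module.End ℂ Fock} (h : IsTranspose T T') (c : ℂ) :
    IsTranspose (c • T) (c • T') := fun v w => by
  simp [h v w]

lemma sum {ι : Type*} {s : Finset ι} {T T' : ι → Module.End ℂ Fock}
    (h : ∀ x ∈ s, IsTranspose (T x) (T' x)) : IsTranspose (∑ x ∈ s, T x) (∑ x ∈ s, T' x) :=
  fun v w => by
    simp only [LinearMap.sum_apply, map_sum]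
    exact Finset.sum_congr rfl fun x hx => h x hx v w

end IsTranspose

lemma isTranspose_diag (c : (ℕ →₀ ℕ) → ℂ) : IsTranspose (diag c) (diag c) :=
  IsTranspose.of_bvec fun m m' => by
    by_cases h : m = m'
    · subst h; simp [diag_bvec]
    · simp [diag_bvec, form_bvec, h]

lemma isTranspose_site (L : ℂ) (γ : ℕ → ℝ) (l : ℕ) :
    IsTranspose (siteUp L γ l) (siteDown L γ l) :=
  IsTranspose.of_bvec fun m m' => by
    simp only [siteUp_bvec, siteDown_bvec, map_smul, LinearMap.smul_apply, form_bvec]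
    rcases Nat.eq_zero_or_pos (m' l) with h0 | h0
    · have : m + Finsupp.single l 1 ≠ m' := fun e => by rw [← e] at h0; simp at h0
      rw [if_neg this, h0, sqrt_sigma_zero]; simp
    · by_cases h : m + Finsupp.single l 1 = m'
      · subst h; simp
      · have hm : m' - Finsupp.single l 1 + Finsupp.single l 1 = m' :=
          tsub_add_cancel_of_le (by simpa [Finsupp.single_le_iff] using Nat.succ_le_of_lt h0)
        have : m ≠ m' - Finsupp.single l 1 := fun e => h (by rw [e, hm])
        rw [if_neg h, if_neg this]; simp

lemma isTranspose_opUp (L : ℂ) (γ : ℕ → ℝ) (a b : ℕ) :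
    IsTranspose (opUp L γ a b) (opDown L γ a b) := by
  refine IsTranspose.sum fun l hl => ?_
  have h := ((isTranspose_diag fun m => (cK L γ (Finset.Ico a l) m)⁻¹).mul
    (isTranspose_site L γ l)).mul ((isTranspose_diag (cK L γ (Finset.Ioc l b))).mul
      (isTranspose_diag (cP (Finset.Ioc l b))))
  rw [← opKinv_eq, ← opK_eq, ← opP_eq] at h
  have h1 : Commute (opP (Finset.Ioc l b)) (opK L γ (Finset.Ioc l b)) := diag_commute _ _
  have h2 : Commute (opKinv L γ (Finset.Ico a l)) (siteDown L γ l) :=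
    opKinv_commute_siteDown (by simp)
  have h3 : Commute (opK L γ (Finset.Ioc l b) * opP (Finset.Ioc l b))
      (opKinv L γ (Finset.Ico a l) * siteDown L γ l) :=
    Commute.mul_left
      ((opK_commute_opKinv _ _ _ _).mul_right (opK_commute_siteDown (by simp)))
      ((opKinv_commute_opP _ _ _ _).symm.mul_right (opP_commute_siteDown (by simp)))
  rwa [h1.eq, ← h2.eq, h3.eq] at h

lemma isTranspose_opGamma (L : ℂ) (γ : ℕ → ℝ) {a b : ℕ} (h : a ≤ b) :
    IsTranspose (opGamma L γ a b) (opGamma L γ a b) := by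
  have hE := isTranspose_opUp L γ a b
  have hF : IsTranspose (opDown L γ a b) (opUp L γ a b) := fun v w => by
    rw [form_symm, ← hE, form_symm]
  have hK : IsTranspose (opK L γ (Finset.Icc a b)) (opK L γ (Finset.Icc a b)) :=
    isTranspose_diag _
  have hK' : IsTranspose (opKinv L γ (Finset.Icc a b)) (opKinv L γ (Finset.Icc a b)) := by
    rw [opKinv_eq]; exact isTranspose_diag _
  have hP : IsTranspose (opP (Finset.Icc a b)) (opP (Finset.Icc a b)) := isTranspose_diag _
  have H := ((((hE.mul hF).neg.add ((hK.mul hK).smul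
    (qpow L (-(1 / 2)) / (qq L - (qq L)⁻¹)))).sub ((hK'.mul hK').smul
      (qpow L (1 / 2) / (qq L - (qq L)⁻¹)))).mul hP)
  have hc : Commute (opP (Finset.Icc a b))
      (-(opUp L γ a b * opDown L γ a b)
        + (qpow L (-(1 / 2)) / (qq L - (qq L)⁻¹)) • (opK L γ (Finset.Icc a b)
          * opK L γ (Finset.Icc a b))
        - (qpow L (1 / 2) / (qq L - (qq L)⁻¹)) • (opKinv L γ (Finset.Icc a b)
          * opKinv L γ (Finset.Icc a b))) := by
    have R := ospRel_interval L γ h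
    have c1 : Commute (opP (Finset.Icc a b)) (opK L γ (Finset.Icc a b)) := R.KP.symm
    have c2 : Commute (opP (Finset.Icc a b)) (opKinv L γ (Finset.Icc a b)) := R.K'P.symm
    exact (R.commute_P.neg_right.add_right ((c1.mul_right c1).smul_right _)).sub_right
      ((c2.mul_right c2).smul_right _)
  rw [hc.eq] at H
  simpa only [opGamma, pow_two] using H

/-! ### Homogeneous vectors on an interval of positions -/

/-- The vectors on the positions `a, …, b` that are homogeneous of degree `d`. -/
def level (a b d : ℕ) : Submodule ℂ Fock :=
  Submodule.span ℂ {v | ∃ m : ℕ →₀ ℕ, (∀ l, l ∉ Finset.Icc a b → m l = 0) ∧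
    ∑ l ∈ Finset.Icc a b, m l = d ∧ v = bvec m}

lemma mul_mem_level {a b c d d' : ℕ} (h1 : a ≤ c + 1) (h2 : c ≤ b) {f g : Fock}
    (hf : f ∈ level a c d) (hg : g ∈ level (c + 1) b d') : f * g ∈ level a b (d + d') := by
  have := Submodule.mul_mem_mul hf hg
  rw [level, level, Submodule.span_mul_span] at this
  refine Submodule.span_mono ?_ this
  rintro _ ⟨_, ⟨m, h3, h4, rfl⟩, _, ⟨m', h5, h6, rfl⟩, rfl⟩
  refine ⟨m + m', fun l hl => ?_, ?_, bvec_mul _ _⟩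
  · rw [Finsupp.add_apply, h3 l, h5 l]
    all_goals simp only [Finset.mem_Icc] at hl ⊢; omega
  · rw [Icc_split h1 h2, Finset.sum_union (Icc_disj _ _ _)]
    simp only [Finsupp.add_apply, Finset.sum_add_distrib]
    rw [h4, h6, Finset.sum_eq_zero fun l hl => h5 l ?_,
      Finset.sum_eq_zero fun l hl => h3 l ?_]
    · simp
    · simp only [Finset.mem_Icc] at hl ⊢; omega
    · simp only [Finset.mem_Icc] at hl ⊢; omega

lemma X_pow_mem_level (l p : ℕ) : (X l : Fock) ^ p ∈ level l l p := by
  refine Submodule.subset_span ⟨Finsupp.single l p, fun t ht => ?_, by simp, ?_⟩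
  · rw [Finset.Icc_self, Finset.mem_singleton] at ht
    simp [ht]
  · rw [bvec, X_pow_eq_monomial]

lemma diag_apply_of_mem_span {c : (ℕ →₀ ℕ) → ℂ} {t : ℂ} {s : Set Fock}
    (hs : ∀ v ∈ s, ∃ m, v = bvec m ∧ c m = t) {v : Fock} (hv : v ∈ Submodule.span ℂ s) :
    diag c v = t • v := by
  induction hv using Submodule.span_induction with
  | mem v hv => obtain ⟨m, rfl, h⟩ := hs v hv; rw [diag_bvec, h]
  | zero => simp
  | add v w _ _ h1 h2 => rw [map_add, h1, h2, smul_add]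
  | smul r v _ h => rw [map_smul, h, smul_comm]

lemma cK_of_sum (L : ℂ) (γ : ℕ → ℝ) {a b d : ℕ} {m : ℕ →₀ ℕ}
    (h : ∑ l ∈ Finset.Icc a b, m l = d) :
    cK L γ (Finset.Icc a b) m = qpow L ((1 / 2) * ((d : ℂ) + (gsum γ a b : ℂ))) := by
  rw [cK, Finset.sum_add_distrib, ← h, gsum]; push_cast; rfl

lemma opK_of_mem_level (L : ℂ) (γ : ℕ → ℝ) {a b d : ℕ} {v : Fock} (hv : v ∈ level a b d) :
    opK L γ (Finset.Icc a b) v = qpow L ((1 / 2) * ((d : ℂ) + (gsum γ a b : ℂ))) • v :=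
  diag_apply_of_mem_span (by
    rintro _ ⟨m, _, h, rfl⟩
    exact ⟨m, rfl, cK_of_sum L γ h⟩) hv

lemma opKinv_of_mem_level (L : ℂ) (γ : ℕ → ℝ) {a b d : ℕ} {v : Fock} (hv : v ∈ level a b d) :
    opKinv L γ (Finset.Icc a b) v = qpow L (-((1 / 2) * ((d : ℂ) + (gsum γ a b : ℂ)))) • v := by
  rw [opKinv_eq]
  exact diag_apply_of_mem_span (by
    rintro _ ⟨m, _, h, rfl⟩
    exact ⟨m, rfl, by rw [cK_of_sum L γ h, qpow_neg]⟩) hv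

lemma opP_of_mem_level {a b d : ℕ} {v : Fock} (hv : v ∈ level a b d) :
    opP (Finset.Icc a b) v = (-1 : ℂ) ^ d • v :=
  diag_apply_of_mem_span (c := cP (Finset.Icc a b)) (by
    rintro _ ⟨m, _, h, rfl⟩
    exact ⟨m, rfl, by rw [cP, h]⟩) hv

lemma ActsOn.mul_right_of_mem_level {L : ℂ} {γ : ℕ → ℝ} {S : Finset ℕ} {T : Module.End ℂ Fock}
    (h : ActsOn L γ S T) {a b d : ℕ} (hd : Disjoint S (Finset.Icc a b)) {f g : Fock}
    (hg : g ∈ level a b d) : T (f * g) = T f * g := by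
  rw [Finset.disjoint_left] at hd
  induction hg using Submodule.span_induction with
  | mem v hv => obtain ⟨m, hm, _, rfl⟩ := hv; exact h.mul_bvec (fun l hl => hm l (hd hl)) f
  | zero => simp
  | add v w _ _ h1 h2 => rw [mul_add, map_add, h1, h2, mul_add]
  | smul r v _ h => rw [mul_smul_comm, map_smul, h, mul_smul_comm]

lemma ActsOn.mul_left_of_mem_level {L : ℂ} {γ : ℕ → ℝ} {S : Finset ℕ} {T : Module.End ℂ Fock}
    (h : ActsOn L γ S T) {a b d : ℕ} (hd : Disjoint S (Finset.Icc a b)) {f g : Fock}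
    (hf : f ∈ level a b d) : T (f * g) = f * T g := by
  rw [mul_comm, h.mul_right_of_mem_level hd hf, mul_comm]

/-- The form is multiplicative on products of vectors on disjoint intervals. -/
lemma form_mul {a b c d d' e e' : ℕ} {f f' g g' : Fock} (hf : f ∈ level a c d)
    (hf' : f' ∈ level a c d') (hg : g ∈ level (c + 1) b e) (hg' : g' ∈ level (c + 1) b e') :
    form (f * g) (f' * g') = form f f' * form g g' := by
  induction hf using Submodule.span_induction with
  | zero => simp
  | add v w _ _ h1 h2 => rw [add_mul, map_add, LinearMap.add_apply, h1, h2, map_add,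
      LinearMap.add_apply, add_mul]
  | smul r v _ h => rw [smul_mul_assoc, map_smul, LinearMap.smul_apply, h, map_smul,
      LinearMap.smul_apply, smul_mul_assoc]
  | mem v hv =>
  obtain ⟨m, hm, _, rfl⟩ := hv
  induction hf' using Submodule.span_induction with
  | zero => simp
  | add v w _ _ h1 h2 => rw [add_mul, map_add, h1, h2, map_add, add_mul]
  | smul r v _ h => rw [smul_mul_assoc, map_smul, h, map_smul, smul_mul_assoc]
  | mem v hv =>
  obtain ⟨m', hm', _, rfl⟩ := hv
  induction hg using Submodule.span_induction with
  | zero => simp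
  | add v w _ _ h1 h2 => rw [mul_add, map_add, LinearMap.add_apply, h1, h2, map_add,
      LinearMap.add_apply, mul_add]
  | smul r v _ h => rw [mul_smul_comm, map_smul, LinearMap.smul_apply, h, map_smul,
      LinearMap.smul_apply, mul_smul_comm]
  | mem v hv =>
  obtain ⟨n, hn, _, rfl⟩ := hv
  induction hg' using Submodule.span_induction with
  | zero => simp
  | add v w _ _ h1 h2 => rw [mul_add, map_add, h1, h2, map_add, mul_add]
  | smul r v _ h => rw [mul_smul_comm, map_smul, h, map_smul, mul_smul_comm]
  | mem v hv =>
  obtain ⟨n', hn', _, rfl⟩ := hv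
  simp only [bvec_mul, form_bvec]
  by_cases h : m = m'
  · subst h; simp
  · have : m + n ≠ m' + n' := fun e => h <| by
      ext t
      have et := DFunLike.congr_fun e t
      simp only [Finsupp.add_apply] at et
      by_cases ht : t ∈ Finset.Icc a c
      · have ht' : t ∉ Finset.Icc (c + 1) b := Finset.disjoint_left.1 (Icc_disj a b c) ht
        rw [hn t ht', hn' t ht'] at et; omega
      · rw [hm t ht, hm' t ht]
    rw [if_neg h, if_neg this, zero_mul]

/-- `A₊` on a product of homogeneous vectors on adjacent intervals. -/
lemma opUp_mul (L : ℂ) (γ : ℕ → ℝ) {a b c d e : ℕ} (h1 : a ≤ c + 1) (h2 : c ≤ b) {f g : Fock}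
    (hf : f ∈ level a c d) (hg : g ∈ level (c + 1) b e) :
    opUp L γ a b (f * g)
      = ((-1) ^ e * qpow L ((1 / 2) * ((e : ℂ) + (gsum γ (c + 1) b : ℂ)))) • (opUp L γ a c f * g)
        + qpow L (-((1 / 2) * ((d : ℂ) + (gsum γ a c : ℂ)))) • (f * opUp L γ (c + 1) b g) := by
  have hd := Icc_disj a b c
  rw [opUp_split L γ h1 h2]
  simp only [LinearMap.add_apply, Module.End.mul_apply]
  rw [(ActsOn.opP (L := L) (γ := γ) subset_rfl).mul_left_of_mem_level hd.symm hf,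
    opP_of_mem_level hg, mul_smul_comm, map_smul,
    (ActsOn.opK subset_rfl).mul_left_of_mem_level hd.symm hf, opK_of_mem_level L γ hg,
    mul_smul_comm, smul_smul, map_smul, (ActsOn.opUp a c).mul_right_of_mem_level hd hg,
    (ActsOn.opUp (c + 1) b).mul_left_of_mem_level hd.symm hf]
  congr 1
  have := (ActsOn.opUp (L := L) (γ := γ) (c + 1) b).commute
    (ActsOn.opKinv (L := L) (γ := γ) (U := Finset.Icc a c) subset_rfl) hd.symm
  have e1 := LinearMap.congr_fun this.eq (f * g)
  simp only [Module.End.mul_apply] at e1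
  rw [(ActsOn.opUp (c + 1) b).mul_left_of_mem_level hd.symm hf] at e1
  rw [← e1, (ActsOn.opKinv subset_rfl).mul_right_of_mem_level hd hg, opKinv_of_mem_level L γ hf,
    smul_mul_assoc, map_smul, (ActsOn.opUp (c + 1) b).mul_left_of_mem_level hd.symm hf]

/-- `A₋` on a product of homogeneous vectors on adjacent intervals. -/
lemma opDown_mul (L : ℂ) (γ : ℕ → ℝ) {a b c d e : ℕ} (h1 : a ≤ c + 1) (h2 : c ≤ b) {f g : Fock}
    (hf : f ∈ level a c d) (hg : g ∈ level (c + 1) b e) :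
    opDown L γ a b (f * g)
      = ((-1) ^ e * qpow L ((1 / 2) * ((e : ℂ) + (gsum γ (c + 1) b : ℂ)))) • (opDown L γ a c f * g)
        + qpow L (-((1 / 2) * ((d : ℂ) + (gsum γ a c : ℂ)))) • (f * opDown L γ (c + 1) b g) := by
  have hd := Icc_disj a b c
  rw [opDown_split L γ h1 h2]
  simp only [LinearMap.add_apply, Module.End.mul_apply]
  rw [(ActsOn.opP (L := L) (γ := γ) subset_rfl).mul_left_of_mem_level hd.symm hf,
    opP_of_mem_level hg, mul_smul_comm, map_smul,
    (ActsOn.opK subset_rfl).mul_left_of_mem_level hd.symm hf, opK_of_mem_level L γ hg,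
    mul_smul_comm, smul_smul, map_smul, (ActsOn.opDown a c).mul_right_of_mem_level hd hg,
    (ActsOn.opDown (c + 1) b).mul_left_of_mem_level hd.symm hf]
  congr 1
  have := (ActsOn.opDown (L := L) (γ := γ) (c + 1) b).commute
    (ActsOn.opKinv (L := L) (γ := γ) (U := Finset.Icc a c) subset_rfl) hd.symm
  have e1 := LinearMap.congr_fun this.eq (f * g)
  simp only [Module.End.mul_apply] at e1
  rw [(ActsOn.opDown (c + 1) b).mul_left_of_mem_level hd.symm hf] at e1
  rw [← e1, (ActsOn.opKinv subset_rfl).mul_right_of_mem_level hd hg, opKinv_of_mem_level L γ hf,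
    smul_mul_assoc, map_smul, (ActsOn.opDown (c + 1) b).mul_left_of_mem_level hd.symm hf]

/-! ### Nonvanishing of the structure constants -/

lemma norm_qpow_ne_one {L : ℂ} (hL : ‖qq L‖ ≠ 1) {x : ℝ} (hx : x ≠ 0) : ‖qpow L x‖ ≠ 1 := by
  rw [qq, Complex.norm_exp, Ne, Real.exp_eq_one_iff] at hL
  rw [qpow, Complex.norm_exp, Ne, Real.exp_eq_one_iff]
  simpa [hx] using hL

lemma norm_neg_qq_pow {L : ℂ} (n : ℕ) : ‖(-qq L) ^ n‖ = ‖qpow L (n : ℝ)‖ := by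
  rw [Complex.ofReal_natCast, qpow_natCast, norm_pow, norm_neg, norm_pow]

/-- `z ↦ z - z⁻¹` identifies only `z` and `-z⁻¹`. -/
lemma eq_or_mul_eq_of_sub_inv_eq {y z : ℂ} (hy : y ≠ 0) (hz : z ≠ 0)
    (h : y - y⁻¹ = z - z⁻¹) : y = z ∨ y * z = -1 := by
  have : (y - z) * (y * z + 1) = 0 := by
    field_simp at h
    linear_combination h
  rcases mul_eq_zero.1 this with h | h
  · exact Or.inl (sub_eq_zero.1 h)
  · exact Or.inr (eq_neg_of_add_eq_zero_left h)

lemma qq_sub_inv_ne_zero {L : ℂ} (hL : ‖qq L‖ ≠ 1) : qq L - (qq L)⁻¹ ≠ 0 := by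
  intro h
  have h1 : qq L * qq L = 1 := by
    field_simp [qq_ne_zero] at h
    linear_combination h
  apply hL
  have := congrArg norm h1
  rw [norm_mul, norm_one] at this
  nlinarith [norm_nonneg (qq L)]

/-- `[n + z]_q` with the sign `(-1)^n`, as a function of `(-q)^n q^z`. -/
lemma neg_one_pow_mul_qnum (L z : ℂ) (n : ℕ) :
    (-1) ^ n * qnum L (n + z) = ((-qq L) ^ n * qpow L z - ((-qq L) ^ n * qpow L z)⁻¹)
      / (qq L - (qq L)⁻¹) := by
  have h : ((-1 : ℂ) ^ n)⁻¹ = (-1) ^ n := by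
    rw [← inv_pow]; norm_num
  rw [qnum, qpow_neg, qpow_add, qpow_natCast, neg_pow (qq L), mul_inv, mul_inv, mul_inv, h]
  ring

/-- The eigenvalues of the Casimir element on the lowest weight modules of lowest weights
`z + 1/2, z + 3/2, …` are distinct. -/
lemma casimir_eigenvalue_injective {L : ℂ} (hL : ‖qq L‖ ≠ 1) {z : ℝ} (hz : 0 < z) {m n : ℕ}
    (h : (-1) ^ m * qnum L (m + z) = (-1) ^ n * qnum L (n + z)) : m = n := by
  rw [neg_one_pow_mul_qnum, neg_one_pow_mul_qnum, div_left_inj' (qq_sub_inv_ne_zero hL)] at h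
  have hne : ∀ k : ℕ, (-qq L) ^ k * qpow L z ≠ 0 := fun k =>
    mul_ne_zero (pow_ne_zero _ (neg_ne_zero.2 (qq_ne_zero L))) (qpow_ne_zero _ _)
  rcases eq_or_mul_eq_of_sub_inv_eq (hne m) (hne n) h with h | h
  · by_contra hmn
    have h1 := congrArg norm h
    rw [norm_mul, norm_mul, norm_neg_qq_pow, norm_neg_qq_pow] at h1
    have h2 := mul_right_cancel₀ (norm_ne_zero_iff.2 (qpow_ne_zero L z)) h1
    have h3 : ‖qpow L ((m : ℝ) - (n : ℝ) : ℝ)‖ = 1 := by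
      rw [Complex.ofReal_sub, qpow_sub, norm_div, h2,
        div_self (norm_ne_zero_iff.2 (qpow_ne_zero _ _))]
    exact norm_qpow_ne_one hL (sub_ne_zero.2 (Nat.cast_injective.ne hmn)) h3
  · have h1 := congrArg norm h
    rw [norm_mul, norm_mul, norm_mul, norm_neg_qq_pow, norm_neg_qq_pow, norm_neg, norm_one,
      ← norm_mul, ← norm_mul, ← norm_mul, ← qpow_add, ← qpow_add, ← qpow_add] at h1
    have h2 : (((m : ℝ) : ℂ) + (z : ℂ) + (((n : ℝ) : ℂ) + (z : ℂ)))
        = (((m : ℝ) + z + ((n : ℝ) + z) : ℝ) : ℂ) := by push_cast; ring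
    rw [h2] at h1
    exact absurd h1 (norm_qpow_ne_one hL (by positivity))

lemma sigma_ne_zero {L : ℂ} (hL : ‖qq L‖ ≠ 1) {m : ℕ} (hm : m ≠ 0) {g : ℝ} (hg : 1 / 2 < g) :
    sigma L m g ≠ 0 := by
  intro h
  refine hm (casimir_eigenvalue_injective hL (z := g - 1 / 2) (by linarith) (n := 0) ?_)
  have h2 : ((-1 : ℂ) ^ m) * (-1) ^ m = 1 := by rw [← mul_pow]; norm_num
  rw [sigma, sub_eq_zero] at h
  push_cast
  rw [← add_sub_assoc, h, ← mul_assoc, h2]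
  simp

/-! ### Lowest weight sequences -/

lemma form_level_ne {d d' : ℕ} (hd : d ≠ d') {v w : Fock} (hv : v ∈ level a b d)
    (hw : w ∈ level a b d') : form v w = 0 := by
  induction hv using Submodule.span_induction with
  | zero => simp
  | add v w _ _ h1 h2 => rw [map_add, LinearMap.add_apply, h1, h2, add_zero]
  | smul r v _ h => rw [map_smul, LinearMap.smul_apply, h, smul_zero]
  | mem v hv =>
  obtain ⟨m, _, h1, rfl⟩ := hv
  induction hw using Submodule.span_induction with
  | zero => simp
  | add v w _ _ h1 h2 => rw [map_add, h1, h2, add_zero]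
  | smul r v _ h => rw [map_smul, h, smul_zero]
  | mem v hv =>
  obtain ⟨m', _, h2, rfl⟩ := hv
  rw [form_bvec, if_neg]
  rintro rfl
  exact hd (h1.symm.trans h2)

/-- On a vector of degree `d`, where `K` and `P` are scalars, `Γ` is `-A₊A₋` plus a `q`-number, up
to the sign `(-1)^d`. -/
lemma opGamma_of_mem_level (L : ℂ) (γ : ℕ → ℝ) {a b d : ℕ} {v : Fock} (hv : v ∈ level a b d) :
    opGamma L γ a b v = (-1 : ℂ) ^ d • (qnum L (d + gsum γ a b - 1 / 2) • v
      - opUp L γ a b (opDown L γ a b v)) := by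
  rw [opGamma]
  simp only [Module.End.mul_apply, opP_of_mem_level hv, map_smul, LinearMap.sub_apply,
    LinearMap.add_apply, LinearMap.neg_apply, LinearMap.smul_apply, pow_two,
    opK_of_mem_level L γ hv, opKinv_of_mem_level L γ hv, smul_smul]
  congr 1
  rw [add_sub_assoc, ← sub_smul, neg_add_eq_sub]
  congr 2
  have e1 : qpow L (-(1 / 2)) * (qpow L ((1 / 2) * ((d : ℂ) + (gsum γ a b : ℂ)))
      * qpow L ((1 / 2) * ((d : ℂ) + (gsum γ a b : ℂ)))) = qpow L (d + gsum γ a b - 1 / 2) := by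
    rw [← qpow_add, ← qpow_add]; congr 1; ring
  have e2 : qpow L (1 / 2) * (qpow L (-((1 / 2) * ((d : ℂ) + (gsum γ a b : ℂ))))
      * qpow L (-((1 / 2) * ((d : ℂ) + (gsum γ a b : ℂ)))))
        = qpow L (-(d + gsum γ a b - 1 / 2)) := by
    rw [← qpow_add, ← qpow_add]; congr 1; ring
  rw [qnum, ← e1, ← e2]
  ring

/-- The vectors `v p = A₊^p v 0` on the positions `a, …, b`, where `v 0` is homogeneous of degree
`h` and `A₋ v 0 = 0`: a basis of a lowest weight module. -/
structure IsLW (L : ℂ) (γ : ℕ → ℝ) (a b h : ℕ) (v : ℕ → Fock) : Prop where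
  le : a ≤ b
  mem : ∀ p, v p ∈ level a b (h + p)
  up : ∀ p, opUp L γ a b (v p) = v (p + 1)
  down_zero : opDown L γ a b (v 0) = 0

namespace IsLW

variable {L : ℂ} {γ : ℕ → ℝ} {a b h : ℕ} {v : ℕ → Fock}

lemma anticomm (hv : IsLW L γ a b h v) (p : ℕ) :
    opUp L γ a b (opDown L γ a b (v p)) + opDown L γ a b (opUp L γ a b (v p))
      = (sigma L (p + 1) (h + gsum γ a b) + sigma L p (h + gsum γ a b)) • v p := by
  have e := LinearMap.congr_fun (ospRel_interval L γ hv.le).EF (v p)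
  simp only [LinearMap.add_apply, Module.End.mul_apply, LinearMap.smul_apply, LinearMap.sub_apply,
    opK_of_mem_level L γ (hv.mem p), opKinv_of_mem_level L γ (hv.mem p), map_smul, smul_smul,
    ← sub_smul, ← qpow_add] at e
  rw [e, sigma_succ_add_sigma]
  congr 3 <;> congr 1 <;> push_cast <;> ring

lemma down_succ (hv : IsLW L γ a b h v) (p : ℕ) :
    opDown L γ a b (v (p + 1)) = sigma L (p + 1) (h + gsum γ a b) • v p := by
  induction p with
  | zero =>
    have e := hv.anticomm 0
    rw [hv.down_zero, map_zero, zero_add, hv.up, sigma_zero, add_zero] at e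
    exact e
  | succ p ih =>
    have e := hv.anticomm (p + 1)
    rw [ih, map_smul, hv.up, hv.up, add_smul, add_comm] at e
    exact add_right_cancel e

lemma down (hv : IsLW L γ a b h v) (p : ℕ) :
    opDown L γ a b (v p) = sigma L p (h + gsum γ a b) • v (p - 1) := by
  cases p with
  | zero => rw [hv.down_zero, sigma_zero, zero_smul]
  | succ p => exact hv.down_succ p

lemma form_succ (hv : IsLW L γ a b h v) {v' : ℕ → Fock} (hv' : IsLW L γ a b h v') (p : ℕ) :
    form (v (p + 1)) (v' (p + 1)) = sigma L (p + 1) (h + gsum γ a b) * form (v p) (v' p) := by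
  rw [← hv.up, isTranspose_opUp, hv'.down_succ, map_smul, smul_eq_mul]

lemma form_eq (hv : IsLW L γ a b h v) {v' : ℕ → Fock} (hv' : IsLW L γ a b h v') (p : ℕ) :
    form (v p) (v' p)
      = (∏ l ∈ Finset.range p, sigma L (l + 1) (h + gsum γ a b)) * form (v 0) (v' 0) := by
  induction p with
  | zero => simp
  | succ p ih => rw [form_succ hv hv', ih, Finset.prod_range_succ]; ring

lemma form_ne_zero (hL : ‖qq L‖ ≠ 1) (hv : IsLW L γ a b h v) (hg : 1 / 2 < h + gsum γ a b)
    (h0 : form (v 0) (v 0) ≠ 0) (p : ℕ) : form (v p) (v p) ≠ 0 := by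
  rw [hv.form_eq hv]
  exact mul_ne_zero (Finset.prod_ne_zero_iff.2 fun l _ => sigma_ne_zero hL (by omega) hg) h0

lemma ne_zero (hL : ‖qq L‖ ≠ 1) (hv : IsLW L γ a b h v) (hg : 1 / 2 < h + gsum γ a b)
    (h0 : v 0 ≠ 0) (p : ℕ) : v p ≠ 0 := by
  induction p with
  | zero => exact h0
  | succ p ih =>
    intro e
    have h1 := hv.down_succ p
    rw [e, map_zero] at h1
    exact smul_ne_zero (sigma_ne_zero hL (by omega) hg) ih h1.symm

/-- The Casimir element is a scalar on a lowest weight module. -/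
lemma gamma (hv : IsLW L γ (a + 1) b h v) (p : ℕ) :
    opGamma L γ (a + 1) b (v p)
      = ((-1) ^ h * qnum L (h + gsum γ (a + 1) b - 1 / 2)) • v p := by
  induction p with
  | zero =>
    rw [opGamma_of_mem_level L γ (hv.mem 0), hv.down_zero, map_zero, sub_zero, smul_smul, add_zero]
  | succ p ih =>
    have hc := opGamma_commute_opUp L γ (a := a + 1) (c := a) (d := b) (b := b) le_rfl
      hv.le le_rfl
    have e := LinearMap.congr_fun hc.eq (v p)
    simp only [Module.End.mul_apply, hv.up, ih, map_smul] at e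
    exact e

end IsLW

/-! ### Coupling two lowest weight modules -/

/-- If a symmetric operator has `n` eigenvectors with distinct eigenvalues in the span of `n`
orthogonal vectors that are not isotropic, then these eigenvectors are not isotropic. -/
lemma form_self_ne_zero_of_eigenvectors {n : ℕ} {b x : Fin n → Fock} {T : Module.End ℂ Fock}
    (hT : IsTranspose T T) {θ : Fin n → ℂ} (hθ : Function.Injective θ)
    (hx : ∀ t, T (x t) = θ t • x t) (hx0 : ∀ t, x t ≠ 0)
    (hxb : ∀ t, x t ∈ Submodule.span ℂ (Set.range b))
    (hb : ∀ p r, p ≠ r → form (b p) (b r) = 0) (hb0 : ∀ p, form (b p) (b p) ≠ 0) (t : Fin n) :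
    form (x t) (x t) ≠ 0 := by
  intro h
  have hli : LinearIndependent ℂ x := Module.End.eigenvectors_linearIndependent' T θ hθ x fun t =>
    ⟨Module.End.mem_eigenspace_iff.2 (hx t), hx0 t⟩
  have hle : Submodule.span ℂ (Set.range x) ≤ Submodule.span ℂ (Set.range b) :=
    Submodule.span_le.2 (by rintro _ ⟨t, rfl⟩; exact hxb t)
  have hfin : Module.finrank ℂ (Submodule.span ℂ (Set.range b))
      ≤ Module.finrank ℂ (Submodule.span ℂ (Set.range x)) := by
    rw [finrank_span_eq_card hli]; exact finrank_range_le_card b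
  have := FiniteDimensional.span_of_finite ℂ (Set.finite_range b)
  have heq := Submodule.eq_of_le_of_finrank_le hle hfin
  have horth : ∀ y ∈ Submodule.span ℂ (Set.range x), form (x t) y = 0 := by
    intro y hy
    induction hy using Submodule.span_induction with
    | zero => simp
    | add v w _ _ h1 h2 => rw [map_add, h1, h2, add_zero]
    | smul r v _ h => rw [map_smul, h, smul_zero]
    | mem v hv =>
    obtain ⟨t', rfl⟩ := hv
    by_cases e : t = t'
    · rw [← e, h]
    · have h1 := hT (x t) (x t')
      rw [hx, hx, map_smul, LinearMap.smul_apply, map_smul, smul_eq_mul, smul_eq_mul] at h1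
      by_contra h2
      exact e (hθ (mul_right_cancel₀ h2 h1))
  obtain ⟨κ, hκ⟩ := (Submodule.mem_span_range_iff_exists_fun ℂ).1 (hxb t)
  refine hx0 t ?_
  rw [← hκ]
  refine Finset.sum_eq_zero fun p _ => ?_
  have h1 := horth (b p) (heq ▸ Submodule.subset_span ⟨p, rfl⟩)
  rw [← hκ, map_sum, LinearMap.sum_apply, Finset.sum_eq_single p] at h1
  · rw [map_smul, LinearMap.smul_apply, smul_eq_mul] at h1
    rw [(mul_eq_zero.1 h1).resolve_right (hb0 p), zero_smul]
  · intro r _ hr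
    rw [map_smul, LinearMap.smul_apply, hb r p hr, smul_zero]
  · simp

/-- The span of the products `v p * u r` with `p + r = N`. -/
def prods (v u : ℕ → Fock) (N : ℕ) : Submodule ℂ Fock :=
  Submodule.span ℂ {w | ∃ p r, p + r = N ∧ w = v p * u r}

lemma mul_mem_prods (v u : ℕ → Fock) {p r N : ℕ} (h : p + r = N) : v p * u r ∈ prods v u N :=
  Submodule.subset_span ⟨p, r, h, rfl⟩

/-- The coefficient of `v (p - 1) * u r` in `A₋ (v p * u r)`. -/
def coefLeft (L : ℂ) (γ : ℕ → ℝ) (a c b h₁ h₂ p r : ℕ) : ℂ :=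
  (-1) ^ (h₂ + r) * qpow L ((1 / 2) * (((h₂ + r : ℕ) : ℂ) + (gsum γ (c + 1) b : ℂ)))
    * sigma L p (h₁ + gsum γ a c)

/-- The coefficient of `v p * u (r - 1)` in `A₋ (v p * u r)`. -/
def coefRight (L : ℂ) (γ : ℕ → ℝ) (a c b h₁ h₂ p r : ℕ) : ℂ :=
  qpow L (-((1 / 2) * (((h₁ + p : ℕ) : ℂ) + (gsum γ a c : ℂ))))
    * sigma L r (h₂ + gsum γ (c + 1) b)

/-- The coefficients `ε` make `∑ p, ε p • (v p * u (s - p))` a lowest weight vector. -/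
def IsCoupling (L : ℂ) (γ : ℕ → ℝ) (a c b h₁ h₂ s : ℕ) (ε : ℕ → ℂ) : Prop :=
  ε 0 ≠ 0 ∧ ∀ p < s, ε (p + 1) * coefLeft L γ a c b h₁ h₂ (p + 1) (s - (p + 1))
    + ε p * coefRight L γ a c b h₁ h₂ p (s - p) = 0

/-- The coupled vector `∑ p, ε p • (v p * u (s - p))`. -/
def coupled (v u : ℕ → Fock) (s : ℕ) (ε : ℕ → ℂ) : Fock :=
  ∑ p ∈ Finset.range (s + 1), ε p • (v p * u (s - p))

section Coupling

variable {L : ℂ} {γ : ℕ → ℝ} {a b c h₁ h₂ : ℕ} {v u : ℕ → Fock}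

lemma coefLeft_ne_zero (hL : ‖qq L‖ ≠ 1) (hg₁ : 1 / 2 < h₁ + gsum γ a c) (p r : ℕ) :
    coefLeft L γ a c b h₁ h₂ (p + 1) r ≠ 0 :=
  mul_ne_zero (mul_ne_zero (pow_ne_zero _ (by norm_num)) (qpow_ne_zero _ _))
    (sigma_ne_zero hL (by omega) hg₁)

lemma exists_isCoupling (hL : ‖qq L‖ ≠ 1) (hg₁ : 1 / 2 < h₁ + gsum γ a c) (s : ℕ) :
    ∃ ε, IsCoupling L γ a c b h₁ h₂ s ε := by
  let ε : ℕ → ℂ := fun p => Nat.rec 1 (fun p e => -(e * coefRight L γ a c b h₁ h₂ p (s - p))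
    / coefLeft L γ a c b h₁ h₂ (p + 1) (s - (p + 1))) p
  refine ⟨ε, one_ne_zero, fun p _ => ?_⟩
  have : ε (p + 1) = -(ε p * coefRight L γ a c b h₁ h₂ p (s - p))
    / coefLeft L γ a c b h₁ h₂ (p + 1) (s - (p + 1)) := rfl
  rw [this, div_mul_cancel₀ _ (coefLeft_ne_zero hL hg₁ _ _), neg_add_cancel]

lemma opDown_mul_lw (hv : IsLW L γ a c h₁ v) (hu : IsLW L γ (c + 1) b h₂ u) (p r : ℕ) :
    opDown L γ a b (v p * u r) = coefLeft L γ a c b h₁ h₂ p r • (v (p - 1) * u r)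
      + coefRight L γ a c b h₁ h₂ p r • (v p * u (r - 1)) := by
  have h1 := hv.le
  have h2 := hu.le
  rw [opDown_mul L γ (by omega) (by omega) (hv.mem p) (hu.mem r), hv.down, hu.down,
    smul_mul_assoc, mul_smul_comm, smul_smul, smul_smul, coefLeft, coefRight]

lemma opUp_mul_lw (hv : IsLW L γ a c h₁ v) (hu : IsLW L γ (c + 1) b h₂ u) (p r : ℕ) :
    opUp L γ a b (v p * u r)
      = ((-1) ^ (h₂ + r) * qpow L ((1 / 2) * (((h₂ + r : ℕ) : ℂ) + (gsum γ (c + 1) b : ℂ))))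
          • (v (p + 1) * u r)
        + qpow L (-((1 / 2) * (((h₁ + p : ℕ) : ℂ) + (gsum γ a c : ℂ)))) • (v p * u (r + 1)) := by
  have h1 := hv.le
  have h2 := hu.le
  rw [opUp_mul L γ (by omega) (by omega) (hv.mem p) (hu.mem r), hv.up, hu.up]

lemma opUp_mem_prods (hv : IsLW L γ a c h₁ v) (hu : IsLW L γ (c + 1) b h₂ u) {N : ℕ} {w : Fock}
    (hw : w ∈ prods v u N) : opUp L γ a b w ∈ prods v u (N + 1) := by
  refine (Submodule.span_le.2 ?_ : prods v u N ≤ (prods v u (N + 1)).comap (opUp L γ a b)) hw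
  rintro _ ⟨p, r, h, rfl⟩
  rw [SetLike.mem_coe, Submodule.mem_comap, opUp_mul_lw hv hu]
  exact add_mem (Submodule.smul_mem _ _ (mul_mem_prods v u (by omega)))
    (Submodule.smul_mem _ _ (mul_mem_prods v u (by omega)))

lemma opUp_pow_mem_prods (hv : IsLW L γ a c h₁ v) (hu : IsLW L γ (c + 1) b h₂ u) {N : ℕ}
    {w : Fock} (hw : w ∈ prods v u N) (t : ℕ) : (opUp L γ a b ^ t) w ∈ prods v u (N + t) := by
  induction t with
  | zero => simpa using hw
  | succ t ih =>
    rw [pow_succ', Module.End.mul_apply, ← add_assoc]; exact opUp_mem_prods hv hu ih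

lemma prods_le_level (hv : IsLW L γ a c h₁ v) (hu : IsLW L γ (c + 1) b h₂ u) (N : ℕ) :
    prods v u N ≤ level a b (h₁ + h₂ + N) := by
  have h1 := hv.le
  have h2 := hu.le
  refine Submodule.span_le.2 ?_
  rintro _ ⟨p, r, rfl, rfl⟩
  have := mul_mem_level (by omega) (by omega) (hv.mem p) (hu.mem r)
  rwa [show h₁ + p + (h₂ + r) = h₁ + h₂ + (p + r) by ring] at this

lemma coupled_mem_prods (v u : ℕ → Fock) (s : ℕ) (ε : ℕ → ℂ) : coupled v u s ε ∈ prods v u s :=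
  sum_mem fun p hp => Submodule.smul_mem _ _ (mul_mem_prods v u (by
    rw [Finset.mem_range] at hp; omega))

lemma opDown_coupled (hv : IsLW L γ a c h₁ v) (hu : IsLW L γ (c + 1) b h₂ u) {s : ℕ} {ε : ℕ → ℂ}
    (hε : IsCoupling L γ a c b h₁ h₂ s ε) : opDown L γ a b (coupled v u s ε) = 0 := by
  simp only [coupled, map_sum, map_smul, opDown_mul_lw hv hu, smul_add, Finset.sum_add_distrib,
    smul_smul]
  rw [Finset.sum_range_succ', Finset.sum_range_succ _ s]
  have e1 : coefLeft L γ a c b h₁ h₂ 0 (s - 0) = 0 := by rw [coefLeft, sigma_zero, mul_zero]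
  have e2 : coefRight L γ a c b h₁ h₂ s (s - s) = 0 := by
    rw [coefRight, Nat.sub_self, sigma_zero, mul_zero]
  rw [e1, e2, mul_zero, mul_zero, zero_smul, zero_smul, add_zero, add_zero,
    ← Finset.sum_add_distrib]
  refine Finset.sum_eq_zero fun p hp => ?_
  rw [Nat.add_sub_cancel, Nat.sub_sub, ← add_smul, hε.2 p (Finset.mem_range.1 hp), zero_smul]

/-- Coupling two lowest weight modules gives a lowest weight module. -/
lemma isLW_coupled (hv : IsLW L γ a c h₁ v) (hu : IsLW L γ (c + 1) b h₂ u) {s : ℕ} {ε : ℕ → ℂ}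
    (hε : IsCoupling L γ a c b h₁ h₂ s ε) :
    IsLW L γ a b (h₁ + h₂ + s) (fun t => (opUp L γ a b ^ t) (coupled v u s ε)) where
  le := by have := hv.le; have := hu.le; omega
  mem t := by
    have := prods_le_level hv hu _ (opUp_pow_mem_prods hv hu (coupled_mem_prods v u s ε) t)
    rwa [← add_assoc] at this
  up t := by rw [pow_succ', Module.End.mul_apply]
  down_zero := by rw [pow_zero, Module.End.one_apply, opDown_coupled hv hu hε]

lemma form_prod (hv : IsLW L γ a c h₁ v) (hu : IsLW L γ (c + 1) b h₂ u) (p r p' r' : ℕ) :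
    form (v p * u r) (v p' * u r') = form (v p) (v p') * form (u r) (u r') :=
  form_mul (hv.mem p) (hv.mem p') (hu.mem r) (hu.mem r')

lemma form_coupled_left (hv : IsLW L γ a c h₁ v) (hu : IsLW L γ (c + 1) b h₂ u) (s : ℕ)
    (ε : ℕ → ℂ) : form (v 0 * u s) (coupled v u s ε)
      = ε 0 * (form (v 0) (v 0) * form (u s) (u s)) := by
  rw [coupled, map_sum, Finset.sum_eq_single 0]
  · rw [map_smul, smul_eq_mul, form_prod hv hu, Nat.sub_zero]
  · intro p _ hp
    rw [map_smul, form_prod hv hu, form_level_ne (by omega) (hv.mem 0) (hv.mem p), zero_mul,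
      smul_zero]
  · simp

lemma gsum_split (γ : ℕ → ℝ) {a b c : ℕ} (h1 : a ≤ c + 1) (h2 : c ≤ b) :
    gsum γ a b = gsum γ a c + gsum γ (c + 1) b := by
  rw [gsum, Icc_split h1 h2, Finset.sum_union (Icc_disj _ _ _), gsum, gsum]

/-- The coupled lowest weight vectors are not isotropic: together with their descendants they are
eigenvectors of the Casimir element for distinct eigenvalues, as many as there are products
`v p * u (s - p)`. -/
lemma form_coupled_ne_zero (hL : ‖qq L‖ ≠ 1) (hv : IsLW L γ (a + 1) c h₁ v)
    (hu : IsLW L γ (c + 1) b h₂ u)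
    (hg₁ : 1 / 2 < gsum γ (a + 1) c) (hg₂ : 1 / 2 < gsum γ (c + 1) b)
    (hv0 : form (v 0) (v 0) ≠ 0) (hu0 : form (u 0) (u 0) ≠ 0) {s : ℕ} {ε : ℕ → ℂ}
    (hε : IsCoupling L γ (a + 1) c b h₁ h₂ s ε) :
    form (coupled v u s ε) (coupled v u s ε) ≠ 0 := by
  have hle1 := hv.le
  have hle2 := hu.le
  have hsum := gsum_split γ (a := a + 1) (c := c) (b := b) (by omega) (by omega)
  have hg₁' : (1 : ℝ) / 2 < h₁ + gsum γ (a + 1) c := by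
    have : (0 : ℝ) ≤ h₁ := Nat.cast_nonneg _
    linarith
  choose ε' hε' using fun s => exists_isCoupling (L := L) (γ := γ) (a := a + 1) (c := c) (b := b)
    (h₁ := h₁) (h₂ := h₂) hL hg₁' s
  let δ : ℕ → ℕ → ℂ := Function.update ε' s ε
  have hδ : ∀ t, IsCoupling L γ (a + 1) c b h₁ h₂ t (δ t) := fun t => by
    by_cases h : t = s
    · subst h; simpa [δ] using hε
    · simpa [δ, h] using hε' t
  have hlw := fun t => isLW_coupled hv hu (hδ t)
  have hcne : ∀ t, coupled v u t (δ t) ≠ 0 := fun t h0 => by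
    have h1 := form_coupled_left hv hu t (δ t)
    rw [h0, map_zero] at h1
    refine mul_ne_zero (hδ t).1 (mul_ne_zero hv0 (hu.form_ne_zero hL ?_ hu0 t)) h1.symm
    have : (0 : ℝ) ≤ h₂ := Nat.cast_nonneg _
    linarith
  have key := form_self_ne_zero_of_eigenvectors (n := s + 1) (b := fun p => v p * u (s - p))
    (x := fun t => (opUp L γ (a + 1) b ^ (s - t)) (coupled v u t (δ t)))
    (θ := fun t => (-1) ^ (h₁ + h₂ + (t : ℕ))
      * qnum L (((h₁ + h₂ + (t : ℕ) : ℕ) : ℂ) + gsum γ (a + 1) b - 1 / 2))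
    (isTranspose_opGamma L γ (a := a + 1) (b := b) (by omega)) ?_
    (fun t => (hlw t).gamma (s - t)) ?_ ?_ ?_ ?_ (Fin.last s)
  · simpa [δ] using key
  · intro t t' h
    have : h₁ + h₂ + (t : ℕ) = h₁ + h₂ + t' :=
      casimir_eigenvalue_injective hL (z := gsum γ (a + 1) b - 1 / 2) (by linarith) (by
        push_cast at h ⊢
        simpa only [add_sub_assoc] using h)
    exact Fin.ext (by omega)
  · intro t
    refine (hlw t).ne_zero hL ?_ (by simpa using hcne t) (s - t)
    have : (0 : ℝ) ≤ (h₁ + h₂ + (t : ℕ) : ℕ) := Nat.cast_nonneg _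
    linarith
  · intro t
    have h1 := opUp_pow_mem_prods hv hu (coupled_mem_prods v u t (δ t)) (s - t)
    refine Submodule.span_mono ?_ h1
    have := t.2
    rintro _ ⟨p, r, h, rfl⟩
    exact ⟨⟨p, by omega⟩, by simp only []; congr 2; omega⟩
  · intro p r h
    rw [form_prod hv hu, form_level_ne (fun e => h (Fin.ext (by omega))) (hv.mem p) (hv.mem r),
      zero_mul]
  · intro p
    rw [form_prod hv hu]
    refine mul_ne_zero (hv.form_ne_zero hL hg₁' hv0 _) (hu.form_ne_zero hL ?_ hu0 _)
    have : (0 : ℝ) ≤ h₂ := Nat.cast_nonneg _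
    linarith

end Coupling

/-! ### Two operators with a common split basis -/

lemma sum_range_tridiag {c : ℕ → ℂ} {N x : ℕ} (hx : x ≤ N)
    (hc : ∀ y ≤ N, y + 1 < x ∨ x + 1 < y → c y = 0) :
    ∑ y ∈ Finset.range (N + 1), c y
      = (if x = 0 then 0 else c (x - 1)) + c x + (if x = N then 0 else c (x + 1)) := by
  have h1 : ∑ y ∈ Finset.range x, c y = if x = 0 then 0 else c (x - 1) := by
    rcases Nat.eq_zero_or_pos x with rfl | h
    · simp
    · obtain ⟨x, rfl⟩ : ∃ x', x = x' + 1 := ⟨x - 1, by omega⟩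
      rw [Finset.sum_range_succ, Finset.sum_eq_zero]
      · simp
      · intro y hy
        rw [Finset.mem_range] at hy
        exact hc y (by omega) (by omega)
  have h2 : ∑ y ∈ Finset.Ico (x + 1) (N + 1), c y = if x = N then 0 else c (x + 1) := by
    split_ifs with h
    · simp [h]
    · rw [Finset.sum_eq_single (x + 1)]
      · intro y hy hne
        rw [Finset.mem_Ico] at hy
        exact hc y (by omega) (by omega)
      · intro h'
        exact absurd (Finset.mem_Ico.2 ⟨le_rfl, by omega⟩) h'
  rw [← h1, ← h2, ← Finset.sum_range_succ]
  simp only [Finset.range_eq_Ico]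
  rw [Finset.sum_Ico_consecutive _ (by omega) (by omega)]

/-- Two operators `S`, `T` on a space `M` with a symmetric bilinear form `B`, both bidiagonal in
the coordinates `ζ 0, …, ζ N`: `S` mixes the coordinate `x` with `x - 1`, and `T` mixes it with
`x + 1`. The family `w` consists of orthonormal eigenvectors of `S` with distinct eigenvalues. The
coordinates determine a vector of `M` up to the radical of the form on `M`. -/
structure SplitPair {V : Type*} [AddCommGroup V] [Module ℂ V] (B : V →ₗ[ℂ] V →ₗ[ℂ] ℂ)
    (M : Submodule ℂ V) (S T : Module.End ℂ V) (N : ℕ) (ζ : ℕ → V →ₗ[ℂ] ℂ) (w : ℕ → V)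
    (θ r θs l : ℕ → ℂ) : Prop where
  symm : ∀ x y, B x y = B y x
  symmT : ∀ x y, B (T x) y = B x (T y)
  mem : ∀ x ≤ N, w x ∈ M
  memT : ∀ z ∈ M, T z ∈ M
  radical : ∀ z ∈ M, (∀ x ≤ N, ζ x z = 0) → ∀ z' ∈ M, B z' z = 0
  orth : ∀ x ≤ N, ∀ y ≤ N, B (w x) (w y) = if x = y then 1 else 0
  eigen : ∀ x ≤ N, S (w x) = θ x • w x
  inj : ∀ x ≤ N, ∀ y ≤ N, θ x = θ y → x = y
  zetaS : ∀ z ∈ M, ∀ x ≤ N, ζ x (S z) = θ x * ζ x z + r x * ζ (x - 1) z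
  zetaT : ∀ z ∈ M, ∀ x ≤ N, ζ x (T z) = θs x * ζ x z + l x * ζ (x + 1) z
  r_zero : r 0 = 0
  l_last : l N = 0

namespace SplitPair

variable {V : Type*} [AddCommGroup V] [Module ℂ V] {B : V →ₗ[ℂ] V →ₗ[ℂ] ℂ}
  {M : Submodule ℂ V} {S T : Module.End ℂ V} {N : ℕ} {ζ : ℕ → V →ₗ[ℂ] ℂ} {w : ℕ → V}
  {θ r θs l : ℕ → ℂ}

lemma zeta_rec (h : SplitPair B M S T N ζ w θ r θs l) {x a : ℕ} (hx : x ≤ N) (ha : a ≤ N) :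
    (θ x - θ a) * ζ a (w x) = r a * ζ (a - 1) (w x) := by
  have h1 := h.zetaS (w x) (h.mem x hx) a ha
  rw [h.eigen x hx, map_smul, smul_eq_mul] at h1
  linear_combination h1

lemma sub_ne_zero (h : SplitPair B M S T N ζ w θ r θs l) {x a : ℕ} (hx : x ≤ N) (ha : a ≤ N)
    (hxa : x ≠ a) : θ x - θ a ≠ 0 :=
  _root_.sub_ne_zero.2 fun e => hxa (h.inj x hx a ha e)

lemma zeta_of_lt (h : SplitPair B M S T N ζ w θ r θs l) {x : ℕ} (hx : x ≤ N) (a : ℕ)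
    (ha : a < x) : ζ a (w x) = 0 := by
  induction a with
  | zero =>
    have h1 := h.zeta_rec hx (Nat.zero_le N)
    rw [h.r_zero, zero_mul] at h1
    exact (mul_eq_zero.1 h1).resolve_left (h.sub_ne_zero hx (Nat.zero_le N) (by omega))
  | succ a ih =>
    have h1 := h.zeta_rec hx (a := a + 1) (by omega)
    rw [Nat.add_sub_cancel, ih (by omega), mul_zero] at h1
    exact (mul_eq_zero.1 h1).resolve_left (h.sub_ne_zero hx (by omega) (by omega))

lemma zeta_self_ne_zero (h : SplitPair B M S T N ζ w θ r θs l) {x : ℕ} (hx : x ≤ N) :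
    ζ x (w x) ≠ 0 := by
  intro h0
  have h1 : ∀ a ≤ N, ζ a (w x) = 0 := by
    intro a
    induction a with
    | zero =>
      intro _
      rcases Nat.eq_zero_or_pos x with rfl | hp
      · exact h0
      · exact h.zeta_of_lt hx 0 hp
    | succ a ih =>
      intro ha
      by_cases e : x = a + 1
      · rw [← e, h0]
      · have h1 := h.zeta_rec hx ha
        rw [Nat.add_sub_cancel, ih (by omega), mul_zero] at h1
        exact (mul_eq_zero.1 h1).resolve_left (h.sub_ne_zero hx ha e)
  have h2 := h.radical (w x) (h.mem x hx) h1 (w x) (h.mem x hx)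
  rw [h.orth x hx x hx, if_pos rfl] at h2
  exact one_ne_zero h2

lemma zeta_succ (h : SplitPair B M S T N ζ w θ r θs l) {x a : ℕ} (hxa : x ≤ a) (ha : a + 1 ≤ N) :
    ζ (a + 1) (w x) = r (a + 1) / (θ x - θ (a + 1)) * ζ a (w x) := by
  have h1 := h.zeta_rec (x := x) (a := a + 1) (by omega) ha
  have h2 := h.sub_ne_zero (x := x) (a := a + 1) (by omega) ha (by omega)
  rw [Nat.add_sub_cancel] at h1
  field_simp
  linear_combination h1

/-- The eigenvectors `w` are complete up to the radical of the form. -/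
lemma exists_expansion (h : SplitPair B M S T N ζ w θ r θs l) {z : V} (n : ℕ) (hn : n ≤ N + 1) :
    ∃ κ : ℕ → ℂ, ∀ a < n, ζ a (z - ∑ x ∈ Finset.range n, κ x • w x) = 0 := by
  induction n with
  | zero => exact ⟨0, by simp⟩
  | succ n ih =>
    obtain ⟨κ, hκ⟩ := ih (by omega)
    let t := ζ n (z - ∑ x ∈ Finset.range n, κ x • w x) / ζ n (w n)
    have e : z - ∑ x ∈ Finset.range (n + 1), Function.update κ n t x • w x
        = (z - ∑ x ∈ Finset.range n, κ x • w x) - t • w n := by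
      rw [Finset.sum_range_succ, Function.update_self, sub_sub,
        Finset.sum_congr rfl fun x hx => by
          rw [Function.update_of_ne (Finset.mem_range.1 hx).ne]]
    refine ⟨Function.update κ n t, fun a ha => ?_⟩
    rw [e, map_sub (ζ a), map_smul, smul_eq_mul]
    rcases Nat.lt_succ_iff_lt_or_eq.1 ha with ha | rfl
    · rw [hκ a ha, h.zeta_of_lt (by omega) a ha, mul_zero, sub_zero]
    · rw [div_mul_cancel₀ _ (h.zeta_self_ne_zero (by omega)), sub_self]

lemma expansion (h : SplitPair B M S T N ζ w θ r θs l) {z : V} (hz : z ∈ M) :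
    (∀ a ≤ N, ζ a z = ∑ x ∈ Finset.range (N + 1), B (w x) z * ζ a (w x)) ∧
    ∀ y ∈ M, B y z = ∑ x ∈ Finset.range (N + 1), B (w x) z * B y (w x) := by
  obtain ⟨κ, hκ⟩ := h.exists_expansion (z := z) (N + 1) le_rfl
  have hmem : z - ∑ x ∈ Finset.range (N + 1), κ x • w x ∈ M :=
    sub_mem hz (sum_mem fun x hx => M.smul_mem _ (h.mem x (by
      rw [Finset.mem_range] at hx; omega)))
  have h1 : ∀ y ∈ M, B y z = ∑ x ∈ Finset.range (N + 1), κ x * B y (w x) := fun y hy => by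
    have h2 := h.radical _ hmem (fun a ha => hκ a (by omega)) y hy
    rw [map_sub, sub_eq_zero, map_sum] at h2
    simpa only [map_smul, smul_eq_mul] using h2
  have h2 : ∀ x ∈ Finset.range (N + 1), κ x = B (w x) z := fun x hx => by
    have hx' : x ≤ N := by rw [Finset.mem_range] at hx; omega
    rw [h1 _ (h.mem x hx'), Finset.sum_eq_single x]
    · rw [h.orth x hx' x hx', if_pos rfl, mul_one]
    · intro y hy hne
      rw [h.orth x hx' y (by rw [Finset.mem_range] at hy; omega), if_neg hne.symm, mul_zero]
    · exact fun hn => absurd hx hn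
  constructor
  · intro a ha
    have h3 := hκ a (by omega)
    rw [map_sub, sub_eq_zero, map_sum] at h3
    rw [h3]
    exact Finset.sum_congr rfl fun x hx => by rw [map_smul, smul_eq_mul, h2 x hx]
  · intro y hy
    rw [h1 y hy]
    exact Finset.sum_congr rfl fun x hx => by rw [h2 x hx]

lemma matrix_symm (h : SplitPair B M S T N ζ w θ r θs l) (x y : ℕ) :
    B (w x) (T (w y)) = B (w y) (T (w x)) := by
  rw [← h.symmT, h.symm]

lemma matrix_eq_zero_of_lt (h : SplitPair B M S T N ζ w θ r θs l) {x : ℕ} (hx : x ≤ N) (a : ℕ)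
    (ha : a + 1 < x) : B (w a) (T (w x)) = 0 := by
  induction a using Nat.strong_induction_on with
  | _ a ih =>
    have h1 := (h.expansion (h.memT _ (h.mem x hx))).1 a (by omega)
    rw [h.zetaT _ (h.mem x hx) a (by omega), h.zeta_of_lt hx a (by omega),
      h.zeta_of_lt hx (a + 1) ha, mul_zero, mul_zero, add_zero, Finset.sum_eq_single a] at h1
    · exact (mul_eq_zero.1 h1.symm).resolve_right (h.zeta_self_ne_zero (by omega))
    · intro y hy hne
      rw [Finset.mem_range] at hy
      rcases Nat.lt_or_ge y a with hya | hya
      · rw [ih y hya (by omega), zero_mul]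
      · rw [h.zeta_of_lt (by omega) a (by omega), mul_zero]
    · intro hn
      exact absurd (Finset.mem_range.2 (by omega)) hn

/-- `T` is tridiagonal in the eigenbasis of `S`. -/
lemma matrix_eq_zero (h : SplitPair B M S T N ζ w θ r θs l) {x y : ℕ} (hx : x ≤ N) (hy : y ≤ N)
    (hxy : y + 1 < x ∨ x + 1 < y) : B (w y) (T (w x)) = 0 := by
  rcases hxy with hxy | hxy
  · exact h.matrix_eq_zero_of_lt hx y hxy
  · rw [h.matrix_symm, h.matrix_eq_zero_of_lt hy x hxy]

/-- The coordinates of `T (w x)` with respect to the eigenbasis, paired with a vector of `M`. -/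
lemma tridiag (h : SplitPair B M S T N ζ w θ r θs l) {x : ℕ} (hx : x ≤ N) {y : V} (hy : y ∈ M) :
    B y (T (w x)) = (if x = 0 then 0 else B (w (x - 1)) (T (w x)) * B y (w (x - 1)))
      + B (w x) (T (w x)) * B y (w x)
      + (if x = N then 0 else B (w (x + 1)) (T (w x)) * B y (w (x + 1))) := by
  rw [(h.expansion (h.memT _ (h.mem x hx))).2 y hy, sum_range_tridiag hx]
  intro z hz hzx
  rw [h.matrix_eq_zero hx hz hzx, zero_mul]

lemma zeta_tridiag (h : SplitPair B M S T N ζ w θ r θs l) {x : ℕ} (hx : x ≤ N) {a : ℕ}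
    (ha : a ≤ N) :
    θs a * ζ a (w x) + l a * ζ (a + 1) (w x)
      = (if x = 0 then 0 else B (w (x - 1)) (T (w x)) * ζ a (w (x - 1)))
      + B (w x) (T (w x)) * ζ a (w x)
      + (if x = N then 0 else B (w (x + 1)) (T (w x)) * ζ a (w (x + 1))) := by
  rw [← h.zetaT _ (h.mem x hx) a ha, (h.expansion (h.memT _ (h.mem x hx))).1 a ha,
    sum_range_tridiag hx]
  intro z hz hzx
  rw [h.matrix_eq_zero hx hz hzx, zero_mul]

lemma matrix_succ (h : SplitPair B M S T N ζ w θ r θs l) {x : ℕ} (hx : x + 1 ≤ N) :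
    B (w x) (T (w (x + 1))) * ζ x (w x) = l x * ζ (x + 1) (w (x + 1)) := by
  have h1 := h.zeta_tridiag hx (a := x) (by omega)
  rw [h.zeta_of_lt hx x (by omega), if_neg (Nat.succ_ne_zero x), Nat.add_sub_cancel] at h1
  split_ifs at h1 with e
  · linear_combination -h1
  · rw [h.zeta_of_lt (x := x + 1 + 1) (by omega) x (by omega)] at h1
    linear_combination -h1

/-- The diagonal entries of `T` in the eigenbasis of `S`. -/
lemma matrix_self (h : SplitPair B M S T N ζ w θ r θs l) {x : ℕ} (hx : x ≤ N) :
    B (w x) (T (w x)) = θs x + l x * r (x + 1) / (θ x - θ (x + 1))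
      - l (x - 1) * r x / (θ (x - 1) - θ x) := by
  have h0 := h.zeta_self_ne_zero hx
  have h1 := h.zeta_tridiag hx hx
  have h2 : (if x = N then 0 else B (w (x + 1)) (T (w x)) * ζ x (w (x + 1))) = 0 := by
    split_ifs with e
    · rfl
    · rw [h.zeta_of_lt (x := x + 1) (by omega) x (by omega), mul_zero]
  have h3 : l x * ζ (x + 1) (w x) = l x * r (x + 1) / (θ x - θ (x + 1)) * ζ x (w x) := by
    rcases Nat.lt_or_ge x N with hN | hN
    · rw [h.zeta_succ le_rfl hN]; ring
    · rw [le_antisymm hx hN, h.l_last]; ring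
  have h4 : (if x = 0 then 0 else B (w (x - 1)) (T (w x)) * ζ x (w (x - 1)))
      = l (x - 1) * r x / (θ (x - 1) - θ x) * ζ x (w x) := by
    cases x with
    | zero => simp [h.r_zero]
    | succ x =>
      rw [if_neg (by omega), Nat.add_sub_cancel, h.zeta_succ le_rfl hx]
      linear_combination (r (x + 1) / (θ x - θ (x + 1))) * h.matrix_succ hx
  rw [h2, h3, h4] at h1
  apply mul_right_cancel₀ h0
  linear_combination -h1

/-- The squares of the off-diagonal entries of `T` in the eigenbasis of `S`. -/
lemma matrix_succ_sq (h : SplitPair B M S T N ζ w θ r θs l) {x : ℕ} (hx : x + 1 ≤ N) :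
    B (w x) (T (w (x + 1))) ^ 2 = l x * r (x + 1) / (θ x - θ (x + 1))
      * (θs (x + 1) - θs x - l x * r (x + 1) / (θ x - θ (x + 1))
        + l (x - 1) * r x / (θ (x - 1) - θ (x + 1))
        + l (x + 1) * r (x + 2) / (θ x - θ (x + 2))) := by
  have hxN : x ≤ N := by omega
  have h0 := h.zeta_self_ne_zero hxN
  have h1 := h.zeta_tridiag hxN hx
  have h5 := h.matrix_succ hx
  have h6 := h.zeta_succ (x := x) le_rfl hx
  have h3 : l (x + 1) * ζ (x + 1 + 1) (w x)
      = l (x + 1) * r (x + 2) / (θ x - θ (x + 2)) * ζ (x + 1) (w x) := by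
    rcases Nat.lt_or_ge (x + 1) N with hN | hN
    · rw [h.zeta_succ (a := x + 1) (by omega) hN]; ring
    · rw [le_antisymm hx hN, h.l_last]; ring
  have h4 : (if x = 0 then 0 else B (w (x - 1)) (T (w x)) * ζ (x + 1) (w (x - 1)))
      = l (x - 1) * r x / (θ (x - 1) - θ x) * (θ x - θ (x + 1)) / (θ (x - 1) - θ (x + 1))
        * ζ (x + 1) (w x) := by
    cases x with
    | zero => simp [h.r_zero]
    | succ x =>
      rw [if_neg (by omega), Nat.add_sub_cancel, h.zeta_succ (a := x + 1) (by omega) hx,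
        h.zeta_succ (a := x) le_rfl hxN, h6]
      have n1 := h.sub_ne_zero (x := x + 1) (a := x + 1 + 1) (by omega) hx (by omega)
      have n2 := h.sub_ne_zero (x := x) (a := x + 1 + 1) (by omega) hx (by omega)
      have n3 := h.sub_ne_zero (x := x) (a := x + 1) (by omega) hxN (by omega)
      field_simp
      linear_combination r (x + 1) * r (x + 1 + 1) * h.matrix_succ hxN
  rw [if_neg (show ¬ x = N by omega), h3, h4, h.matrix_self hxN, h.matrix_symm (x + 1) x, h6] at h1
  have n1 := h.sub_ne_zero (x := x) (a := x + 1) (by omega) hx (by omega)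
  apply mul_right_cancel₀ h0
  have key : l (x - 1) * r x / (θ (x - 1) - θ x)
      - l (x - 1) * r x / (θ (x - 1) - θ x) * (θ x - θ (x + 1)) / (θ (x - 1) - θ (x + 1))
      = l (x - 1) * r x / (θ (x - 1) - θ (x + 1)) := by
    cases x with
    | zero => simp [h.r_zero]
    | succ x =>
      rw [Nat.add_sub_cancel]
      have n2 := h.sub_ne_zero (x := x) (a := x + 1 + 1) (by omega) hx (by omega)
      have n3 := h.sub_ne_zero (x := x) (a := x + 1) (by omega) hxN (by omega)
      field_simp
      ring
  rw [← key]
  linear_combination B (w x) (T (w (x + 1))) * h5 - l x * h1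

/-- An eigenvector of `T` that is orthogonal to `w 0` is orthogonal to all of `M`. -/
lemma eq_zero_of_orthogonal (h : SplitPair B M S T N ζ w θ r θs l)
    (hoff : ∀ x, x + 1 ≤ N → B (w x) (T (w (x + 1))) ≠ 0) {y : V} (hy : y ∈ M) {μ : ℂ}
    (hμ : T y = μ • y) (h0 : B y (w 0) = 0) : ∀ z ∈ M, B y z = 0 := by
  have h1 : ∀ x ≤ N, B y (w x) = 0 := by
    intro x
    induction x using Nat.strong_induction_on with
    | _ x ih =>
      intro hx
      rcases Nat.eq_zero_or_pos x with rfl | hp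
      · exact h0
      obtain ⟨x, rfl⟩ : ∃ x', x = x' + 1 := ⟨x - 1, by omega⟩
      have h2 := h.tridiag (x := x) (by omega) hy
      rw [← h.symmT, hμ, map_smul, LinearMap.smul_apply, ih x (by omega) (by omega), smul_zero,
        mul_zero, add_zero, if_neg (show ¬ x = N by omega)] at h2
      have h3 : (if x = 0 then 0 else B (w (x - 1)) (T (w x)) * B y (w (x - 1))) = 0 := by
        split_ifs with e
        · rfl
        · rw [ih (x - 1) (by omega) (by omega), mul_zero]
      rw [h3, zero_add, h.matrix_symm] at h2
      exact (mul_eq_zero.1 h2.symm).resolve_left (hoff x hx)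
  intro z hz
  rw [(h.expansion hz).2 y hy]
  refine Finset.sum_eq_zero fun x hx => ?_
  rw [h1 x (by rw [Finset.mem_range] at hx; omega), mul_zero]

end SplitPair

/-! ### Three coupled lowest weight modules -/

/-- The span of the products `v x * u y * t z` with `x + y + z = N`. -/
def trip (v u t : ℕ → Fock) (N : ℕ) : Submodule ℂ Fock :=
  Submodule.span ℂ {f | ∃ x y z, x + y + z = N ∧ f = v x * u y * t z}

lemma mul_mem_trip_left (v u t : ℕ → Fock) {M z N : ℕ} (h : M + z = N) {f : Fock}
    (hf : f ∈ prods v u M) : f * t z ∈ trip v u t N := by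
  refine (Submodule.span_le.2 ?_ : prods v u M ≤ (trip v u t N).comap
    (LinearMap.mulRight ℂ (t z))) hf
  rintro _ ⟨x, y, hxy, rfl⟩
  exact Submodule.subset_span ⟨x, y, z, by omega, rfl⟩

lemma mul_mem_trip_right (v u t : ℕ → Fock) {x M N : ℕ} (h : x + M = N) {f : Fock}
    (hf : f ∈ prods u t M) : v x * f ∈ trip v u t N := by
  refine (Submodule.span_le.2 ?_ : prods u t M ≤ (trip v u t N).comap
    (LinearMap.mulLeft ℂ (v x))) hf
  rintro _ ⟨y, z, hyz, rfl⟩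
  exact Submodule.subset_span ⟨x, y, z, by omega, by simp [mul_assoc]⟩

/-- The lowest weight vectors of degree `N` in the product of three lowest weight modules. -/
def lowestTrip (L : ℂ) (γ : ℕ → ℝ) (a b : ℕ) (v u t : ℕ → Fock) (N : ℕ) : Submodule ℂ Fock :=
  trip v u t N ⊓ LinearMap.ker (opDown L γ a b)

section Triple

variable {L : ℂ} {γ : ℕ → ℝ} {a c e b h₁ h₂ : ℕ} {v u t : ℕ → Fock}

lemma opGamma_mem_prods {v u : ℕ → Fock} (hv : IsLW L γ a c h₁ v) (hu : IsLW L γ (c + 1) b h₂ u)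
    {N : ℕ} {w : Fock} (hw : w ∈ prods v u N) : opGamma L γ a b w ∈ prods v u N := by
  refine (Submodule.span_le.2 ?_ : prods v u N ≤ (prods v u N).comap (opGamma L γ a b)) hw
  rintro _ ⟨p, r, h, rfl⟩
  have hw := mul_mem_prods v u h
  rw [SetLike.mem_coe, Submodule.mem_comap, opGamma_of_mem_level L γ (prods_le_level hv hu N hw),
    opDown_mul_lw hv hu]
  refine Submodule.smul_mem _ _ (sub_mem (Submodule.smul_mem _ _ hw) ?_)
  rw [map_add, map_smul, map_smul]
  refine add_mem ?_ ?_
  · rcases Nat.eq_zero_or_pos p with rfl | hp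
    · rw [coefLeft, sigma_zero, mul_zero, zero_smul]; exact zero_mem _
    · have := opUp_mem_prods hv hu (mul_mem_prods v u (p := p - 1) (r := r) rfl)
      rw [show p - 1 + r + 1 = N by omega] at this
      exact Submodule.smul_mem _ _ this
  · rcases Nat.eq_zero_or_pos r with rfl | hr
    · rw [coefRight, sigma_zero, mul_zero, zero_smul]; exact zero_mem _
    · have := opUp_mem_prods hv hu (mul_mem_prods v u (p := p) (r := r - 1) rfl)
      rw [show p + (r - 1) + 1 = N by omega] at this
      exact Submodule.smul_mem _ _ this

/-- `A₊` on the first two factors, paired with a lowest weight vector. -/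
lemma form_opUp_left (ht : IsLW L γ (e + 1) b 0 t) (hae : a ≤ e) {z : Fock}
    (hz : opDown L γ a b z = 0) {d : ℕ} {f : Fock} (hf : f ∈ level a e d) (w : ℕ) :
    form (opUp L γ a e f * t w) z
      = -((-1) ^ w * qpow L (-((1 / 2) * ((w : ℂ) + (gsum γ (e + 1) b : ℂ))))
          * qpow L (-((1 / 2) * ((d : ℂ) + (gsum γ a e : ℂ))))) * form (f * t (w + 1)) z := by
  have hb := ht.le
  have h1 := isTranspose_opUp L γ a b (f * t w) z
  rw [hz, map_zero, opUp_mul L γ (by omega) (by omega) hf (ht.mem w), ht.up, zero_add] at h1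
  simp only [map_add, map_smul, LinearMap.add_apply, LinearMap.smul_apply, smul_eq_mul] at h1
  rw [qpow_neg L ((1 / 2) * ((w : ℂ) + (gsum γ (e + 1) b : ℂ)))]
  have h2 := inv_mul_cancel₀ (qpow_ne_zero L ((1 / 2) * ((w : ℂ) + (gsum γ (e + 1) b : ℂ))))
  have h3 : ((-1 : ℂ) ^ w) * (-1) ^ w = 1 := by rw [← mul_pow]; norm_num
  generalize qpow L ((1 / 2) * ((w : ℂ) + (gsum γ (e + 1) b : ℂ))) = A at *
  linear_combination ((-1) ^ w * A⁻¹) * h1 - A⁻¹ * A * form (opUp L γ a e f * t w) z * h3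
    - form (opUp L γ a e f * t w) z * h2

/-- `A₊` on the last two factors, paired with a lowest weight vector. -/
lemma form_opUp_right (hv : IsLW L γ a c h₁ v) (hcb : c + 1 ≤ b) {z : Fock}
    (hz : opDown L γ a b z = 0) {d : ℕ} {g : Fock} (hg : g ∈ level (c + 1) b d) (x : ℕ) :
    form (v x * opUp L γ (c + 1) b g) z
      = -((-1) ^ d * qpow L ((1 / 2) * ((d : ℂ) + (gsum γ (c + 1) b : ℂ)))
          * qpow L ((1 / 2) * (((h₁ + x : ℕ) : ℂ) + (gsum γ a c : ℂ))))
        * form (v (x + 1) * g) z := by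
  have hb := hv.le
  have h1 := isTranspose_opUp L γ a b (v x * g) z
  rw [hz, map_zero, opUp_mul L γ (by omega) (by omega) (hv.mem x) hg, hv.up] at h1
  simp only [map_add, map_smul, LinearMap.add_apply, LinearMap.smul_apply, smul_eq_mul] at h1
  rw [qpow_neg] at h1
  have h2 := mul_inv_cancel₀ (qpow_ne_zero L ((1 / 2) * (((h₁ + x : ℕ) : ℂ) + (gsum γ a c : ℂ))))
  generalize qpow L ((1 / 2) * (((h₁ + x : ℕ) : ℂ) + (gsum γ a c : ℂ))) = A at *
  linear_combination A * h1 - form (v x * opUp L γ (c + 1) b g) z * h2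

/-- The coordinates of a lowest weight vector: its pairings with the products in which the middle
factor is a lowest weight vector. -/
def zeta (v u t : ℕ → Fock) (N x : ℕ) : Fock →ₗ[ℂ] ℂ := form (v x * u 0 * t (N - x))

/-- The off-diagonal coefficient of `Γ` on the first two factors in the coordinates `zeta`. -/
def splitR (L : ℂ) (γ : ℕ → ℝ) (a c e b h₁ N x : ℕ) : ℂ :=
  (-1) ^ (h₁ + N) * sigma L x (h₁ + gsum γ a c)
    * qpow L (-((1 / 2) * ((h₁ : ℂ) + gsum γ a c + gsum γ (e + 1) b + N - 1)))

/-- The off-diagonal coefficient of `Γ` on the last two factors in the coordinates `zeta`. -/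
def splitL (L : ℂ) (γ : ℕ → ℝ) (a c e b h₁ N x : ℕ) : ℂ :=
  -(sigma L (N - x) (gsum γ (e + 1) b)
    * qpow L ((1 / 2) * ((h₁ : ℂ) + gsum γ a c + gsum γ (e + 1) b + N - 1)))

lemma zeta_opGamma_left (hv : IsLW L γ a c h₁ v) (hu : IsLW L γ (c + 1) e h₂ u)
    (ht : IsLW L γ (e + 1) b 0 t) {N : ℕ} {z : Fock} (hz : opDown L γ a b z = 0) {x : ℕ}
    (hx : x ≤ N) :
    zeta v u t N x (opGamma L γ a e z)
      = ((-1) ^ (h₁ + h₂ + x) * qnum L (((h₁ + h₂ + x : ℕ) : ℂ) + gsum γ a e - 1 / 2))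
          * zeta v u t N x z
        + splitR L γ a c e b h₁ N x * zeta v u t N (x - 1) z := by
  have h1 := hv.le
  have h2 := hu.le
  have hae : a ≤ e := by omega
  have hlev := prods_le_level hv hu x (mul_mem_prods v u (p := x) (r := 0) (by omega))
  rw [zeta, ← isTranspose_opGamma L γ hae,
    (ActsOn.opGamma a e).mul_right_of_mem_level (Icc_disj a b e) (ht.mem _),
    opGamma_of_mem_level L γ hlev, opDown_mul_lw hv hu]
  have e2 : coefRight L γ a c e h₁ h₂ x 0 = 0 := by rw [coefRight, sigma_zero, mul_zero]
  rw [e2, zero_smul, add_zero, map_smul]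
  simp only [smul_mul_assoc, sub_mul, map_smul, map_sub, LinearMap.smul_apply, LinearMap.sub_apply,
    smul_eq_mul]
  rcases Nat.eq_zero_or_pos x with rfl | hx0
  · rw [coefLeft, splitR, sigma_zero]; ring
  obtain ⟨x, rfl⟩ : ∃ x', x = x' + 1 := ⟨x - 1, by omega⟩
  obtain ⟨w, rfl⟩ : ∃ w, N = x + 1 + w := ⟨N - (x + 1), by omega⟩
  have hlev' := prods_le_level hv hu x (mul_mem_prods v u (p := x) (r := 0) (by omega))
  rw [Nat.add_sub_cancel, show x + 1 + w - (x + 1) = w by omega,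
    form_opUp_left ht hae hz hlev' w, zeta, show x + 1 + w - x = w + 1 by omega, coefLeft, splitR]
  have hq : qpow L ((1 / 2) * (((h₂ + 0 : ℕ) : ℂ) + (gsum γ (c + 1) e : ℂ)))
      * (qpow L (-((1 / 2) * ((w : ℂ) + (gsum γ (e + 1) b : ℂ))))
        * qpow L (-((1 / 2) * (((h₁ + h₂ + x : ℕ) : ℂ) + (gsum γ a e : ℂ)))))
      = qpow L (-((1 / 2) * ((h₁ : ℂ) + gsum γ a c + gsum γ (e + 1) b
        + (x + 1 + w : ℕ) - 1))) := by
    rw [← qpow_add, ← qpow_add, gsum_split γ (a := a) (b := e) (c := c) (by omega) (by omega)]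
    congr 1; push_cast; ring
  have hs : ((-1 : ℂ) ^ h₂) * (-1) ^ h₂ = 1 := by rw [← mul_pow]; norm_num
  rw [← hq]
  simp only [pow_add]
  linear_combination (-1) ^ h₁ * (-1) ^ x * (-1) ^ 1 * sigma L (x + 1) (h₁ + gsum γ a c)
    * qpow L ((1 / 2) * (((h₂ + 0 : ℕ) : ℂ) + (gsum γ (c + 1) e : ℂ)))
      * (qpow L (-((1 / 2) * ((w : ℂ) + (gsum γ (e + 1) b : ℂ))))
        * qpow L (-((1 / 2) * (((h₁ + h₂ + x : ℕ) : ℂ) + (gsum γ a e : ℂ)))))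
      * (-1) ^ w * form (v x * u 0 * t (w + 1)) z * hs

lemma zeta_opGamma_right (hv : IsLW L γ a c h₁ v) (hu : IsLW L γ (c + 1) e h₂ u)
    (ht : IsLW L γ (e + 1) b 0 t) {N : ℕ} {z : Fock} (hz : opDown L γ a b z = 0) {x : ℕ}
    (hx : x ≤ N) :
    zeta v u t N x (opGamma L γ (c + 1) b z)
      = ((-1) ^ (h₂ + (N - x)) * qnum L (((h₂ + (N - x) : ℕ) : ℂ) + gsum γ (c + 1) b - 1 / 2))
          * zeta v u t N x z
        + splitL L γ a c e b h₁ N x * zeta v u t N (x + 1) z := by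
  have h1 := hv.le
  have h2 := hu.le
  have h3 := ht.le
  have hcb : c + 1 ≤ b := by omega
  obtain ⟨w, rfl⟩ : ∃ w, N = x + w := ⟨N - x, by omega⟩
  have hlev := prods_le_level hu ht w (mul_mem_prods u t (p := 0) (r := w) (by omega))
  rw [zeta, show x + w - x = w by omega, mul_assoc, ← isTranspose_opGamma L γ hcb,
    (ActsOn.opGamma (c + 1) b).mul_left_of_mem_level (Icc_disj a b c).symm (hv.mem _),
    opGamma_of_mem_level L γ hlev, opDown_mul_lw hu ht]
  have e2 : coefLeft L γ (c + 1) e b h₂ 0 0 w = 0 := by rw [coefLeft, sigma_zero, mul_zero]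
  rw [e2, zero_smul, zero_add, map_smul]
  simp only [mul_smul_comm, mul_sub, map_smul, map_sub, LinearMap.smul_apply, LinearMap.sub_apply,
    smul_eq_mul, add_zero]
  rw [splitL, show x + w - x = w by omega]
  rcases Nat.eq_zero_or_pos w with rfl | hw0
  · rw [coefRight, sigma_zero, sigma_zero]; ring
  obtain ⟨w, rfl⟩ : ∃ w', w = w' + 1 := ⟨w - 1, by omega⟩
  have hlev' := prods_le_level hu ht w (mul_mem_prods u t (p := 0) (r := w) (by omega))
  rw [Nat.add_sub_cancel, form_opUp_right hv hcb hz hlev' x, zeta,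
    show x + (w + 1) - (x + 1) = w by omega, coefRight, mul_assoc (v (x + 1))]
  have hq : qpow L (-((1 / 2) * (((h₂ + 0 : ℕ) : ℂ) + (gsum γ (c + 1) e : ℂ))))
      * (qpow L ((1 / 2) * (((h₂ + 0 + w : ℕ) : ℂ) + (gsum γ (c + 1) b : ℂ)))
        * qpow L ((1 / 2) * (((h₁ + x : ℕ) : ℂ) + (gsum γ a c : ℂ))))
      = qpow L ((1 / 2) * ((h₁ : ℂ) + gsum γ a c + gsum γ (e + 1) b
        + (x + (w + 1) : ℕ) - 1)) := by
    rw [← qpow_add, ← qpow_add, gsum_split γ (a := c + 1) (b := b) (c := e) (by omega) (by omega)]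
    congr 1; push_cast; ring
  have hs2 : ((-1 : ℂ) ^ (h₂ + (w + 1))) * (-1) ^ (h₂ + w) = -1 := by
    rw [← pow_add, show h₂ + (w + 1) + (h₂ + w) = 2 * (h₂ + w) + 1 by ring, pow_succ, pow_mul]
    norm_num
  rw [← hq]
  simp only [add_zero, Nat.cast_zero, zero_add]
  linear_combination sigma L (w + 1) (gsum γ (e + 1) b)
    * (qpow L (-((1 / 2) * ((h₂ : ℂ) + (gsum γ (c + 1) e : ℂ))))
      * (qpow L ((1 / 2) * (((h₂ + w : ℕ) : ℂ) + (gsum γ (c + 1) b : ℂ)))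
        * qpow L ((1 / 2) * (((h₁ + x : ℕ) : ℂ) + (gsum γ a c : ℂ)))))
      * form (v (x + 1) * (u 0 * t w)) z * hs2

/-- A lowest weight vector whose coordinates vanish is orthogonal to all products. -/
lemma form_eq_zero_of_zeta (hv : IsLW L γ a c h₁ v) (hu : IsLW L γ (c + 1) e h₂ u)
    (ht : IsLW L γ (e + 1) b 0 t) {N : ℕ} {z : Fock} (hz : opDown L γ a b z = 0)
    (h0 : ∀ x ≤ N, zeta v u t N x z = 0) : ∀ f ∈ trip v u t N, form f z = 0 := by
  have hle1 := hv.le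
  have hle2 := hu.le
  have key : ∀ y x w, x + y + w = N → form (v x * u y * t w) z = 0 := by
    intro y
    induction y with
    | zero =>
      intro x w h
      have := h0 x (by omega)
      rwa [zeta, show N - x = w by omega] at this
    | succ y ih =>
      intro x w h
      have hlev := prods_le_level hv hu (x + y) (mul_mem_prods v u (p := x) (r := y) rfl)
      have h1 := form_opUp_left ht (by omega) hz hlev w
      rw [ih x (w + 1) (by omega), mul_zero, opUp_mul_lw hv hu, add_mul, smul_mul_assoc,
        smul_mul_assoc, map_add, map_smul, map_smul, LinearMap.add_apply, LinearMap.smul_apply,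
        LinearMap.smul_apply, ih (x + 1) w (by omega), smul_zero, zero_add, smul_eq_mul] at h1
      exact (mul_eq_zero.1 h1).resolve_left (qpow_ne_zero _ _)
  intro f hf
  induction hf using Submodule.span_induction with
  | zero => simp
  | add v w _ _ h1 h2 => rw [map_add, LinearMap.add_apply, h1, h2, add_zero]
  | smul r v _ h => rw [map_smul, LinearMap.smul_apply, h, smul_zero]
  | mem f hf => obtain ⟨x, y, w, h, rfl⟩ := hf; exact key y x w h

end Triple

section Triple

variable {L : ℂ} {γ : ℕ → ℝ} {a c e b h₁ h₂ : ℕ} {v u t : ℕ → Fock}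

lemma opGamma_coupled_left {h : ℕ} {V : ℕ → Fock} (hV : IsLW L γ (a + 1) e h V)
    (ht : IsLW L γ (e + 1) b h₂ t) (s : ℕ) (ε : ℕ → ℂ) :
    opGamma L γ (a + 1) e (coupled V t s ε)
      = ((-1) ^ h * qnum L ((h : ℂ) + gsum γ (a + 1) e - 1 / 2)) • coupled V t s ε := by
  rw [coupled, map_sum, Finset.smul_sum]
  refine Finset.sum_congr rfl fun p _ => ?_
  rw [map_smul, (ActsOn.opGamma (a + 1) e).mul_right_of_mem_level (Icc_disj (a + 1) b e) (ht.mem _),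
    hV.gamma, smul_mul_assoc, smul_comm]

lemma opGamma_coupled_right {h : ℕ} {U : ℕ → Fock} (hv : IsLW L γ a c h₁ v)
    (hU : IsLW L γ (c + 1) b h U) (s : ℕ) (ε : ℕ → ℂ) :
    opGamma L γ (c + 1) b (coupled v U s ε)
      = ((-1) ^ h * qnum L ((h : ℂ) + gsum γ (c + 1) b - 1 / 2)) • coupled v U s ε := by
  rw [coupled, map_sum, Finset.smul_sum]
  refine Finset.sum_congr rfl fun p _ => ?_
  rw [map_smul,
    (ActsOn.opGamma (c + 1) b).mul_left_of_mem_level (Icc_disj a b c).symm (hv.mem _),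
    hU.gamma, mul_smul_comm, smul_comm]

lemma coupled_left_mem_trip (hv : IsLW L γ a c h₁ v) (hu : IsLW L γ (c + 1) e h₂ u) {x y N : ℕ}
    (h : x + y = N) (ε δ : ℕ → ℂ) :
    coupled (fun p => (opUp L γ a e ^ p) (coupled v u x ε)) t y δ ∈ trip v u t N :=
  sum_mem fun p hp => Submodule.smul_mem _ _ <| by
    rw [Finset.mem_range] at hp
    exact mul_mem_trip_left v u t (M := x + p) (by omega)
      (opUp_pow_mem_prods hv hu (coupled_mem_prods v u x ε) p)

lemma coupled_right_mem_trip (hu : IsLW L γ (c + 1) e h₁ u) (ht : IsLW L γ (e + 1) b h₂ t)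
    {x y N : ℕ} (h : x + y = N) (ε δ : ℕ → ℂ) :
    coupled v (fun p => (opUp L γ (c + 1) b ^ p) (coupled u t x ε)) y δ ∈ trip v u t N :=
  sum_mem fun p hp => Submodule.smul_mem _ _ <| by
    rw [Finset.mem_range] at hp
    exact mul_mem_trip_right v u t (M := x + (y - p)) (by omega)
      (opUp_pow_mem_prods hu ht (coupled_mem_prods u t x ε) (y - p))

lemma opGamma_right_mem_lowestTrip (hv : IsLW L γ a c h₁ v) (hu : IsLW L γ (c + 1) e h₂ u)
    (ht : IsLW L γ (e + 1) b 0 t) {N : ℕ} {z : Fock} (hz : z ∈ lowestTrip L γ a b v u t N) :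
    opGamma L γ (c + 1) b z ∈ lowestTrip L γ a b v u t N := by
  have hle1 := hv.le
  have hle2 := hu.le
  have hle3 := ht.le
  refine ⟨?_, ?_⟩
  · refine (Submodule.span_le.2 ?_ : trip v u t N ≤ (trip v u t N).comap
      (opGamma L γ (c + 1) b)) hz.1
    rintro _ ⟨x, y, w, h, rfl⟩
    rw [SetLike.mem_coe, Submodule.mem_comap, mul_assoc,
      (ActsOn.opGamma (c + 1) b).mul_left_of_mem_level (Icc_disj a b c).symm (hv.mem _)]
    exact mul_mem_trip_right v u t (by omega)
      (opGamma_mem_prods hu ht (mul_mem_prods u t (p := y) (r := w) rfl))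
  · have h := opGamma_commute_opDown L γ (a := a) (b := b) (c := c) (d := b) (by omega) (by omega)
      le_rfl
    rw [SetLike.mem_coe, LinearMap.mem_ker, ← Module.End.mul_apply, ← h.eq, Module.End.mul_apply,
      LinearMap.mem_ker.1 hz.2, map_zero]

/-- The operators `Γ` on the first two and on the last two of three coupled lowest weight modules.
-/
lemma splitPair_lowestTrip (hL : ‖qq L‖ ≠ 1) (hv : IsLW L γ (a + 1) c h₁ v)
    (hu : IsLW L γ (c + 1) e h₂ u) (ht : IsLW L γ (e + 1) b 0 t)
    (hg : 1 / 2 < gsum γ (a + 1) e) {N : ℕ} {w : ℕ → Fock}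
    (hmem : ∀ x ≤ N, w x ∈ lowestTrip L γ (a + 1) b v u t N)
    (heig : ∀ x ≤ N, opGamma L γ (a + 1) e (w x) = ((-1) ^ (h₁ + h₂ + x)
      * qnum L (((h₁ + h₂ + x : ℕ) : ℂ) + gsum γ (a + 1) e - 1 / 2)) • w x)
    (hnorm : ∀ x ≤ N, form (w x) (w x) = 1) :
    SplitPair form (lowestTrip L γ (a + 1) b v u t N) (opGamma L γ (a + 1) e)
      (opGamma L γ (c + 1) b) N (zeta v u t N) w
      (fun x => (-1) ^ (h₁ + h₂ + x)
        * qnum L (((h₁ + h₂ + x : ℕ) : ℂ) + gsum γ (a + 1) e - 1 / 2))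
      (splitR L γ (a + 1) c e b h₁ N)
      (fun x => (-1) ^ (h₂ + (N - x))
        * qnum L (((h₂ + (N - x) : ℕ) : ℂ) + gsum γ (c + 1) b - 1 / 2))
      (splitL L γ (a + 1) c e b h₁ N) := by
  have hle1 := hv.le
  have hle2 := hu.le
  have hle3 := ht.le
  have hinj : ∀ x y : ℕ, (-1) ^ (h₁ + h₂ + x)
        * qnum L (((h₁ + h₂ + x : ℕ) : ℂ) + gsum γ (a + 1) e - 1 / 2)
      = (-1) ^ (h₁ + h₂ + y)
        * qnum L (((h₁ + h₂ + y : ℕ) : ℂ) + gsum γ (a + 1) e - 1 / 2) → x = y := fun x y h => by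
    have : h₁ + h₂ + x = h₁ + h₂ + y :=
      casimir_eigenvalue_injective hL (z := gsum γ (a + 1) e - 1 / 2) (by linarith) (by
        push_cast at h ⊢
        simpa only [add_sub_assoc] using h)
    omega
  refine
    { symm := form_symm
      symmT := isTranspose_opGamma L γ (by omega)
      mem := hmem
      memT := fun z hz => opGamma_right_mem_lowestTrip hv hu ht hz
      radical := fun z hz h0 z' hz' =>
        form_eq_zero_of_zeta hv hu ht (LinearMap.mem_ker.1 hz.2) h0 z' hz'.1
      orth := fun x hx y hy => ?_
      eigen := heig
      inj := fun x _ y _ h => hinj x y h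
      zetaS := fun z hz x hx => zeta_opGamma_left hv hu ht (LinearMap.mem_ker.1 hz.2) hx
      zetaT := fun z hz x hx => zeta_opGamma_right hv hu ht (LinearMap.mem_ker.1 hz.2) hx
      r_zero := by rw [splitR, sigma_zero]; ring
      l_last := by rw [splitL, Nat.sub_self, sigma_zero]; ring }
  split_ifs with h
  · rw [← h, hnorm x hx]
  · have h1 := isTranspose_opGamma L γ (a := a + 1) (b := e) (by omega) (w x) (w y)
    rw [heig x hx, heig y hy, map_smul, map_smul, LinearMap.smul_apply, smul_eq_mul, smul_eq_mul,
      ← sub_eq_zero, ← sub_mul] at h1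
    exact (mul_eq_zero.1 h1).resolve_left (sub_ne_zero.2 fun e' => h (hinj x y e'))

end Triple

/-! ### The difference equation of the basic Racah polynomials -/

/-- The coefficient `A_s` at `X = p ^ s`, in terms of `u = a d`, `v = a c`, `w = -a b` and
`B = a b c d / p`. -/
def racA (p a u v w B X : ℂ) : ℂ :=
  -((1 - u * X) * (1 - v * X) * (1 - w * X) * (1 - B * X))
    / (a * (1 - B * X ^ 2) * (1 - B * p * X ^ 2))

/-- The coefficient `C_s` at `X = p ^ s`, in the same parameters. -/
def racC (p a u v w B X : ℂ) : ℂ :=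
  a * (1 - X) * (1 - B * X / u) * (1 - B * X / v) * (1 - B * X / w)
    / ((1 - B * X ^ 2 / p) * (1 - B * X ^ 2))

/-- The function `(X⁻¹, B X; p)_t`, a polynomial of degree `t` in `X⁻¹ + B X`. -/
def racE (p B X : ℂ) (t : ℕ) : ℂ := poch p X⁻¹ t * poch p (B * X) t

lemma poch_succ (p a : ℂ) (n : ℕ) : poch p a (n + 1) = poch p a n * (1 - a * p ^ n) := by
  rw [poch, Finset.prod_range_succ, poch]

lemma poch_succ' (p a : ℂ) (n : ℕ) : poch p a (n + 1) = (1 - a) * poch p (a * p) n := by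
  rw [poch, Finset.prod_range_succ', poch, pow_zero, mul_one, mul_comm]
  congr 1
  exact Finset.prod_congr rfl fun l _ => by rw [pow_succ']; ring

@[simp] lemma poch_zero (p a : ℂ) : poch p a 0 = 1 := by simp [poch]

lemma poch_shift (p a : ℂ) (n : ℕ) : poch p (a * p) n * (1 - a) = poch p a n * (1 - a * p ^ n) := by
  rw [← poch_succ, poch_succ', mul_comm]

lemma racE_succ (p B X : ℂ) (t : ℕ) :
    racE p B X (t + 1) = racE p B X t * ((1 - X⁻¹ * p ^ t) * (1 - B * X * p ^ t)) := by
  rw [racE, racE, poch_succ, poch_succ]; ring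

lemma racE_up {p : ℂ} (hp : p ≠ 0) (B X : ℂ) (t : ℕ) :
    racE p B (p * X) (t + 1) * (1 - B * X)
      = racE p B X t * ((1 - (p * X)⁻¹) * (1 - B * X * p ^ t) * (1 - B * X * p ^ (t + 1))) := by
  have h1 : (p * X)⁻¹ * p = X⁻¹ := by field_simp
  have h2 := poch_shift p (B * X) (t + 1)
  rw [poch_succ p (B * X) t, show B * X * p = B * (p * X) by ring] at h2
  rw [racE, racE, poch_succ' p (p * X)⁻¹, h1]
  linear_combination (1 - (p * X)⁻¹) * poch p X⁻¹ t * h2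

lemma racE_down {p : ℂ} (hp : p ≠ 0) (B X : ℂ) (t : ℕ) :
    racE p B (p⁻¹ * X) (t + 1) * (1 - X⁻¹)
      = racE p B X t * ((1 - B * X * p⁻¹) * (1 - X⁻¹ * p ^ t) * (1 - X⁻¹ * p ^ (t + 1))) := by
  have h1 : B * (p⁻¹ * X) * p = B * X := by field_simp
  have h2 := poch_shift p X⁻¹ (t + 1)
  rw [poch_succ p X⁻¹ t] at h2
  rw [racE, racE, poch_succ' p (B * (p⁻¹ * X)), h1, mul_inv, inv_inv, mul_comm p]
  linear_combination (1 - B * (p⁻¹ * X)) * poch p (B * X) t * h2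

/-- The rational identity behind `racE_difference`, with `X = p ^ x` and `P = p ^ t`. -/
lemma difference_rational {p a u v B X P d1 d2 d3 : ℂ} (hp : p ≠ 0) (ha : a ≠ 0)
    (hu : u ≠ 0) (hv : v ≠ 0) (hX : X ≠ 0) (hP : P ≠ 0) (hd1 : d1 = 1 - B * X ^ 2)
    (hd2 : d2 = 1 - B * p * X ^ 2) (hd3 : d3 = p - B * X ^ 2) (h1 : d1 ≠ 0) (h2 : d2 ≠ 0)
    (h3 : d3 ≠ 0) :
   -((1 - u * X) * (1 - v * X) * (1 + (a ^ 2 * p * B) / (u * v) * X))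
      / (a * d1 * d2)
        * ((1 - (p * X)⁻¹) * (1 - B * X * P) * (1 - B * X * (P * p)))
      + -(a * X * (1 - B * X / u) * (1 - B * X / v) * (1 + u * v * X / (a ^ 2 * p)))
    / (d3 / p * d1)
        * ((1 - B * X * p⁻¹) * (1 - X⁻¹ * P) * (1 - X⁻¹ * (P * p)))
      = (-((1 - u * X) * (1 - v * X) * (1 + (a ^ 2 * p * B) / (u * v) * X))
          / (a * d1 * d2) * (1 - B * X)
        + -(a * X * (1 - B * X / u) * (1 - B * X / v) * (1 + u * v * X / (a ^ 2 * p)))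
          / (d3 / p * d1) * (1 - X⁻¹)
        + (P * p - 1) * (a + (a * (P * p))⁻¹))
          * ((1 - X⁻¹ * P) * (1 - B * X * P))
        + (1 - u * P) * (1 - v * P) * (1 + (a ^ 2 * p * B) / (u * v) * P) * (1 - P * p)
          / (a * (P * p)) := by
  field_simp
  subst hd1 hd2 hd3
  ring

/-- The second order difference operator acts on the functions `racE` by two terms. -/
lemma racE_difference {p a u v w B X : ℂ} (hp : p ≠ 0) (ha : a ≠ 0) (hu : u ≠ 0) (hv : v ≠ 0)
    (hX : X ≠ 0) (hB : u * v * w = -(a ^ 2 * p * B))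
    (h1 : 1 - B * X ^ 2 ≠ 0) (h2 : 1 - B * p * X ^ 2 ≠ 0) (h3 : 1 - B * X ^ 2 / p ≠ 0) (hw : w ≠ 0)
    (t : ℕ) :
    racA p a u v w B X * (racE p B (p * X) (t + 1) - racE p B X (t + 1))
      + racC p a u v w B X * (racE p B (p⁻¹ * X) (t + 1) - racE p B X (t + 1))
      = (p ^ (t + 1) - 1) * (a + (a * p ^ (t + 1))⁻¹) * racE p B X (t + 1)
        + (1 - u * p ^ t) * (1 - v * p ^ t) * (1 - w * p ^ t) * (1 - p ^ (t + 1))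
          / (a * p ^ (t + 1)) * racE p B X t := by
  have hB0 : B ≠ 0 := by
    rintro rfl
    exact mul_ne_zero (mul_ne_zero hu hv) hw (by rw [hB]; ring)
  have e1 := racE_up hp B X t
  have e2 := racE_down hp B X t
  have e3 := racE_succ p B X t
  have hP : p ^ t ≠ 0 := pow_ne_zero _ hp
  have hw' : w = -(a ^ 2 * p * B / (u * v)) := by field_simp; linear_combination hB
  have hA : racA p a u v w B X = -((1 - u * X) * (1 - v * X) * (1 + a ^ 2 * p * B / (u * v) * X))
      / (a * (1 - B * X ^ 2) * (1 - B * p * X ^ 2)) * (1 - B * X) := by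
    rw [racA, hw']; ring
  have hC : racC p a u v w B X = -(a * X * (1 - B * X / u) * (1 - B * X / v)
      * (1 + u * v * X / (a ^ 2 * p))) / ((p - B * X ^ 2) / p * (1 - B * X ^ 2)) * (1 - X⁻¹) := by
    have e4 : B * X / w = -(u * v * X / (a ^ 2 * p)) := by
      rw [hw']; field_simp
    have e5 : 1 - B * X ^ 2 / p = (p - B * X ^ 2) / p := by field_simp
    have e6 : 1 - X = -(X * (1 - X⁻¹)) := by field_simp; ring
    rw [racC, e4, e5, e6]; ring
  have h3' : p - B * X ^ 2 ≠ 0 := by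
    intro h; apply h3; field_simp; linear_combination h
  have key := difference_rational hp ha hu hv hX hP rfl rfl rfl h1 h2 h3'
  rw [← pow_succ] at key
  rw [show (1 - w * p ^ t) = 1 + a ^ 2 * p * B / (u * v) * p ^ t by rw [hw']; ring, hA, hC, e3]
  generalize -((1 - u * X) * (1 - v * X) * (1 + a ^ 2 * p * B / (u * v) * X))
      / (a * (1 - B * X ^ 2) * (1 - B * p * X ^ 2)) = A' at *
  generalize -(a * X * (1 - B * X / u) * (1 - B * X / v)
      * (1 + u * v * X / (a ^ 2 * p))) / ((p - B * X ^ 2) / p * (1 - B * X ^ 2)) = C' at *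
  linear_combination A' * e1 + C' * e2 + racE p B X t * key

/-- The coefficients of the basic Racah polynomial with respect to the functions `racE`. -/
def racCoeff (p a u v w : ℂ) (m t : ℕ) : ℂ :=
  poch p (p ^ m)⁻¹ t * poch p (-(a ^ 2 * p ^ m)) t
    / (poch p u t * poch p v t * poch p w t * poch p p t) * p ^ t

/-- The terminating series of the basic Racah polynomial of degree `m`. -/
def racSum (p a u v w B : ℂ) (m : ℕ) (X : ℂ) : ℂ :=
  ∑ t ∈ Finset.range (m + 1), racCoeff p a u v w m t * racE p B X t

/-- The coefficients are chosen such that the two-term action of the difference operator on the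
functions `racE` telescopes. -/
lemma racCoeff_succ {p a u v w : ℂ} {m t : ℕ} (hp : p ≠ 0) (ha : a ≠ 0) (hu : 1 - u * p ^ t ≠ 0)
    (hv : 1 - v * p ^ t ≠ 0) (hw : 1 - w * p ^ t ≠ 0) (h1 : 1 - p ^ (t + 1) ≠ 0) :
    racCoeff p a u v w m (t + 1) * ((1 - u * p ^ t) * (1 - v * p ^ t) * (1 - w * p ^ t)
        * (1 - p ^ (t + 1)) / (a * p ^ (t + 1)))
      = ((p ^ m - 1) * (a + (a * p ^ m)⁻¹) - (p ^ t - 1) * (a + (a * p ^ t)⁻¹))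
        * racCoeff p a u v w m t := by
  have hP : p ^ t ≠ 0 := pow_ne_zero _ hp
  have hM : p ^ m ≠ 0 := pow_ne_zero _ hp
  rw [racCoeff, racCoeff, poch_succ, poch_succ, poch_succ, poch_succ, poch_succ, poch_succ,
    show p * p ^ t = p ^ (t + 1) by ring]
  have e : ((p ^ m - 1) * (a + (a * p ^ m)⁻¹) - (p ^ t - 1) * (a + (a * p ^ t)⁻¹))
      = (1 - (p ^ m)⁻¹ * p ^ t) * (1 - -(a ^ 2 * p ^ m) * p ^ t) / (a * p ^ t) := by
    field_simp; ring
  rw [e]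
  rw [pow_succ p t] at *
  generalize p ^ t = P at *
  clear e
  generalize hU : 1 - u * P = U at *
  generalize hV : 1 - v * P = V at *
  generalize hW : 1 - w * P = W at *
  generalize hT : 1 - P * p = T at *
  generalize (1 - (p ^ m)⁻¹ * P) = Z1
  generalize (1 - -(a ^ 2 * p ^ m) * P) = Z2
  have e2 : ∀ x y d₁ d₂ d₃ d₄ : ℂ, x * Z1 * (y * Z2) / (d₁ * U * (d₂ * V) * (d₃ * W) * (d₄ * T))
      = x * y / (d₁ * d₂ * d₃ * d₄) * (Z1 * Z2 / (U * V * W * T)) := fun x y d₁ d₂ d₃ d₄ => by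
    rw [div_mul_div_comm]; congr 1 <;> ring
  rw [e2]
  generalize (poch p (p ^ m)⁻¹ t * poch p (-(a ^ 2 * p ^ m)) t
    / (poch p u t * poch p v t * poch p w t * poch p p t)) = Y
  field_simp

/-- The difference equation of the basic Racah polynomials. -/
lemma racSum_difference {p a u v w B X : ℂ} {m : ℕ} (hp : p ≠ 0) (ha : a ≠ 0) (hu : u ≠ 0)
    (hv : v ≠ 0) (hw : w ≠ 0) (hX : X ≠ 0) (hB : u * v * w = -(a ^ 2 * p * B))
    (h1 : 1 - B * X ^ 2 ≠ 0) (h2 : 1 - B * p * X ^ 2 ≠ 0) (h3 : 1 - B * X ^ 2 / p ≠ 0)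
    (hu' : ∀ t < m, 1 - u * p ^ t ≠ 0) (hv' : ∀ t < m, 1 - v * p ^ t ≠ 0)
    (hw' : ∀ t < m, 1 - w * p ^ t ≠ 0) (hp' : ∀ t < m, 1 - p ^ (t + 1) ≠ 0) :
    racA p a u v w B X * (racSum p a u v w B m (p * X) - racSum p a u v w B m X)
      + racC p a u v w B X * (racSum p a u v w B m (p⁻¹ * X) - racSum p a u v w B m X)
      = (p ^ m - 1) * (a + (a * p ^ m)⁻¹) * racSum p a u v w B m X := by
  have e : ∀ X, racE p B X 0 = 1 := fun X => by simp [racE]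
  have key : ∀ t < m, racCoeff p a u v w m (t + 1)
      * (racA p a u v w B X * (racE p B (p * X) (t + 1) - racE p B X (t + 1))
      + racC p a u v w B X * (racE p B (p⁻¹ * X) (t + 1) - racE p B X (t + 1)))
      = (p ^ (t + 1) - 1) * (a + (a * p ^ (t + 1))⁻¹)
          * (racCoeff p a u v w m (t + 1) * racE p B X (t + 1))
        + (((p ^ m - 1) * (a + (a * p ^ m)⁻¹)) * (racCoeff p a u v w m t * racE p B X t)
          - (p ^ t - 1) * (a + (a * p ^ t)⁻¹) * (racCoeff p a u v w m t * racE p B X t)) :=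
    fun t ht => by
      rw [racE_difference hp ha hu hv hX hB h1 h2 h3 hw]
      linear_combination racE p B X t
        * racCoeff_succ (m := m) hp ha (hu' t ht) (hv' t ht) (hw' t ht) (hp' t ht)
  have lhs : racA p a u v w B X * (racSum p a u v w B m (p * X) - racSum p a u v w B m X)
      + racC p a u v w B X * (racSum p a u v w B m (p⁻¹ * X) - racSum p a u v w B m X)
      = ∑ t ∈ Finset.range m, racCoeff p a u v w m (t + 1)
      * (racA p a u v w B X * (racE p B (p * X) (t + 1) - racE p B X (t + 1))
      + racC p a u v w B X * (racE p B (p⁻¹ * X) (t + 1) - racE p B X (t + 1))) := by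
    simp only [racSum]
    rw [Finset.sum_range_succ' _ m, Finset.sum_range_succ' _ m, Finset.sum_range_succ' _ m, e, e, e,
      add_sub_add_right_eq_sub, add_sub_add_right_eq_sub, ← Finset.sum_sub_distrib,
      ← Finset.sum_sub_distrib, Finset.mul_sum, Finset.mul_sum, ← Finset.sum_add_distrib]
    exact Finset.sum_congr rfl fun t _ => by ring
  rw [lhs, Finset.sum_congr rfl fun t ht => key t (Finset.mem_range.1 ht), Finset.sum_add_distrib,
    Finset.sum_sub_distrib, racSum, Finset.sum_range_succ, ← Finset.mul_sum]
  have tel := Finset.sum_range_sub (fun t => (p ^ t - 1) * (a + (a * p ^ t)⁻¹)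
    * (racCoeff p a u v w m t * racE p B X t)) m
  rw [Finset.sum_sub_distrib] at tel
  simp only [pow_zero, sub_self, zero_mul, sub_zero] at tel
  linear_combination tel

/-- The initial value `1` and the three-term recursion of a tridiagonal action determine a sequence,
and the values of a basic Racah polynomial, times Pochhammer symbols, are that sequence: in this
normalization the recursion is the difference equation. -/
lemma racah_recursion {p a u v w B : ℂ} {m N : ℕ} (hp : p ≠ 0) (ha : a ≠ 0) (hu : u ≠ 0)
    (hv : v ≠ 0) (hw : w ≠ 0) (hB : u * v * w = -(a ^ 2 * p * B)) (hmN : m ≤ N)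
    (h1 : ∀ t : ℕ, 1 - B * p ^ t ≠ 0) (h2 : 1 - B / p ≠ 0)
    (hu' : ∀ t < N, 1 - u * p ^ t ≠ 0) (hv' : ∀ t < N, 1 - v * p ^ t ≠ 0)
    (hw' : ∀ t < N, 1 - w * p ^ t ≠ 0) (hp' : ∀ t < N, 1 - p ^ (t + 1) ≠ 0)
    {H : ℕ → ℂ} (H0 : H 0 = 1)
    (hH : ∀ x < N, H (x + 1) = -a * ((a * p ^ m - (a * p ^ m)⁻¹ - a + a⁻¹
      + racA p a u v w B (p ^ x) + racC p a u v w B (p ^ x)) * H x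
      + a * racA p a u v w B (p ^ (x - 1)) * racC p a u v w B (p ^ x) * H (x - 1))) :
    ∀ x ≤ N, H x = poch p u x * poch p v x * poch p w x / poch p (B * p ^ x) x
      * racSum p a u v w B m (p ^ x) := by
  have hpoch : ∀ x, poch p (B * p ^ x) x ≠ 0 := fun x =>
    Finset.prod_ne_zero_iff.2 fun l _ => by rw [mul_assoc, ← pow_add]; exact h1 _
  obtain ⟨f, hf⟩ : ∃ f : ℕ → ℂ, ∀ x, f x = poch p u x * poch p v x * poch p w x
    / poch p (B * p ^ x) x := ⟨_, fun _ => rfl⟩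
  have f_succ : ∀ x, f (x + 1) = -a * racA p a u v w B (p ^ x) * f x := fun x => by
    have e1 := poch_shift p (B * p ^ x) (x + 1)
    rw [poch_succ p (B * p ^ x) x, show B * p ^ x * p = B * p ^ (x + 1) by ring] at e1
    have n1 := hpoch x
    have n2 := hpoch (x + 1)
    have n3 := h1 x
    have n4 : 1 - B * (p ^ x) ^ 2 ≠ 0 := by rw [← pow_mul]; exact h1 _
    have n5 : 1 - B * p * (p ^ x) ^ 2 ≠ 0 := by
      rw [mul_assoc, ← pow_mul, ← pow_succ']; exact h1 _
    rw [hf, hf, poch_succ, poch_succ, poch_succ, racA, div_eq_iff n2]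
    rw [pow_succ p x] at e1
    rw [show (1 - B * p ^ x * p ^ x) = 1 - B * (p ^ x) ^ 2 by ring,
      show (1 - B * p ^ x * (p ^ x * p)) = 1 - B * p * (p ^ x) ^ 2 by ring, ← pow_succ] at e1
    generalize poch p (B * p ^ (x + 1)) (x + 1) = Y at *
    generalize poch p (B * p ^ x) x = Z at *
    generalize hd4 : 1 - B * (p ^ x) ^ 2 = d4 at *
    generalize hd5 : 1 - B * p * (p ^ x) ^ 2 = d5 at *
    field_simp
    linear_combination -(poch p u x * (1 - u * p ^ x) * poch p v x * (1 - v * p ^ x) * poch p w x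
      * (1 - w * p ^ x)) * e1
  have hC0 : racC p a u v w B 1 = 0 := by simp [racC]
  have step : ∀ x < N, H x = f x * racSum p a u v w B m (p ^ x) →
      (x ≠ 0 → H (x - 1) = f (x - 1) * racSum p a u v w B m (p ^ (x - 1))) →
      H (x + 1) = f (x + 1) * racSum p a u v w B m (p ^ (x + 1)) := fun x hx i1 i2 => by
    have hd := racSum_difference (m := m) hp ha hu hv hw (pow_ne_zero x hp) hB
      (by rw [← pow_mul]; exact h1 _) (by rw [mul_assoc, ← pow_mul, ← pow_succ']; exact h1 _)
      (by
        rcases Nat.eq_zero_or_pos x with rfl | h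
        · simpa using h2
        · obtain ⟨y, rfl⟩ : ∃ y, x = y + 1 := ⟨x - 1, by omega⟩
          have : B * (p ^ (y + 1)) ^ 2 / p = B * p ^ (2 * y + 1) := by
            field_simp; ring
          rw [this]; exact h1 _)
      (fun t ht => hu' t (by omega)) (fun t ht => hv' t (by omega))
      (fun t ht => hw' t (by omega)) (fun t ht => hp' t (by omega))
    have hM : p ^ m ≠ 0 := pow_ne_zero _ hp
    have e : (p ^ m - 1) * (a + (a * p ^ m)⁻¹) = a * p ^ m - (a * p ^ m)⁻¹ - a + a⁻¹ := by
      field_simp; ring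
    rw [e, ← pow_succ'] at hd
    have h3 : a * racA p a u v w B (p ^ (x - 1)) * racC p a u v w B (p ^ x) * H (x - 1)
        = -f x * (racC p a u v w B (p ^ x) * racSum p a u v w B m (p⁻¹ * p ^ x)) := by
      rcases Nat.eq_zero_or_pos x with rfl | h
      · rw [pow_zero, hC0]; ring
      · obtain ⟨y, rfl⟩ : ∃ y, x = y + 1 := ⟨x - 1, by omega⟩
        have e2 : p⁻¹ * p ^ (y + 1) = p ^ y := by rw [pow_succ', inv_mul_cancel_left₀ hp]
        have e3 := i2 (by omega)
        rw [Nat.add_sub_cancel] at e3 ⊢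
        rw [e2, e3, f_succ]; ring
    rw [hH x hx, h3, i1, f_succ]
    linear_combination (-a * f x) * (-hd)
  have key : ∀ x ≤ N, H x = f x * racSum p a u v w B m (p ^ x) := by
    intro x
    induction x using Nat.strong_induction_on with
    | _ x ih =>
      intro hx
      cases x with
      | zero =>
        have h0 : racSum p a u v w B m (p ^ 0) = 1 := by
          rw [racSum, Finset.sum_range_succ', Finset.sum_eq_zero]
          · simp [racCoeff, racE]
          · intro t _
            rw [racE, poch_succ']; simp
        rw [H0, h0, hf]; simp
      | succ x =>
        exact step x (by omega) (ih x (by omega) (by omega))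
          fun hx0 => ih (x - 1) (by omega) (by omega)
  intro x hx
  rw [key x hx, hf]

lemma poch_inv_pow_eq_zero {p : ℂ} (hp : p ≠ 0) {m t : ℕ} (h : m < t) : poch p (p ^ m)⁻¹ t = 0 :=
  Finset.prod_eq_zero (Finset.mem_range.2 h) (by rw [inv_mul_cancel₀ (pow_ne_zero _ hp), sub_self])

/-- The `p`-Racah polynomial as a multiple of `racSum`. Both series terminate at `m`, so that the
upper limit of summation does not matter. -/
lemma racah_eq_racSum {p a u v w B g δ β : ℂ} {N : ℕ} (hp : p ≠ 0) (hu : g * p = u)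
    (hv : δ * β * p = v) (hw : p ^ (-(N : ℤ)) = w) (hg : g * δ * p = -a ^ 2) (hB : β * w = B)
    (m x : ℕ) (ρ : ℂ) :
    racah p m x g δ β N ρ
      = poch p u m * poch p v m * poch p w m * ρ ^ m * racSum p a u v w B m (p ^ x) := by
  have e1 : p ^ (-(m : ℤ)) = (p ^ m)⁻¹ := by rw [zpow_neg, zpow_natCast]
  have e2 : p ^ (-(x : ℤ)) = (p ^ x)⁻¹ := by rw [zpow_neg, zpow_natCast]
  have e3 : β * p ^ ((x : ℤ) - (N : ℤ)) = B * p ^ x := by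
    rw [← hB, ← hw, sub_eq_add_neg, add_comm, zpow_add₀ hp, zpow_natCast, mul_assoc]
  have e4 : g * δ * p ^ (m + 1) = -(a ^ 2 * p ^ m) := by
    rw [pow_succ]; linear_combination p ^ m * hg
  rw [racah, phi43, hu, hv, e1, e2, e3, e4, hw, racSum]
  congr 1
  rw [tsum_eq_sum (s := Finset.range (m + 1))]
  · refine Finset.sum_congr rfl fun t _ => ?_
    rw [racCoeff, racE]; ring
  · intro t ht
    rw [poch_inv_pow_eq_zero hp (by simpa using ht)]
    ring

/-! ### The tridiagonal action in terms of the Racah parameters -/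

/-- The product `l (x - 1) * r x` of the two off-diagonal coefficients of a split pair, up to a
constant factor, at `X = p ^ x` with `n = p ^ N`. -/
def splitProd (p X n u v : ℂ) : ℂ :=
  -((1 - X) * (1 - u ^ 2 * X / p) * (1 - p * n / X) * (1 - v ^ 2 * n / X)) / (n * u * v)

/-- The rational identity that turns the diagonal entry of a split pair into the diagonal
coefficient of the Racah recursion. -/
lemma diagonal_rational {p X n u v m d0 d1 d2 d3 : ℂ} (hp : p ≠ 0) (hX : X ≠ 0) (hn : n ≠ 0)
    (hu : u ≠ 0) (hv : v ≠ 0) (hm : m ≠ 0) (hd0 : d0 = 1 - p) (hd1 : d1 = p + u ^ 2 * m ^ 2 * X ^ 2)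
    (hd2 : d2 = 1 + u ^ 2 * m ^ 2 * X ^ 2) (hd3 : d3 = 1 + u ^ 2 * m ^ 2 * p * X ^ 2)
    (h0 : d0 ≠ 0) (h1 : d1 ≠ 0) (h2 : d2 ≠ 0) (h3 : d3 ≠ 0) :
    (m * v * n / X - X / (m * v * n)) + splitProd p (p * X) n u v * (u * m * p * X) / (d0 * d3)
      - splitProd p X n u v * (u * m * p * X) / (d0 * d1)
      = m * v - 1 / (m * v)
        + ((1 - X / n) * (1 + X * n * u ^ 2 * (m * v) ^ 2) * (1 + m ^ 2 * p * X)
          * (1 + (u * m) ^ 2 * X)) / (m * v * d2 * d3)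
        - m * v * (1 - X) * (1 - X * u ^ 2 / p) * (1 - X / (n * v ^ 2))
          * (1 + X * n * (u * m) ^ 2) * p / (d1 * d2) := by
  unfold splitProd
  field_simp
  subst hd0 hd1 hd2 hd3
  ring

/-- The rational identity that turns the square of an off-diagonal entry of a split pair into a
product of two coefficients of the Racah recursion. -/
lemma offDiagonal_rational {p X n u v m d0 dd d2 d3 d4 : ℂ} (hp : p ≠ 0) (hX : X ≠ 0) (hn : n ≠ 0)
    (hu : u ≠ 0) (hv : v ≠ 0) (hm : m ≠ 0) (hd0 : d0 = 1 - p) (hdd : dd = 1 + p)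
    (hd2 : d2 = 1 + u ^ 2 * m ^ 2 * X ^ 2) (hd3 : d3 = 1 + u ^ 2 * m ^ 2 * p * X ^ 2)
    (hd4 : d4 = 1 + u ^ 2 * m ^ 2 * p ^ 2 * X ^ 2) (h0 : d0 ≠ 0) (hdd' : dd ≠ 0)
    (h2 : d2 ≠ 0) (h3 : d3 ≠ 0) (h4 : d4 ≠ 0) :
    (m * v * n / (p * X) - p * X / (m * v * n)) - (m * v * n / X - X / (m * v * n))
        - splitProd p (p * X) n u v * (u * m * p * X) / (d0 * d3)
        + splitProd p X n u v * (u * m * p * X) / (d0 * dd * d2)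
        + splitProd p (p ^ 2 * X) n u v * (u * m * p ^ 2 * X) / (d0 * dd * d4)
      = ((1 + X * n * u ^ 2 * (m * v) ^ 2) * (1 + m ^ 2 * p * X) * (1 + (u * m) ^ 2 * X))
        * (1 + p * X * n * (u * m) ^ 2) * X * d0 / (m * v * n * d2 * d3 * d4) := by
  unfold splitProd
  field_simp
  subst hd0 hdd hd2 hd3 hd4
  ring

/-- The coefficients `A_s` for the parameters `u`, `v`, `m`. -/
def dataA (p u v m : ℂ) (N : ℕ) (X : ℂ) : ℂ :=
  racA p (m * v) (-(m ^ 2 * p)) (-(p ^ N * u ^ 2 * (m * v) ^ 2)) (p ^ N)⁻¹ (-(u ^ 2 * m ^ 2)) X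

lemma dataA_eq (p u v m : ℂ) (N : ℕ) (X : ℂ) :
    dataA p u v m N X = -(((1 - X / p ^ N) * (1 + X * p ^ N * u ^ 2 * (m * v) ^ 2)
      * (1 + m ^ 2 * p * X) * (1 + (u * m) ^ 2 * X))
        / (m * v * (1 + u ^ 2 * m ^ 2 * X ^ 2) * (1 + u ^ 2 * m ^ 2 * p * X ^ 2))) := by
  rw [dataA, racA, neg_div]
  congr 2 <;> ring

/-- The coefficients `C_s` for the parameters `u`, `v`, `m`. -/
def dataC (p u v m : ℂ) (N : ℕ) (X : ℂ) : ℂ :=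
  racC p (m * v) (-(m ^ 2 * p)) (-(p ^ N * u ^ 2 * (m * v) ^ 2)) (p ^ N)⁻¹ (-(u ^ 2 * m ^ 2)) X

/-- The coefficients of a split pair are those of the `p`-Racah polynomials: the two eigenvalue
sequences and the products of the off-diagonal coefficients are parametrized by `u`, `v`, `m`. -/
structure IsRacahData (p Q u v m : ℂ) (N : ℕ) (θ r θs l : ℕ → ℂ) : Prop where
  p_ne : p ≠ 0
  Q_ne : Q ≠ 0
  u_ne : u ≠ 0
  v_ne : v ≠ 0
  m_ne : m ≠ 0
  one_sub : 1 - p ≠ 0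
  one_add : 1 + p ≠ 0
  reg : ∀ t : ℕ, 1 - -(u ^ 2 * m ^ 2) * p ^ t ≠ 0
  reg' : 1 - -(u ^ 2 * m ^ 2) / p ≠ 0
  theta_eq : ∀ x, Q * θ x = u * m * p ^ x - (u * m * p ^ x)⁻¹
  thetas_eq : ∀ x ≤ N, Q * θs x = m * v * p ^ N / p ^ x - p ^ x / (m * v * p ^ N)
  prod_eq : ∀ x ≤ N, Q ^ 2 * (l x * r (x + 1)) = splitProd p (p * p ^ x) (p ^ N) u v
  poch_u : ∀ t < N, 1 - -(m ^ 2 * p) * p ^ t ≠ 0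
  poch_v : ∀ t < N, 1 - -(p ^ N * u ^ 2 * (m * v) ^ 2) * p ^ t ≠ 0
  poch_w : ∀ t < N, 1 - (p ^ N)⁻¹ * p ^ t ≠ 0
  poch_p : ∀ t < N, 1 - p ^ (t + 1) ≠ 0
  off_ne : ∀ x < N, dataA p u v m N (p ^ x) * dataC p u v m N (p ^ (x + 1)) ≠ 0

namespace IsRacahData

variable {p Q u v m : ℂ} {N : ℕ} {θ r θs l : ℕ → ℂ}

lemma dataC_eq (h : IsRacahData p Q u v m N θ r θs l) {X : ℂ} (hX : X ≠ 0) :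
    dataC p u v m N X = m * v * (1 - X) * (1 - X * u ^ 2 / p) * (1 - X / (p ^ N * v ^ 2))
          * (1 + X * p ^ N * (u * m) ^ 2) * p
        / ((p + u ^ 2 * m ^ 2 * X ^ 2) * (1 + u ^ 2 * m ^ 2 * X ^ 2)) := by
  have h1 := h.p_ne
  have h2 := h.u_ne
  have h3 := h.v_ne
  have h4 := h.m_ne
  have hn : p ^ N ≠ 0 := pow_ne_zero _ h1
  have e1 : -(u ^ 2 * m ^ 2) * X / -(m ^ 2 * p) = X * u ^ 2 / p := by field_simp
  have e2 : -(u ^ 2 * m ^ 2) * X / -(p ^ N * u ^ 2 * (m * v) ^ 2) = X / (p ^ N * v ^ 2) := by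
    field_simp
  have e3 : 1 - -(u ^ 2 * m ^ 2) * X / (p ^ N)⁻¹ = 1 + X * p ^ N * (u * m) ^ 2 := by
    field_simp; ring
  have e4 : 1 - -(u ^ 2 * m ^ 2) * X ^ 2 / p = (p + u ^ 2 * m ^ 2 * X ^ 2) / p := by
    field_simp; ring
  have e5 : 1 - -(u ^ 2 * m ^ 2) * X ^ 2 = 1 + u ^ 2 * m ^ 2 * X ^ 2 := by ring
  rw [dataC, racC, e1, e2, e3, e4, e5, div_mul_eq_mul_div, div_div_eq_mul_div]

lemma theta_sub (h : IsRacahData p Q u v m N θ r θs l) (x : ℕ) :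
    Q * (θ x - θ (x + 1))
      = (1 - p) * (1 + u ^ 2 * m ^ 2 * p * (p ^ x) ^ 2) / (u * m * p * p ^ x) := by
  have h1 := h.p_ne
  have h2 := h.u_ne
  have h4 := h.m_ne
  have hX : p ^ x ≠ 0 := pow_ne_zero _ h1
  rw [mul_sub, h.theta_eq, h.theta_eq, pow_succ]
  generalize p ^ x = X at *
  field_simp
  ring

lemma theta_sub_two (h : IsRacahData p Q u v m N θ r θs l) (x : ℕ) :
    Q * (θ x - θ (x + 2)) = (1 - p) * (1 + p) * (1 + u ^ 2 * m ^ 2 * p ^ 2 * (p ^ x) ^ 2)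
      / (u * m * p ^ 2 * p ^ x) := by
  have h1 := h.p_ne
  have h2 := h.u_ne
  have h4 := h.m_ne
  have hX : p ^ x ≠ 0 := pow_ne_zero _ h1
  rw [mul_sub, h.theta_eq, h.theta_eq, pow_add]
  generalize p ^ x = X at *
  field_simp
  ring

/-- Division by a difference of eigenvalues. -/
lemma prod_div (h : IsRacahData p Q u v m N θ r θs l) {y d z : ℂ} {f : ℂ} (hy : Q ^ 2 * f = y)
    (hd : Q * d = z) : Q * (f / d) = y / z := by
  have h1 := h.Q_ne
  subst hy hd
  field_simp

lemma reg_one (h : IsRacahData p Q u v m N θ r θs l) (x t : ℕ) :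
    1 + u ^ 2 * m ^ 2 * p ^ t * (p ^ x) ^ 2 ≠ 0 := by
  have := h.reg (t + 2 * x)
  rwa [show 1 - -(u ^ 2 * m ^ 2) * p ^ (t + 2 * x) = 1 + u ^ 2 * m ^ 2 * p ^ t * (p ^ x) ^ 2 by
    rw [pow_add, pow_mul']; ring] at this

lemma reg_neg (h : IsRacahData p Q u v m N θ r θs l) (x : ℕ) :
    p + u ^ 2 * m ^ 2 * (p ^ x) ^ 2 ≠ 0 := by
  have h1 := h.p_ne
  cases x with
  | zero =>
    have h2 := h.reg'
    have : 1 - -(u ^ 2 * m ^ 2) / p = (p + u ^ 2 * m ^ 2 * (p ^ 0) ^ 2) / p := by field_simp; ring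
    rw [this] at h2
    exact fun e => h2 (by rw [e, zero_div])
  | succ x =>
    have h2 := h.reg_one x 1
    rw [show p + u ^ 2 * m ^ 2 * (p ^ (x + 1)) ^ 2 = p * (1 + u ^ 2 * m ^ 2 * p ^ 1 * (p ^ x) ^ 2) by
      ring]
    exact mul_ne_zero h1 h2

variable {V : Type*} [AddCommGroup V] [Module ℂ V] {B : V →ₗ[ℂ] V →ₗ[ℂ] ℂ}
  {M : Submodule ℂ V} {S T : Module.End ℂ V} {ζ : ℕ → V →ₗ[ℂ] ℂ} {w : ℕ → V}

lemma prod_pred_div (h : IsRacahData p Q u v m N θ r θs l) (hs : SplitPair B M S T N ζ w θ r θs l)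
    {x : ℕ} (hx : x ≤ N) : Q * (l (x - 1) * r x / (θ (x - 1) - θ x))
      = splitProd p (p ^ x) (p ^ N) u v * (u * m * p * p ^ x)
        / ((1 - p) * (p + u ^ 2 * m ^ 2 * (p ^ x) ^ 2)) := by
  have h1 := h.p_ne
  cases x with
  | zero => rw [hs.r_zero, splitProd]; simp
  | succ x =>
    rw [Nat.add_sub_cancel, h.prod_div (h.prod_eq x (by omega)) (h.theta_sub x), ← pow_succ',
      div_div_eq_mul_div]
    have : (1 - p) * (p + u ^ 2 * m ^ 2 * (p ^ (x + 1)) ^ 2)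
      = p * ((1 - p) * (1 + u ^ 2 * m ^ 2 * p * (p ^ x) ^ 2)) := by ring
    rw [this, show u * m * p * p ^ (x + 1) = p * (u * m * p * p ^ x) by ring,
      mul_left_comm (splitProd _ _ _ _ _) p, mul_div_mul_left _ _ h1]

lemma prod_pred_div_two (h : IsRacahData p Q u v m N θ r θs l)
    (hs : SplitPair B M S T N ζ w θ r θs l) {x : ℕ} (hx : x ≤ N) :
    Q * (l (x - 1) * r x / (θ (x - 1) - θ (x + 1)))
      = splitProd p (p ^ x) (p ^ N) u v * (u * m * p * p ^ x)
        / ((1 - p) * (1 + p) * (1 + u ^ 2 * m ^ 2 * (p ^ x) ^ 2)) := by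
  have h1 := h.p_ne
  cases x with
  | zero => rw [hs.r_zero, splitProd]; simp
  | succ x =>
    rw [Nat.add_sub_cancel, h.prod_div (h.prod_eq x (by omega)) (h.theta_sub_two x), ← pow_succ',
      div_div_eq_mul_div]
    congr 1 <;> ring

/-- The diagonal entries of the tridiagonal action. -/
lemma matrix_self (h : IsRacahData p Q u v m N θ r θs l) (hs : SplitPair B M S T N ζ w θ r θs l)
    {x : ℕ} (hx : x ≤ N) : Q * B (w x) (T (w x))
      = m * v - (m * v)⁻¹ - dataA p u v m N (p ^ x) - dataC p u v m N (p ^ x) := by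
  have hX : p ^ x ≠ 0 := pow_ne_zero _ h.p_ne
  have h2 := h.reg_one x 0
  have h3 := h.reg_one x 1
  rw [pow_zero, mul_one] at h2
  rw [pow_one] at h3
  have key := diagonal_rational h.p_ne hX (pow_ne_zero N h.p_ne) h.u_ne h.v_ne h.m_ne rfl rfl rfl rfl
    h.one_sub (h.reg_neg x) h2 h3
  rw [hs.matrix_self hx, dataA_eq, h.dataC_eq hX, mul_sub, mul_add, h.thetas_eq x hx,
    h.prod_pred_div hs hx, h.prod_div (h.prod_eq x hx) (h.theta_sub x), div_div_eq_mul_div, key]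
  ring

/-- The squares of the off-diagonal entries of the tridiagonal action. -/
lemma matrix_succ_sq (h : IsRacahData p Q u v m N θ r θs l)
    (hs : SplitPair B M S T N ζ w θ r θs l) {x : ℕ} (hx : x + 1 ≤ N) :
    (Q * B (w x) (T (w (x + 1)))) ^ 2
      = dataA p u v m N (p ^ x) * dataC p u v m N (p ^ (x + 1)) := by
  have hX : p ^ x ≠ 0 := pow_ne_zero _ h.p_ne
  have h2 := h.reg_one x 0
  have h3 := h.reg_one x 1
  have h4 := h.reg_one x 2
  rw [pow_zero, mul_one] at h2
  rw [pow_one] at h3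
  have key := offDiagonal_rational h.p_ne hX (pow_ne_zero N h.p_ne) h.u_ne h.v_ne h.m_ne rfl rfl rfl
    rfl rfl h.one_sub h.one_add h2 h3 h4
  have e1 := h.prod_div (h.prod_eq x (by omega)) (h.theta_sub x)
  have e2 := h.prod_div (h.prod_eq (x + 1) hx) (h.theta_sub_two x)
  rw [div_div_eq_mul_div] at e1 e2
  rw [show p * p ^ (x + 1) = p ^ 2 * p ^ x by ring] at e2
  have e3 := h.thetas_eq (x + 1) hx
  rw [pow_succ'] at e3
  rw [mul_pow, hs.matrix_succ_sq hx, pow_two, mul_mul_mul_comm, e1, mul_add Q, mul_add Q,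
    mul_sub Q, mul_sub Q, e1, e3, e2, h.thetas_eq x (by omega), h.prod_pred_div_two hs (by omega), key,
    dataA_eq, h.dataC_eq (pow_ne_zero _ h.p_ne), pow_succ' p x]
  have h0 := h.one_sub
  have n1 := h.p_ne
  have n2 := h.u_ne
  have n3 := h.v_ne
  have n4 := h.m_ne
  have hn := pow_ne_zero N h.p_ne
  have e5 : p + u ^ 2 * m ^ 2 * (p * p ^ x) ^ 2 = p * (1 + u ^ 2 * m ^ 2 * p * (p ^ x) ^ 2) := by ring
  have e6 : 1 + u ^ 2 * m ^ 2 * (p * p ^ x) ^ 2 = 1 + u ^ 2 * m ^ 2 * p ^ 2 * (p ^ x) ^ 2 := by ring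
  rw [e5, e6, splitProd]
  generalize p ^ x = X at *
  generalize p ^ N = n at *
  clear key e1 e2 e3 e5 e6
  generalize 1 + u ^ 2 * m ^ 2 * X ^ 2 = d2 at *
  generalize 1 + u ^ 2 * m ^ 2 * p * X ^ 2 = d3 at *
  generalize 1 + u ^ 2 * m ^ 2 * p ^ 2 * X ^ 2 = d4 at *
  obtain ⟨d0, hd0⟩ : ∃ d, d = 1 - p := ⟨_, rfl⟩
  rw [← hd0] at h0 ⊢
  field_simp
  ring

lemma matrix_succ_ne_zero (h : IsRacahData p Q u v m N θ r θs l)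
    (hs : SplitPair B M S T N ζ w θ r θs l) {x : ℕ} (hx : x + 1 ≤ N) :
    B (w x) (T (w (x + 1))) ≠ 0 := fun e => by
  have h1 := h.matrix_succ_sq hs hx
  rw [e, mul_zero] at h1
  exact h.off_ne x hx (by rw [← h1]; ring)

/-- An eigenvector of `T` is not orthogonal to the first eigenvector of `S`. -/
lemma form_zero_ne_zero (h : IsRacahData p Q u v m N θ r θs l)
    (hs : SplitPair B M S T N ζ w θ r θs l) {y : V} (hy : y ∈ M) {μ : ℂ} (hμ : T y = μ • y)
    (hyy : B y y ≠ 0) : B y (w 0) ≠ 0 := fun e =>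
  hyy (hs.eq_zero_of_orthogonal (fun _ hx => h.matrix_succ_ne_zero hs hx) hy hμ e y hy)

/-- The coordinates of an eigenvector of `T` in the eigenbasis of `S` are, up to normalization,
basic Racah polynomials. -/
theorem form_eq_racSum (h : IsRacahData p Q u v m N θ r θs l)
    (hs : SplitPair B M S T N ζ w θ r θs l) {y : V} (hy : y ∈ M) {μ : ℂ} {k : ℕ} (hk : k ≤ N)
    (hμ : T y = μ • y) (hQ : Q * μ = m * v * p ^ k - (m * v * p ^ k)⁻¹) (h0 : B y (w 0) ≠ 0)
    {x : ℕ} (hx : x ≤ N) :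
    (-(m * v)) ^ x * (∏ t ∈ Finset.Icc 1 x, Q * B (w (t - 1)) (T (w t)))
        * (B y (w x) / B y (w 0))
      = poch p (-(m ^ 2 * p)) x * poch p (-(p ^ N * u ^ 2 * (m * v) ^ 2)) x * poch p (p ^ N)⁻¹ x
          / poch p (-(u ^ 2 * m ^ 2) * p ^ x) x
        * racSum p (m * v) (-(m ^ 2 * p)) (-(p ^ N * u ^ 2 * (m * v) ^ 2)) (p ^ N)⁻¹
            (-(u ^ 2 * m ^ 2)) k (p ^ x) := by
  have n1 := h.p_ne
  have n2 := h.u_ne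
  have n3 := h.v_ne
  have n4 := h.m_ne
  have hn := pow_ne_zero N h.p_ne
  refine racah_recursion (N := N) (H := fun x => (-(m * v)) ^ x
      * (∏ t ∈ Finset.Icc 1 x, Q * B (w (t - 1)) (T (w t))) * (B y (w x) / B y (w 0)))
    n1 (mul_ne_zero n4 n3) (neg_ne_zero.2 (by positivity)) (neg_ne_zero.2 (by positivity))
    (inv_ne_zero hn) (by field_simp) hk h.reg h.reg' h.poch_u h.poch_v h.poch_w h.poch_p ?_ ?_ x hx
  · simp [div_self h0]
  · intro x hx
    have h1 := hs.tridiag (x := x) hx.le hy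
    rw [← hs.symmT, hμ, map_smul, LinearMap.smul_apply, smul_eq_mul, if_neg hx.ne,
      hs.matrix_symm (x + 1) x] at h1
    have h2 := h.matrix_self hs hx.le
    rw [Finset.prod_Icc_succ_top (by omega), Nat.add_sub_cancel]
    change _ = -(m * v) * ((m * v * p ^ k - (m * v * p ^ k)⁻¹ - m * v + (m * v)⁻¹
      + dataA p u v m N (p ^ x) + dataC p u v m N (p ^ x)) * _
      + m * v * dataA p u v m N (p ^ (x - 1)) * dataC p u v m N (p ^ x) * _)
    have h3 : m * v * dataA p u v m N (p ^ (x - 1)) * dataC p u v m N (p ^ x)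
        * ((-(m * v)) ^ (x - 1) * (∏ t ∈ Finset.Icc 1 (x - 1), Q * B (w (t - 1)) (T (w t)))
          * (B y (w (x - 1)) / B y (w 0)))
        = -((-(m * v)) ^ x * (∏ t ∈ Finset.Icc 1 x, Q * B (w (t - 1)) (T (w t)))
          * (Q * (if x = 0 then 0 else B (w (x - 1)) (T (w x)) * B y (w (x - 1)))
            / B y (w 0))) := by
      cases x with
      | zero => simp [dataC, racC]
      | succ x =>
        rw [if_neg (by omega), Nat.add_sub_cancel, Finset.prod_Icc_succ_top (by omega),
          Nat.add_sub_cancel, mul_assoc (m * v), ← h.matrix_succ_sq hs hx.le]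
        ring
    rw [h3, ← hQ]
    linear_combination (-(m * v)) ^ (x + 1)
      * (∏ t ∈ Finset.Icc 1 x, Q * B (w (t - 1)) (T (w t))) * (-Q / B y (w 0)) * h1
      + (-(m * v)) ^ (x + 1)
      * (∏ t ∈ Finset.Icc 1 x, Q * B (w (t - 1)) (T (w t))) * (- B y (w x) / B y (w 0)) * h2

end IsRacahData

/-! ### Absolute values of the scalars -/

/-- The number `z` has the absolute value of `q ^ r`. -/
def HasDeg (L z : ℂ) (r : ℝ) : Prop := ‖z‖ = ‖qpow L r‖

namespace HasDeg

variable {L z z' : ℂ} {r r' : ℝ}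

lemma one : HasDeg L 1 0 := by simp [HasDeg, qpow_zero]

lemma qpow (L : ℂ) (r : ℝ) : HasDeg L (QBI.qpow L r) r := rfl

lemma mul (h : HasDeg L z r) (h' : HasDeg L z' r') : HasDeg L (z * z') (r + r') := by
  rw [HasDeg, norm_mul, h, h', Complex.ofReal_add, qpow_add, norm_mul]

lemma inv (h : HasDeg L z r) : HasDeg L z⁻¹ (-r) := by
  rw [HasDeg, norm_inv, h, Complex.ofReal_neg, qpow_neg, norm_inv]

lemma div (h : HasDeg L z r) (h' : HasDeg L z' r') : HasDeg L (z / z') (r - r') := by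
  rw [div_eq_mul_inv, sub_eq_add_neg]; exact h.mul h'.inv

lemma neg (h : HasDeg L z r) : HasDeg L (-z) r := by rw [HasDeg, norm_neg, h]

lemma pow (h : HasDeg L z r) (n : ℕ) : HasDeg L (z ^ n) (n * r) := by
  induction n with
  | zero => simpa using one
  | succ n ih =>
    rw [pow_succ, show ((n + 1 : ℕ) : ℝ) * r = n * r + r by push_cast; ring]; exact ih.mul h

lemma neg_qq (L : ℂ) : HasDeg L (-qq L) 1 := by
  rw [HasDeg, norm_neg, Complex.ofReal_one, qpow_one]

lemma neg_qq_pow (L : ℂ) (n : ℕ) : HasDeg L ((-qq L) ^ n) n := by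
  simpa using (neg_qq L).pow n

lemma ne_zero (h : HasDeg L z r) : z ≠ 0 :=
  norm_ne_zero_iff.1 (by rw [h]; exact norm_ne_zero_iff.2 (qpow_ne_zero _ _))

lemma one_sub_ne_zero (hL : ‖qq L‖ ≠ 1) (h : HasDeg L z r) (hr : r ≠ 0) : 1 - z ≠ 0 := fun e => by
  rw [sub_eq_zero] at e
  rw [← e, HasDeg, norm_one] at h
  exact norm_qpow_ne_one hL hr h.symm

end HasDeg

lemma neg_one_pow_mul_sigma {L : ℂ} (n h : ℕ) (g : ℝ) :
    (-1) ^ (h + n) * sigma L n (h + g)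
      = -((1 - (-qq L) ^ n) * (1 + ((-qq L) ^ h * qpow L (g - 1 / 2)) ^ 2 * (-qq L) ^ n)
        / ((-qq L) ^ h * qpow L (g - 1 / 2) * (-qq L) ^ n)) / (qq L - (qq L)⁻¹) := by
  have h1 := neg_one_pow_mul_qnum L ((g : ℂ) - 1 / 2) (h + n)
  have h2 := neg_one_pow_mul_qnum L ((g : ℂ) - 1 / 2) h
  have h3 : ((-1 : ℂ) ^ n) * (-1) ^ n = 1 := by rw [← mul_pow]; norm_num
  have e : (-1) ^ (h + n) * sigma L n (h + g)
      = (-1) ^ (h + n) * qnum L (((h + n : ℕ) : ℂ) + ((g : ℂ) - 1 / 2))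
        - (-1) ^ h * qnum L ((h : ℂ) + ((g : ℂ) - 1 / 2)) := by
    have e1 : ((n : ℂ) + ((((h : ℝ) + g : ℝ)) : ℂ) - 1 / 2) = ((h + n : ℕ) : ℂ) + ((g : ℂ) - 1 / 2) := by
      push_cast; ring
    have e2 : (((((h : ℝ) + g : ℝ)) : ℂ) - 1 / 2) = (h : ℂ) + ((g : ℂ) - 1 / 2) := by
      push_cast; ring
    rw [sigma, e1, e2, pow_add]
    linear_combination -((-1) ^ h * qnum L ((h : ℂ) + ((g : ℂ) - 1 / 2))) * h3
  rw [e, h1, h2, ← sub_div, pow_add]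
  congr 1
  have n1 : (-qq L) ^ n ≠ 0 := pow_ne_zero _ (neg_ne_zero.2 (qq_ne_zero L))
  have n2 : (-qq L) ^ h * qpow L (g - 1 / 2) ≠ 0 :=
    mul_ne_zero (pow_ne_zero _ (neg_ne_zero.2 (qq_ne_zero L))) (qpow_ne_zero _ _)
  rw [mul_right_comm]
  generalize (-qq L) ^ h * qpow L (g - 1 / 2) = E at *
  generalize (-qq L) ^ n = X at *
  field_simp
  ring

/-- The rational identity behind `splitL_mul_splitR`, with `S = q^{1/2}`, `X = p ^ x`,
`Y = p ^ (N - x)`. -/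
lemma splitProd_rational {p X Y U V S Q : ℂ} (hp : p ≠ 0) (hX : X ≠ 0) (hY : Y ≠ 0) (hU : U ≠ 0)
    (hV : V ≠ 0) (hS : S ≠ 0) (hQ : Q ≠ 0) (h : p = -S ^ 2) :
    Q ^ 2 * (-((1 - p * X) * (1 + (U / S) ^ 2 * (p * X)) / (U / S * (p * X))) / Q
        * (-((1 - Y) * (1 + (V / S) ^ 2 * Y) / (V / S * Y)) / Q))
      = splitProd p (p * X) (X * Y) U V := by
  rw [splitProd]
  field_simp
  subst h
  ring

lemma splitL_mul_splitR {L : ℂ} (hL : ‖qq L‖ ≠ 1) {γ : ℕ → ℝ} {a c e b h₁ N x : ℕ} (hx : x ≤ N) :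
    (qq L - (qq L)⁻¹) ^ 2 * (splitL L γ a c e b h₁ N x * splitR L γ a c e b h₁ N (x + 1))
      = splitProd (-qq L) (-qq L * (-qq L) ^ x) ((-qq L) ^ N) ((-qq L) ^ h₁ * qpow L (gsum γ a c))
        (qpow L (gsum γ (e + 1) b)) := by
  have hp := neg_ne_zero.2 (qq_ne_zero L)
  obtain ⟨y, rfl⟩ : ∃ y, N = x + y := ⟨N - x, by omega⟩
  have e1 := neg_one_pow_mul_sigma (L := L) (x + 1) h₁ (gsum γ a c)
  have e2 := neg_one_pow_mul_sigma (L := L) y 0 (gsum γ (e + 1) b)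
  rw [Nat.cast_zero, zero_add, zero_add, pow_zero, one_mul] at e2
  have eK := mul_inv_cancel₀ (qpow_ne_zero L ((1 / 2) * ((h₁ : ℂ) + gsum γ a c
    + gsum γ (e + 1) b + (x + y : ℕ) - 1)))
  have e3 : (qq L - (qq L)⁻¹) ^ 2 * (splitL L γ a c e b h₁ (x + y) x
      * splitR L γ a c e b h₁ (x + y) (x + 1))
      = (qq L - (qq L)⁻¹) ^ 2 * (((-1) ^ (h₁ + (x + 1)) * sigma L (x + 1) (h₁ + gsum γ a c))
        * ((-1) ^ y * sigma L y (gsum γ (e + 1) b))) := by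
    rw [splitL, splitR, qpow_neg, Nat.add_sub_cancel_left, pow_add (-1 : ℂ) h₁ (x + 1),
      pow_add (-1 : ℂ) h₁ (x + y), pow_succ (-1 : ℂ) x, pow_add (-1 : ℂ) x y]
    linear_combination (-(qq L - (qq L)⁻¹) ^ 2 * sigma L (x + 1) (h₁ + gsum γ a c)
      * sigma L y (gsum γ (e + 1) b) * (-1) ^ h₁ * (-1) ^ x * (-1) ^ y) * eK
  rw [e3, e1, e2, qpow_sub L (gsum γ a c), qpow_sub L (gsum γ (e + 1) b), ← sq,
    ← mul_div_assoc ((-qq L) ^ h₁), pow_succ' _ x, pow_add _ x y]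
  exact splitProd_rational (p := -qq L) (X := (-qq L) ^ x) (Y := (-qq L) ^ y)
    (U := (-qq L) ^ h₁ * qpow L (gsum γ a c)) (V := qpow L (gsum γ (e + 1) b)) (S := sq L) hp
    (pow_ne_zero x hp) (pow_ne_zero y hp)
    (mul_ne_zero (pow_ne_zero _ hp) (qpow_ne_zero _ _)) (qpow_ne_zero _ _) (sq_ne_zero L)
    (qq_sub_inv_ne_zero hL) (by rw [sq_sq])

/-- The coefficients of the split pair of three coupled lowest weight modules. -/
lemma isRacahData {L : ℂ} (hL : ‖qq L‖ ≠ 1) {γ : ℕ → ℝ} {a c e b : ℕ} (hac : a ≤ c + 1)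
    (hce : c ≤ e) (heb : e ≤ b) (h₁ h₂ N : ℕ)
    (g1 : 1 / 2 < gsum γ a c) (g2 : 1 / 2 < gsum γ (c + 1) e) (g3 : 1 / 2 < gsum γ (e + 1) b) :
    IsRacahData (-qq L) (qq L - (qq L)⁻¹) ((-qq L) ^ h₁ * qpow L (gsum γ a c))
      (qpow L (gsum γ (e + 1) b)) ((-qq L) ^ h₂ * qpow L (gsum γ (c + 1) e - 1 / 2)) N
      (fun x => (-1) ^ (h₁ + h₂ + x) * qnum L (((h₁ + h₂ + x : ℕ) : ℂ) + gsum γ a e - 1 / 2))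
      (splitR L γ a c e b h₁ N)
      (fun x => (-1) ^ (h₂ + (N - x))
        * qnum L (((h₂ + (N - x) : ℕ) : ℂ) + gsum γ (c + 1) b - 1 / 2))
      (splitL L γ a c e b h₁ N) := by
  have sae := gsum_split γ (a := a) (c := c) (b := e) (by omega) hce
  have scb := gsum_split γ (a := c + 1) (c := e) (b := b) (by omega) heb
  have hp := neg_ne_zero.2 (qq_ne_zero L)
  have dp := HasDeg.neg_qq L
  have dn := HasDeg.neg_qq_pow L N
  have du : HasDeg L ((-qq L) ^ h₁ * qpow L (gsum γ a c)) (h₁ + gsum γ a c) :=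
    (HasDeg.neg_qq_pow L h₁).mul (HasDeg.qpow L _)
  have dv : HasDeg L (qpow L (gsum γ (e + 1) b)) (gsum γ (e + 1) b) := HasDeg.qpow L _
  have dm : HasDeg L ((-qq L) ^ h₂ * qpow L (gsum γ (c + 1) e - 1 / 2))
      (h₂ + (gsum γ (c + 1) e - 1 / 2)) := by
    refine (HasDeg.neg_qq_pow L h₂).mul ?_
    have := HasDeg.qpow L (gsum γ (c + 1) e - 1 / 2)
    push_cast at this
    exact this
  have dB := ((du.pow 2).mul (dm.pow 2)).neg
  have dU := ((dm.pow 2).mul dp).neg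
  have dV := ((dn.mul (du.pow 2)).mul ((dm.mul dv).pow 2)).neg
  have p1 : (0 : ℝ) ≤ h₁ := Nat.cast_nonneg _
  have p2 : (0 : ℝ) ≤ h₂ := Nat.cast_nonneg _
  have pN : (0 : ℝ) ≤ N := Nat.cast_nonneg _
  refine
    { p_ne := hp
      Q_ne := qq_sub_inv_ne_zero hL
      u_ne := du.ne_zero
      v_ne := dv.ne_zero
      m_ne := dm.ne_zero
      one_sub := dp.one_sub_ne_zero hL one_ne_zero
      one_add := by
        have := dp.neg.one_sub_ne_zero hL one_ne_zero
        rwa [sub_neg_eq_add] at this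
      reg := fun t => (dB.mul (HasDeg.neg_qq_pow L t)).one_sub_ne_zero hL (by
        have : (0 : ℝ) ≤ t := Nat.cast_nonneg _
        push_cast; linarith)
      reg' := (dB.div dp).one_sub_ne_zero hL (by push_cast; linarith)
      theta_eq := fun x => ?_
      thetas_eq := fun x hx => ?_
      prod_eq := fun x hx => ?_
      poch_u := fun t _ => (dU.mul (HasDeg.neg_qq_pow L t)).one_sub_ne_zero hL (by
        have : (0 : ℝ) ≤ t := Nat.cast_nonneg _
        push_cast; linarith)
      poch_v := fun t _ => (dV.mul (HasDeg.neg_qq_pow L t)).one_sub_ne_zero hL (by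
        have : (0 : ℝ) ≤ t := Nat.cast_nonneg _
        push_cast; linarith)
      poch_w := fun t ht => (dn.inv.mul (HasDeg.neg_qq_pow L t)).one_sub_ne_zero hL (by
        have : (t : ℝ) < N := by exact_mod_cast ht
        linarith)
      poch_p := fun t _ => (HasDeg.neg_qq_pow L (t + 1)).one_sub_ne_zero hL (by
        have : (0 : ℝ) ≤ t := Nat.cast_nonneg _
        push_cast; linarith)
      off_ne := fun x hx => ?_ }
  · have h := neg_one_pow_mul_qnum L ((gsum γ a e : ℂ) - 1 / 2) (h₁ + h₂ + x)
    rw [← add_sub_assoc] at h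
    rw [h, mul_div_cancel₀ _ (qq_sub_inv_ne_zero hL), sae]
    have e1 : (-qq L) ^ (h₁ + h₂ + x)
        * qpow L (((gsum γ a c + gsum γ (c + 1) e : ℝ) : ℂ) - 1 / 2)
        = (-qq L) ^ h₁ * qpow L (gsum γ a c)
          * ((-qq L) ^ h₂ * qpow L (gsum γ (c + 1) e - 1 / 2)) * (-qq L) ^ x := by
      rw [Complex.ofReal_add, add_sub_assoc, qpow_add, pow_add, pow_add]; ring
    rw [e1]
  · have h := neg_one_pow_mul_qnum L ((gsum γ (c + 1) b : ℂ) - 1 / 2) (h₂ + (N - x))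
    rw [← add_sub_assoc] at h
    rw [h, mul_div_cancel₀ _ (qq_sub_inv_ne_zero hL), scb]
    have e1 : (-qq L) ^ (h₂ + (N - x))
        * qpow L (((gsum γ (c + 1) e + gsum γ (e + 1) b : ℝ) : ℂ) - 1 / 2)
        = ((-qq L) ^ h₂ * qpow L (gsum γ (c + 1) e - 1 / 2)) * qpow L (gsum γ (e + 1) b)
          * (-qq L) ^ N / (-qq L) ^ x := by
      rw [Complex.ofReal_add, add_sub_right_comm, qpow_add, pow_add, pow_sub₀ _ hp hx]
      ring
    rw [e1, inv_div]
  · exact splitL_mul_splitR hL hx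
  · have dX := HasDeg.neg_qq_pow L x
    have dX' := HasDeg.neg_qq_pow L (x + 1)
    have px : (0 : ℝ) ≤ x := Nat.cast_nonneg _
    have pxN : (x : ℝ) + 1 ≤ N := by exact_mod_cast hx
    have dm0 := dm.mul dv
    rw [dataA, racA, dataC, racC]
    push_cast at *
    refine mul_ne_zero (div_ne_zero (neg_ne_zero.2 (mul_ne_zero (mul_ne_zero (mul_ne_zero
      ((dU.mul dX).one_sub_ne_zero hL (by linarith)) ((dV.mul dX).one_sub_ne_zero hL (by linarith)))
      ((dn.inv.mul dX).one_sub_ne_zero hL (by linarith)))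
      ((dB.mul dX).one_sub_ne_zero hL (by linarith))))
      (mul_ne_zero (mul_ne_zero dm0.ne_zero ((dB.mul (dX.pow 2)).one_sub_ne_zero hL (by
        push_cast; linarith))) (((dB.mul dp).mul (dX.pow 2)).one_sub_ne_zero hL (by
        push_cast; linarith))))
      (div_ne_zero (mul_ne_zero (mul_ne_zero (mul_ne_zero (mul_ne_zero dm0.ne_zero
        (dX'.one_sub_ne_zero hL (by linarith)))
        (((dB.mul dX').div dU).one_sub_ne_zero hL (by linarith)))
        (((dB.mul dX').div dV).one_sub_ne_zero hL (by linarith)))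
        (((dB.mul dX').div dn.inv).one_sub_ne_zero hL (by linarith)))
        (mul_ne_zero (((dB.mul (dX'.pow 2)).div dp).one_sub_ne_zero hL (by push_cast; linarith))
          ((dB.mul (dX'.pow 2)).one_sub_ne_zero hL (by push_cast; linarith))))

/-! ### The coupled vectors as lowest weight sequences -/

lemma psum_succ (j : ℕ → ℕ) (m : ℕ) : psum j (m + 1) = psum j m + j (m + 1) := by
  rw [psum, Finset.sum_Icc_succ_top (by omega), psum]

lemma gsum_self (γ : ℕ → ℝ) (l : ℕ) : gsum γ l l = γ l := by simp [gsum]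

lemma half_lt_gsum {γ : ℕ → ℝ} {a b : ℕ} (hab : a ≤ b) (h : ∀ l, a ≤ l → l ≤ b → 1 / 2 < γ l) :
    1 / 2 < gsum γ a b := by
  rw [gsum, ← Finset.insert_Icc_succ_left_eq_Icc hab, Finset.sum_insert (by simp)]
  have h1 := h a le_rfl hab
  have : 0 ≤ ∑ l ∈ Finset.Icc (Order.succ a) b, γ l := Finset.sum_nonneg fun l hl => by
    rw [Finset.mem_Icc, Nat.succ_eq_succ] at hl
    linarith [h l (by omega) hl.2]
  linarith

lemma isLW_psi_one (L : ℂ) (γ : ℕ → ℝ) (o : ℕ) (j : ℕ → ℕ) :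
    IsLW L γ (o + 1) (o + 1) 0 (psi L γ o 1 j) where
  le := le_rfl
  mem p := by
    rw [psi, zero_add]
    exact Submodule.smul_mem _ _ (X_pow_mem_level (o + 1) p)
  up p := by
    have h : (X (o + 1) : Fock) ^ p = bvec (Finsupp.single (o + 1) p) := X_pow_eq_monomial
    have h' : (X (o + 1) : Fock) ^ (p + 1) = bvec (Finsupp.single (o + 1) (p + 1)) :=
      X_pow_eq_monomial
    rw [psi, psi, h, h', opUp_self, map_smul, siteUp_bvec, smul_smul,
      Finset.prod_Icc_succ_top (by omega), ← Finsupp.single_add, Finsupp.single_eq_same]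
  down_zero := by
    have h : (X (o + 1) : Fock) ^ 0 = bvec (Finsupp.single (o + 1) 0) := X_pow_eq_monomial
    rw [psi, h, opDown_self, map_smul, siteDown_bvec, Finsupp.single_eq_same, sqrt_sigma_zero,
      zero_smul, smul_zero]

lemma form_psi_one_zero (L : ℂ) (γ : ℕ → ℝ) (o : ℕ) (j : ℕ → ℕ) :
    form (psi L γ o 1 j 0) (psi L γ o 1 j 0) = 1 := by
  have h : (X (o + 1) : Fock) ^ 0 = bvec (Finsupp.single (o + 1) 0) := X_pow_eq_monomial
  rw [psi, h]
  simp [form_bvec]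

lemma sqrt_sigma_ne_zero {L : ℂ} (hL : ‖qq L‖ ≠ 1) {m : ℕ} (hm : m ≠ 0) {g : ℝ} (hg : 1 / 2 < g) :
    Complex.sqrt (sigma L m g) ≠ 0 := fun e =>
  sigma_ne_zero hL hm hg (by rw [← sqrt_mul_sqrt (sigma L m g), e, zero_mul])

/-- The coefficients of the coupling step, with respect to the lowest weight sequence of the last
position. -/
def stepCoeff (L : ℂ) (γ : ℕ → ℝ) (o m : ℕ) (j : ℕ → ℕ) (k : ℕ) : ℂ :=
  coupleCoeff L γ o (m + 1) j k
    * (∏ l ∈ Finset.Icc 1 (j m - k), Complex.sqrt (sigma L l (γ (o + m + 1))))⁻¹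

lemma coupleStep_eq {L : ℂ} (hL : ‖qq L‖ ≠ 1) {γ : ℕ → ℝ} {o m : ℕ} (hγ : 1 / 2 < γ (o + m + 1))
    (j : ℕ → ℕ) (f : ℕ → Fock) (p : ℕ) :
    coupleStep L γ o (m + 1) j f p = (opUp L γ (o + 1) (o + m + 1) ^ p)
      (coupled f (psi L γ (o + m) 1 j) (j m) (stepCoeff L γ o m j)) := by
  rw [coupleStep, coupled, Nat.add_sub_cancel, ← add_assoc o m 1]
  congr 1
  refine Finset.sum_congr rfl fun k _ => ?_
  have : (∏ l ∈ Finset.Icc 1 (j m - k), Complex.sqrt (sigma L l (γ (o + m + 1)))) ≠ 0 :=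
    Finset.prod_ne_zero_iff.2 fun l hl => sqrt_sigma_ne_zero hL
      (by rw [Finset.mem_Icc] at hl; omega) hγ
  rw [stepCoeff, psi, mul_smul_comm, smul_smul, mul_assoc, inv_mul_cancel₀ this, mul_one]

lemma coupleCoeff_zero (L : ℂ) (γ : ℕ → ℝ) (o m : ℕ) (j : ℕ → ℕ) : coupleCoeff L γ o m j 0 = 1 := by
  simp [coupleCoeff, qpow_zero]

lemma coupleCoeff_succ (L : ℂ) (γ : ℕ → ℝ) (o m : ℕ) (j : ℕ → ℕ) (k : ℕ) :
    coupleCoeff L γ o m j (k + 1) = coupleCoeff L γ o m j k * ((-1) ^ (j (m - 1) + k)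
      * qpow L (-((1 / 2) * ((psum j (m - 1) : ℂ) + (gsum γ (o + 1) (o + m) : ℂ) - 1)))
      * (Complex.sqrt (sigma L (j (m - 1) - k) (γ (o + m)))
          / sigma L (k + 1) ((psum j (m - 2) : ℝ) + gsum γ (o + 1) (o + m - 1)))) := by
  have e1 : (k + 1) * j (m - 1) + (k + 1) * (k + 1 - 1) / 2
      = (k * j (m - 1) + k * (k - 1) / 2) + (j (m - 1) + k) := by
    have : (k + 1) * (k + 1 - 1) / 2 = k * (k - 1) / 2 + k := by
      rw [← Nat.choose_two_right, ← Nat.choose_two_right, Nat.choose_succ_succ' k 1, Nat.choose_one_right,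
        add_comm]
    rw [this]
    generalize k * (k - 1) / 2 = c
    ring
  have e2 : -(((k + 1 : ℕ) : ℂ) / 2) * ((psum j (m - 1) : ℂ) + (gsum γ (o + 1) (o + m) : ℂ) - 1)
      = -((k : ℂ) / 2) * ((psum j (m - 1) : ℂ) + (gsum γ (o + 1) (o + m) : ℂ) - 1)
        + -((1 / 2) * ((psum j (m - 1) : ℂ) + (gsum γ (o + 1) (o + m) : ℂ) - 1)) := by
    push_cast; ring
  rw [coupleCoeff, e1, pow_add, e2, qpow_add, Finset.prod_range_succ, coupleCoeff]
  ring

/-- The coefficients of a coupling step make the coupled vector one of lowest weight. -/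
lemma isCoupling_stepCoeff {L : ℂ} (hL : ‖qq L‖ ≠ 1) {γ : ℕ → ℝ} {o m : ℕ} (hm : 1 ≤ m)
    (hγ : 1 / 2 < γ (o + m + 1)) (j : ℕ → ℕ)
    (hg : 1 / 2 < (psum j (m - 1) : ℝ) + gsum γ (o + 1) (o + m)) :
    IsCoupling L γ (o + 1) (o + m) (o + m + 1) (psum j (m - 1)) 0 (j m) (stepCoeff L γ o m j) := by
  have hprod : ∀ n, (∏ l ∈ Finset.Icc 1 n, Complex.sqrt (sigma L l (γ (o + m + 1)))) ≠ 0 := fun n =>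
    Finset.prod_ne_zero_iff.2 fun l hl => sqrt_sigma_ne_zero hL
      (by rw [Finset.mem_Icc] at hl; omega) hγ
  refine ⟨?_, fun k hk => ?_⟩
  · rw [stepCoeff, coupleCoeff_zero, one_mul]
    exact inv_ne_zero (hprod _)
  obtain ⟨w, hw⟩ : ∃ w, j m = k + 1 + w := ⟨j m - (k + 1), by omega⟩
  obtain ⟨m, rfl⟩ : ∃ m', m = m' + 1 := ⟨m - 1, by omega⟩
  have hs := sigma_ne_zero hL (m := k + 1) (by omega) hg
  have hn := hprod w
  have hr := sqrt_sigma_ne_zero hL (m := w + 1) (by omega) hγ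
  have hrr := sqrt_mul_sqrt (sigma L (w + 1) (γ (o + (m + 1) + 1)))
  have hq : qpow L (-((1 / 2) * ((psum j (m + 1) : ℂ) + (gsum γ (o + 1) (o + (m + 1 + 1)) : ℂ) - 1)))
      * qpow L ((1 / 2) * (((0 + w : ℕ) : ℂ) + (gsum γ (o + (m + 1) + 1) (o + (m + 1) + 1) : ℂ)))
      = qpow L (-((1 / 2) * (((psum j m + k : ℕ) : ℂ) + (gsum γ (o + 1) (o + (m + 1)) : ℂ)))) := by
    rw [← qpow_add, psum_succ, hw, gsum_split γ (a := o + 1) (b := o + (m + 1 + 1)) (c := o + (m + 1))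
      (by omega) (by omega)]
    congr 1; push_cast; ring_nf
  have h3 : ((-1 : ℂ) ^ (k + 1 + w + k)) * (-1) ^ w = -1 := by
    rw [← pow_add, show k + 1 + w + k + w = 2 * (k + w) + 1 by ring, pow_succ, pow_mul]; norm_num
  rw [stepCoeff, stepCoeff, coupleCoeff_succ, coefLeft, coefRight]
  simp only [Nat.add_sub_cancel, show m + 1 + 1 - 2 = m by omega, hw, Nat.add_sub_cancel_left,
    show k + 1 + w - k = w + 1 by omega, Nat.cast_zero, zero_add, ← add_assoc o (m + 1) 1, gsum_self] at *
  rw [← hq, Finset.prod_Icc_succ_top (by omega)]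
  generalize Complex.sqrt (sigma L (w + 1) (γ (o + (m + 1) + 1))) = R at *
  rw [← hrr]
  generalize qpow L (-((1 / 2) * ((psum j (m + 1) : ℂ) + (gsum γ (o + 1) (o + (m + 1) + 1) : ℂ) - 1)))
    = A at *
  generalize qpow L ((1 / 2) * ((w : ℂ) + (γ (o + (m + 1) + 1) : ℂ))) = D at *
  generalize (∏ l ∈ Finset.Icc 1 w, Complex.sqrt (sigma L l (γ (o + (m + 1) + 1)))) = Y at *
  generalize sigma L (k + 1) ((psum j m : ℝ) + gsum γ (o + 1) (o + (m + 1))) = Z at *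
  field_simp
  linear_combination (coupleCoeff L γ o (m + 1 + 1) j k * A * R * D) * h3

section Sequences

variable {L : ℂ} {γ : ℕ → ℝ}

/-- A coupling step turns a lowest weight sequence into another one, of higher degree. -/
lemma isLW_coupleStep (hL : ‖qq L‖ ≠ 1) {o m : ℕ} (hm : 1 ≤ m)
    (hγ : ∀ l, o + 1 ≤ l → l ≤ o + m + 1 → 1 / 2 < γ l) {j : ℕ → ℕ} {f : ℕ → Fock}
    (hf : IsLW L γ (o + 1) (o + m) (psum j (m - 1)) f) :
    IsLW L γ (o + 1) (o + m + 1) (psum j m) (coupleStep L γ o (m + 1) j f) := by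
  have hg : 1 / 2 < (psum j (m - 1) : ℝ) + gsum γ (o + 1) (o + m) := by
    have h1 := half_lt_gsum (γ := γ) (a := o + 1) (b := o + m) (by omega)
      fun l h1 h2 => hγ l h1 (by omega)
    have : (0 : ℝ) ≤ psum j (m - 1) := Nat.cast_nonneg _
    linarith
  have h := isLW_coupled hf (isLW_psi_one L γ (o + m) j)
    (isCoupling_stepCoeff hL hm (hγ _ (by omega) le_rfl) j hg)
  have e : psum j (m - 1) + 0 + j m = psum j m := by
    obtain ⟨m, rfl⟩ : ∃ m', m = m' + 1 := ⟨m - 1, by omega⟩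
    rw [psum_succ]; simp
  rw [e] at h
  rwa [show coupleStep L γ o (m + 1) j f = _ from
    funext fun p => coupleStep_eq hL (hγ _ (by omega) le_rfl) j f p]

lemma form_coupleStep_ne_zero (hL : ‖qq L‖ ≠ 1) {o m : ℕ} (hm : 1 ≤ m)
    (hγ : ∀ l, o + 1 ≤ l → l ≤ o + m + 1 → 1 / 2 < γ l) {j : ℕ → ℕ} {f : ℕ → Fock}
    (hf : IsLW L γ (o + 1) (o + m) (psum j (m - 1)) f) (h0 : form (f 0) (f 0) ≠ 0) :
    form (coupleStep L γ o (m + 1) j f 0) (coupleStep L γ o (m + 1) j f 0) ≠ 0 := by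
  have h1 := half_lt_gsum (γ := γ) (a := o + 1) (b := o + m) (by omega)
    fun l h1 h2 => hγ l h1 (by omega)
  have hg : 1 / 2 < (psum j (m - 1) : ℝ) + gsum γ (o + 1) (o + m) := by
    have : (0 : ℝ) ≤ psum j (m - 1) := Nat.cast_nonneg _
    linarith
  rw [coupleStep_eq hL (hγ _ (by omega) le_rfl), pow_zero, Module.End.one_apply]
  refine form_coupled_ne_zero hL hf (isLW_psi_one L γ (o + m) j) h1 ?_ h0 ?_
    (isCoupling_stepCoeff hL hm (hγ _ (by omega) le_rfl) j hg)
  · rw [gsum_self]; exact hγ _ (by omega) le_rfl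
  · rw [form_psi_one_zero]; exact one_ne_zero

lemma isLW_psi (hL : ‖qq L‖ ≠ 1) {o m : ℕ} (hm : 1 ≤ m)
    (hγ : ∀ l, o + 1 ≤ l → l ≤ o + m → 1 / 2 < γ l) (j : ℕ → ℕ) :
    IsLW L γ (o + 1) (o + m) (psum j (m - 1)) (psi L γ o m j) ∧
      form (psi L γ o m j 0) (psi L γ o m j 0) ≠ 0 := by
  induction m, hm using Nat.le_induction with
  | base =>
    refine ⟨?_, by rw [form_psi_one_zero]; exact one_ne_zero⟩
    have : psum j (1 - 1) = 0 := by simp [psum]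
    rw [this]
    exact isLW_psi_one L γ o j
  | succ m hm ih =>
    obtain ⟨h1, h2⟩ := ih fun l hl1 hl2 => hγ l hl1 (by omega)
    obtain ⟨m, rfl⟩ : ∃ m', m = m' + 1 := ⟨m - 1, by omega⟩
    have e : psi L γ o (m + 1 + 1) j = coupleStep L γ o (m + 1 + 1) j (psi L γ o (m + 1) j) := by
      funext p; rw [psi]
    rw [e]
    exact ⟨isLW_coupleStep hL hm hγ h1, form_coupleStep_ne_zero hL hm hγ h1 h2⟩

/-- The coefficients in `bigPsi` make the coupled vector one of lowest weight. -/
lemma isCoupling_epsCoeff (hL : ‖qq L‖ ≠ 1) {i r H κ s : ℕ}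
    (g1 : 1 / 2 < (H : ℝ) + gsum γ 1 i) :
    IsCoupling L γ 1 i (i + r) H κ s (epsCoeff L γ i r H κ s) := by
  have hα : ∀ p, 1 ≤ p → alphaCoeff L γ i r H κ s p ≠ 0 := fun p hp =>
    mul_ne_zero (mul_ne_zero (pow_ne_zero _ (by norm_num)) (qpow_ne_zero _ _))
      (sigma_ne_zero hL (by omega) g1)
  have hprod : ∀ n, (∏ l ∈ Finset.Icc 1 n, alphaCoeff L γ i r H κ s l) ≠ 0 := fun n =>
    Finset.prod_ne_zero_iff.2 fun l hl => hα l (Finset.mem_Icc.1 hl).1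
  refine ⟨by simp [epsCoeff], fun p hp => ?_⟩
  obtain ⟨w, rfl⟩ : ∃ w, s = p + 1 + w := ⟨s - (p + 1), by omega⟩
  have e1 : coefLeft L γ 1 i (i + r) H κ (p + 1) (p + 1 + w - (p + 1))
      = alphaCoeff L γ i r H κ (p + 1 + w) (p + 1) := by
    rw [coefLeft, alphaCoeff, show κ + (p + 1 + w) - (p + 1) = κ + w by omega,
      show p + 1 + w - (p + 1) = w by omega]
    congr 3; push_cast; ring
  have e2 : coefRight L γ 1 i (i + r) H κ p (p + 1 + w - p)
      = betaCoeff L γ i r H κ (p + 1 + w) (w + 1) := by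
    rw [coefRight, betaCoeff, show p + 1 + w - p = w + 1 by omega]
    congr 2; push_cast; ring
  have e3 : ∏ l ∈ Finset.Icc (p + 1 + w - (p + 1) + 1) (p + 1 + w),
        betaCoeff L γ i r H κ (p + 1 + w) l
      = betaCoeff L γ i r H κ (p + 1 + w) (w + 1)
        * ∏ l ∈ Finset.Icc (p + 1 + w - p + 1) (p + 1 + w), betaCoeff L γ i r H κ (p + 1 + w) l := by
    rw [show p + 1 + w - (p + 1) + 1 = w + 1 by omega, show p + 1 + w - p + 1 = w + 2 by omega,
      ← Finset.insert_Icc_succ_left_eq_Icc (show w + 1 ≤ p + 1 + w by omega),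
      Finset.prod_insert (by simp)]
    rfl
  have h1 := hα (p + 1) (by omega)
  have h2 := hprod p
  rw [e1, e2, epsCoeff, epsCoeff, e3, Finset.prod_Icc_succ_top (by omega)]
  generalize alphaCoeff L γ i r H κ (p + 1 + w) (p + 1) = A at *
  generalize ∏ l ∈ Finset.Icc 1 p, alphaCoeff L γ i r H κ (p + 1 + w) l = A' at *
  field_simp
  ring

lemma psum_shift (j : ℕ → ℕ) {i r : ℕ} (hi : 1 ≤ i) (hr : 1 ≤ r) :
    psum (fun l => j (i - 1 + l)) (r - 1) = ∑ l ∈ Finset.Icc i (i + r - 2), j l := by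
  rw [psum, show Finset.Icc i (i + r - 2) = (Finset.Icc 1 (r - 1)).map (addLeftEmbedding (i - 1)) by
    rw [Finset.map_add_left_Icc]; congr 1 <;> omega, Finset.sum_map]
  rfl

lemma psum_add (j : ℕ → ℕ) {a b : ℕ} (hab : a ≤ b) :
    psum j b = psum j a + ∑ l ∈ Finset.Icc (a + 1) b, j l := by
  rw [psum, Icc_split (a := 1) (c := a) (by omega) hab, Finset.sum_union (Icc_disj _ _ _), psum]

lemma psum_block (j : ℕ → ℕ) {i r : ℕ} (hi : 1 ≤ i) (hr : 1 ≤ r) :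
    psum j (i + r - 2) = psum j (i - 1) + psum (fun l => j (i - 1 + l)) (r - 1) := by
  rw [psum_shift j hi hr, psum_add j (a := i - 1) (by omega), Nat.sub_add_cancel hi]

/-- The two lowest weight sequences that are coupled in `bigPsi`, their coupling coefficients, and
the resulting lowest weight sequence. -/
lemma isLW_bigPsi (hL : ‖qq L‖ ≠ 1) {i r : ℕ} (hi : 1 ≤ i) (hr : 1 ≤ r)
    (hγ : ∀ l, 1 ≤ l → l ≤ i + r → 1 / 2 < γ l) (j : ℕ → ℕ) :
    IsLW L γ 1 i (psum j (i - 1)) (psi L γ 0 i j) ∧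
    IsLW L γ (i + 1) (i + r) (psum (fun l => j (i - 1 + l)) (r - 1))
      (psi L γ i r (fun l => j (i - 1 + l))) ∧
    IsCoupling L γ 1 i (i + r) (psum j (i - 1)) (psum (fun l => j (i - 1 + l)) (r - 1))
      (j (i + r - 1)) (epsCoeff L γ i r (psum j (i - 1)) (psum (fun l => j (i - 1 + l)) (r - 1))
        (j (i + r - 1))) ∧
    (bigPsi L γ i r j = fun t => (opUp L γ 1 (i + r) ^ t)
      (coupled (psi L γ 0 i j) (psi L γ i r (fun l => j (i - 1 + l))) (j (i + r - 1))
        (epsCoeff L γ i r (psum j (i - 1)) (psum (fun l => j (i - 1 + l)) (r - 1))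
          (j (i + r - 1))))) ∧
    IsLW L γ 1 (i + r) (psum j (i + r - 1)) (bigPsi L γ i r j) ∧
    form (bigPsi L γ i r j 0) (bigPsi L γ i r j 0) ≠ 0 := by
  have hv := isLW_psi hL (o := 0) hi (fun l h1 h2 => hγ l (by omega) (by omega)) j
  rw [zero_add, zero_add] at hv
  have hu := isLW_psi hL (o := i) hr (fun l h1 h2 => hγ l (by omega) (by omega))
    (fun l => j (i - 1 + l))
  have g1 := half_lt_gsum (γ := γ) hi fun l h1 h2 => hγ l h1 (by omega)
  have g2 := half_lt_gsum (γ := γ) (a := i + 1) (b := i + r) (by omega)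
    fun l h1 h2 => hγ l (by omega) (by omega)
  have hc := isCoupling_epsCoeff (γ := γ) hL (i := i) (r := r) (H := psum j (i - 1))
    (κ := psum (fun l => j (i - 1 + l)) (r - 1)) (s := j (i + r - 1)) (by
      have : (0 : ℝ) ≤ psum j (i - 1) := Nat.cast_nonneg _
      linarith)
  have he : bigPsi L γ i r j = fun t => (opUp L γ 1 (i + r) ^ t)
      (coupled (psi L γ 0 i j) (psi L γ i r (fun l => j (i - 1 + l))) (j (i + r - 1))
        (epsCoeff L γ i r (psum j (i - 1)) (psum (fun l => j (i - 1 + l)) (r - 1))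
          (j (i + r - 1)))) := by
    funext t
    rw [bigPsi, coupled, psum_shift j hi hr]
  refine ⟨hv.1, hu.1, hc, he, ?_, ?_⟩
  · have h := isLW_coupled hv.1 hu.1 hc
    rw [← psum_block j hi hr] at h
    have : psum j (i + r - 2) + j (i + r - 1) = psum j (i + r - 1) := by
      rw [show i + r - 1 = i + r - 2 + 1 by omega, psum_succ]
    rw [this] at h
    rwa [he]
  · rw [he]
    simp only [pow_zero, Module.End.one_apply]
    exact form_coupled_ne_zero hL (a := 0) hv.1 hu.1 g1 g2 hv.2 hu.2 hc

/-- The vectors `Θ` are non-isotropic lowest weight sequences. -/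
lemma isLW_theta (hL : ‖qq L‖ ≠ 1) {i r : ℕ} (hi : 1 ≤ i) (hr : 1 ≤ r) (d : ℕ)
    (hγ : ∀ l, 1 ≤ l → l ≤ i + r + d → 1 / 2 < γ l) (j : ℕ → ℕ) :
    IsLW L γ 1 (i + r + d) (psum j (i + r + d - 1)) (theta L γ i r j d) ∧
      form (theta L γ i r j d 0) (theta L γ i r j d 0) ≠ 0 := by
  induction d with
  | zero =>
    obtain ⟨-, -, -, -, h1, h2⟩ := isLW_bigPsi hL hi hr (fun l h1 h2 => hγ l h1 (by omega)) j
    have e : theta L γ i r j 0 = bigPsi L γ i r j := by funext p; rw [theta]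
    rw [e]
    exact ⟨h1, h2⟩
  | succ d ih =>
    obtain ⟨h1, h2⟩ := ih fun l hl1 hl2 => hγ l hl1 (by omega)
    have e : theta L γ i r j (d + 1) = coupleStep L γ 0 (i + r + d + 1) j (theta L γ i r j d) := by
      funext p; rw [theta]
    have hγ' : ∀ l, 0 + 1 ≤ l → l ≤ 0 + (i + r + d) + 1 → 1 / 2 < γ l := fun l hl1 hl2 =>
      hγ l (by omega) (by omega)
    rw [← zero_add (i + r + d)] at h1
    have h3 := isLW_coupleStep hL (o := 0) (m := i + r + d) (by omega) hγ' (by simpa using h1)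
    have h4 := form_coupleStep_ne_zero hL (o := 0) (m := i + r + d) (by omega) hγ'
      (by simpa using h1) h2
    rw [e]
    refine ⟨?_, h4⟩
    simpa [← add_assoc] using h3

end Sequences

/-! ### Joint eigenvectors -/

section Eigenvectors

variable {L : ℂ} {γ : ℕ → ℝ}

lemma opGamma_opUp_pow {a b c d : ℕ} (hac : a ≤ c + 1) (hcd : c + 1 ≤ d) (hdb : d ≤ b) (p : ℕ)
    (f : Fock) : opGamma L γ (c + 1) d ((opUp L γ a b ^ p) f)
      = (opUp L γ a b ^ p) (opGamma L γ (c + 1) d f) :=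
  LinearMap.congr_fun ((opGamma_commute_opUp L γ hac hcd hdb).pow_right p).eq f

/-- `Γ` on an interval inside the first factor passes through a coupling step: it commutes with `A₊`
and does not act on the added position. -/
lemma opGamma_coupleStep {o m c d : ℕ} (hoc : o ≤ c) (hcd : c + 1 ≤ d) (hdm : d ≤ o + m)
    (j : ℕ → ℕ) (f : ℕ → Fock) (p : ℕ) :
    opGamma L γ (c + 1) d (coupleStep L γ o (m + 1) j f p)
      = coupleStep L γ o (m + 1) j (fun t => opGamma L γ (c + 1) d (f t)) p := by
  rw [coupleStep, coupleStep, opGamma_opUp_pow (by omega) hcd (by omega), map_sum]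
  congr 1
  refine Finset.sum_congr rfl fun k _ => ?_
  rw [map_smul, (ActsOn.opGamma (c + 1) d).mul_right_of_mem_level _ (X_pow_mem_level _ _)]
  exact Finset.disjoint_left.2 fun t h1 h2 => by
    rw [Finset.mem_Icc] at h1 h2; omega

lemma coupleStep_smul {o m : ℕ} (j : ℕ → ℕ) (f : ℕ → Fock) (μ : ℂ) (p : ℕ) :
    coupleStep L γ o m j (fun t => μ • f t) p = μ • coupleStep L γ o m j f p := by
  rw [coupleStep, coupleStep, ← map_smul, Finset.smul_sum]
  congr 1
  exact Finset.sum_congr rfl fun k _ => by rw [smul_mul_assoc, smul_comm]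

lemma opGamma_coupleStep_of_eigen {o m c d : ℕ} (hoc : o ≤ c) (hcd : c + 1 ≤ d) (hdm : d ≤ o + m)
    (j : ℕ → ℕ) {f : ℕ → Fock} {μ : ℂ} (hf : ∀ t, opGamma L γ (c + 1) d (f t) = μ • f t) (p : ℕ) :
    opGamma L γ (c + 1) d (coupleStep L γ o (m + 1) j f p)
      = μ • coupleStep L γ o (m + 1) j f p := by
  rw [opGamma_coupleStep hoc hcd hdm, funext hf, coupleStep_smul]

lemma opGamma_psi (hL : ‖qq L‖ ≠ 1) {o m m' : ℕ} (hm' : 1 ≤ m') (hm : m' ≤ m)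
    (hγ : ∀ l, o + 1 ≤ l → l ≤ o + m → 1 / 2 < γ l) (j : ℕ → ℕ) (p : ℕ) :
    opGamma L γ (o + 1) (o + m') (psi L γ o m j p) = ((-1) ^ psum j (m' - 1)
      * qnum L ((psum j (m' - 1) : ℂ) + gsum γ (o + 1) (o + m') - 1 / 2)) • psi L γ o m j p := by
  induction m, hm using Nat.le_induction generalizing p with
  | base => exact (isLW_psi hL hm' hγ j).1.gamma p
  | succ m hm ih =>
    have ih := ih fun l h1 h2 => hγ l h1 (by omega)
    obtain ⟨m, rfl⟩ : ∃ k, m = k + 1 := ⟨m - 1, by omega⟩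
    rw [psi]
    exact opGamma_coupleStep_of_eigen le_rfl (by omega) (by omega) j ih p

lemma opGamma_bigPsi_left (hL : ‖qq L‖ ≠ 1) {i r m : ℕ} (hi : 1 ≤ i) (hr : 1 ≤ r) (hm : 1 ≤ m)
    (hmi : m ≤ i) (hγ : ∀ l, 1 ≤ l → l ≤ i + r → 1 / 2 < γ l) (j : ℕ → ℕ) (p : ℕ) :
    opGamma L γ 1 m (bigPsi L γ i r j p) = ((-1) ^ psum j (m - 1)
      * qnum L ((psum j (m - 1) : ℂ) + gsum γ 1 m - 1 / 2)) • bigPsi L γ i r j p := by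
  obtain ⟨-, hu, -, -⟩ := isLW_bigPsi hL hi hr hγ j
  have h := fun p => opGamma_psi hL (o := 0) hm hmi (fun l h1 h2 => hγ l (by omega) (by omega)) j p
  simp only [zero_add] at h
  rw [bigPsi, opGamma_opUp_pow (c := 0) (by omega) hm (by omega), ← map_smul, map_sum,
    Finset.smul_sum]
  congr 1
  refine Finset.sum_congr rfl fun t _ => ?_
  rw [map_smul, (ActsOn.opGamma 1 m).mul_right_of_mem_level _ (hu.mem _), h, smul_mul_assoc,
    smul_comm]
  exact Finset.disjoint_left.2 fun t h1 h2 => by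
    rw [Finset.mem_Icc] at h1 h2; omega

lemma opGamma_bigPsi_right (hL : ‖qq L‖ ≠ 1) {i r m : ℕ} (hi : 1 ≤ i) (hr : 1 ≤ r) (hm : 1 ≤ m)
    (hmr : m ≤ r) (hγ : ∀ l, 1 ≤ l → l ≤ i + r → 1 / 2 < γ l) (j : ℕ → ℕ) (p : ℕ) :
    opGamma L γ (i + 1) (i + m) (bigPsi L γ i r j p)
      = ((-1) ^ psum (fun l => j (i - 1 + l)) (m - 1)
        * qnum L ((psum (fun l => j (i - 1 + l)) (m - 1) : ℂ) + gsum γ (i + 1) (i + m) - 1 / 2))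
        • bigPsi L γ i r j p := by
  obtain ⟨hv, -, -, -⟩ := isLW_bigPsi hL hi hr hγ j
  have h := fun p => opGamma_psi hL (o := i) hm hmr (fun l h1 h2 => hγ l (by omega) (by omega))
    (fun l => j (i - 1 + l)) p
  rw [bigPsi, opGamma_opUp_pow (c := i) (by omega) (by omega) (by omega), ← map_smul, map_sum,
    Finset.smul_sum]
  congr 1
  refine Finset.sum_congr rfl fun t _ => ?_
  rw [map_smul, (ActsOn.opGamma (i + 1) (i + m)).mul_left_of_mem_level
    (Icc_disj 1 (i + m) i).symm (hv.mem _), h, mul_smul_comm, smul_comm]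

lemma opGamma_theta {i r d c e : ℕ} (hce : c + 1 ≤ e) (he : e ≤ i + r) {j : ℕ → ℕ} {μ : ℂ}
    (h : ∀ p, opGamma L γ (c + 1) e (bigPsi L γ i r j p) = μ • bigPsi L γ i r j p) (p : ℕ) :
    opGamma L γ (c + 1) e (theta L γ i r j d p) = μ • theta L γ i r j d p := by
  induction d generalizing p with
  | zero => rw [theta, h]
  | succ d ih =>
    rw [theta]
    exact opGamma_coupleStep_of_eigen (Nat.zero_le c) hce (by omega) j ih p

lemma opGamma_theta_outer (hL : ‖qq L‖ ≠ 1) {i r d m : ℕ} (hi : 1 ≤ i) (hr : 1 ≤ r)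
    (hm : i + r ≤ m) (hmd : m ≤ i + r + d)
    (hγ : ∀ l, 1 ≤ l → l ≤ i + r + d → 1 / 2 < γ l) (j : ℕ → ℕ) (p : ℕ) :
    opGamma L γ 1 m (theta L γ i r j d p) = ((-1) ^ psum j (m - 1)
      * qnum L ((psum j (m - 1) : ℂ) + gsum γ 1 m - 1 / 2)) • theta L γ i r j d p := by
  induction d generalizing p with
  | zero =>
    obtain rfl : m = i + r + 0 := by omega
    exact (isLW_theta hL hi hr 0 hγ j).1.gamma (a := 0) p
  | succ d ih =>
    rcases Nat.eq_or_lt_of_le hmd with rfl | hlt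
    · exact (isLW_theta hL hi hr (d + 1) hγ j).1.gamma (a := 0) p
    · rw [theta]
      exact opGamma_coupleStep_of_eigen (c := 0) le_rfl (by omega) (by omega) j
        (ih (by omega) fun l h1 h2 => hγ l h1 (by omega)) p

lemma isJointEigenvector_ket (hL : ‖qq L‖ ≠ 1) {n i r : ℕ} (hi : 1 ≤ i) (hr : 1 ≤ r)
    (hn : i + r ≤ n) (hγ : ∀ l, 1 ≤ l → l ≤ n → 1 / 2 < γ l) (η : (ℕ → ℕ) → ℂ) (j : ℕ → ℕ) :
    IsJointEigenvector L γ n i r j (ket L γ n i r η j) := by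
  obtain ⟨d, rfl⟩ : ∃ d, n = i + r + d := ⟨n - (i + r), by omega⟩
  have hγ' : ∀ l, 1 ≤ l → l ≤ i + r → 1 / 2 < γ l := fun l h1 h2 => hγ l h1 (by omega)
  have e : ket L γ (i + r + d) i r η j = η j • theta L γ i r j d 0 := by
    rw [ket, show i + r + d - i - r = d by omega]
  rw [e]
  refine ⟨fun m hm hmi => ?_, fun m hm => ?_, ?_⟩
  · rw [Finset.mem_Icc] at hm
    rw [map_smul, smul_comm]
    congr 1
    rcases hmi with hmi | hmi
    · exact opGamma_theta (c := 0) (by omega) (by omega)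
        (opGamma_bigPsi_left hL hi hr (by omega) hmi hγ' j) 0
    · exact opGamma_theta_outer hL hi hr hmi hm.2 hγ j 0
  · rw [Finset.mem_Icc] at hm
    rw [map_smul, smul_comm, psum_block j hi (r := m) (by omega), Nat.add_sub_cancel_left,
      Nat.cast_add, add_sub_cancel_left]
    congr 1
    exact opGamma_theta (c := i) (by omega) (by omega)
      (opGamma_bigPsi_right hL hi hr (by omega) hm.2 hγ' j) 0
  · rw [map_smul, smul_comm]
    congr 1
    rw [opK_of_mem_level L γ ((isLW_theta hL hi hr d hγ j).1.mem 0), add_zero]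

lemma exists_isNormalization (hL : ‖qq L‖ ≠ 1) {n i r : ℕ} (hi : 1 ≤ i) (hr : 1 ≤ r)
    (hn : i + r ≤ n) (hγ : ∀ l, 1 ≤ l → l ≤ n → 1 / 2 < γ l) :
    ∃ η : (ℕ → ℕ) → ℂ, IsNormalization L γ n i r η := by
  obtain ⟨d, rfl⟩ : ∃ d, n = i + r + d := ⟨n - (i + r), by omega⟩
  have h := fun j => (isLW_theta hL hi hr d hγ j).2
  refine ⟨fun j => (Complex.sqrt (form (theta L γ i r j d 0) (theta L γ i r j d 0)))⁻¹, fun j => ?_⟩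
  have h1 := sqrt_mul_sqrt (form (theta L γ i r j d 0) (theta L γ i r j d 0))
  rw [ket, show i + r + d - i - r = d by omega, pair_eq_form, map_smul, map_smul,
    LinearMap.smul_apply, smul_smul, smul_eq_mul, ← mul_inv, h1, inv_mul_cancel₀ (h j)]

end Eigenvectors

/-! ### The outer coupling steps -/

section Outer

variable {L : ℂ} {γ : ℕ → ℝ}

lemma coupleStep_congr {o m : ℕ} {j j' : ℕ → ℕ} (h1 : j m = j' m) (h2 : psum j m = psum j' m)
    (h3 : psum j (m - 1) = psum j' (m - 1)) (f : ℕ → Fock) (p : ℕ) :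
    coupleStep L γ o (m + 1) j f p = coupleStep L γ o (m + 1) j' f p := by
  have e : ∀ t, coupleCoeff L γ o (m + 1) j t = coupleCoeff L γ o (m + 1) j' t := fun t => by
    rw [coupleCoeff, coupleCoeff, Nat.add_sub_cancel, show m + 1 - 2 = m - 1 by omega, h1, h2, h3]
  rw [coupleStep, coupleStep, Nat.add_sub_cancel, h1]
  simp only [e]

lemma psum_congr {j j' : ℕ → ℕ} {m : ℕ} (h : ∀ l, 1 ≤ l → l ≤ m → j l = j' l) :
    psum j m = psum j' m :=
  Finset.sum_congr rfl fun l hl => by rw [Finset.mem_Icc] at hl; exact h l hl.1 hl.2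

lemma psi_congr {o m : ℕ} {j j' : ℕ → ℕ} (h : ∀ l, 1 ≤ l → l < m → j l = j' l) :
    psi L γ o m j = psi L γ o m j' := by
  induction m with
  | zero => funext p; rw [psi, psi]
  | succ m ih =>
    cases m with
    | zero => funext p; rw [psi, psi]
    | succ m =>
      funext p
      rw [psi, psi, ih fun l h1 h2 => h l h1 (by omega)]
      exact coupleStep_congr (h _ (by omega) (by omega))
        (psum_congr fun l h1 h2 => h l h1 (by omega))
        (psum_congr fun l h1 h2 => h l h1 (by omega)) _ p

/-- The coupling steps at the positions `m + 1, …, m + d`, starting from the descendants of the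
vector `z` on the positions `1, …, m`. -/
def outer (L : ℂ) (γ : ℕ → ℝ) (m : ℕ) (j : ℕ → ℕ) : ℕ → Fock → ℕ → Fock
  | 0, z, p => (opUp L γ 1 m ^ p) z
  | d + 1, z, p => coupleStep L γ 0 (m + d + 1) j (outer L γ m j d z) p

lemma coupleStep_eq_opUp_pow {o m : ℕ} (j : ℕ → ℕ) (f : ℕ → Fock) (p : ℕ) :
    coupleStep L γ o m j f p = (opUp L γ (o + 1) (o + m) ^ p) (coupleStep L γ o m j f 0) := by
  rw [coupleStep, coupleStep, pow_zero, Module.End.one_apply]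

lemma theta_succ_eq_outer (i k : ℕ) (j : ℕ → ℕ) (d : ℕ) :
    theta L γ i k j (d + 1) = outer L γ (i + k + 1) j d (theta L γ i k j 1 0) := by
  induction d with
  | zero =>
    funext p
    rw [outer, theta, theta, coupleStep_eq_opUp_pow]
    simp only [zero_add, add_zero]
  | succ d ih =>
    funext p
    rw [theta, outer, ih, show i + k + (d + 1) + 1 = i + k + 1 + d + 1 by omega]

lemma theta_eq_outer (i r : ℕ) (j : ℕ → ℕ) (d : ℕ) :
    theta L γ i r j d = outer L γ (i + r) j d (bigPsi L γ i r j 0) := by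
  induction d with
  | zero =>
    funext p
    rw [outer, theta, bigPsi, bigPsi, pow_zero, Module.End.one_apply]
  | succ d ih =>
    funext p
    rw [theta, outer, ih]

lemma outer_congr {m : ℕ} {j j' : ℕ → ℕ} (h : ∀ l, m ≤ l → j l = j' l)
    (hm : ∀ l, m - 1 ≤ l → psum j l = psum j' l) (d : ℕ) (z : Fock) :
    outer L γ m j d z = outer L γ m j' d z := by
  induction d with
  | zero => rfl
  | succ d ih =>
    funext p
    rw [outer, outer, ih]
    exact coupleStep_congr (h _ (by omega)) (hm _ (by omega)) (hm _ (by omega)) _ p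

lemma opGamma_outer {m c e : ℕ} (hce : c + 1 ≤ e) (he : e ≤ m) (j : ℕ → ℕ) (d : ℕ) (z : Fock)
    (p : ℕ) : opGamma L γ (c + 1) e (outer L γ m j d z p)
      = outer L γ m j d (opGamma L γ (c + 1) e z) p := by
  induction d generalizing p with
  | zero => rw [outer, outer, opGamma_opUp_pow (by omega) hce he]
  | succ d ih =>
    rw [outer, outer, opGamma_coupleStep (Nat.zero_le c) hce (by omega)]
    congr 1
    exact funext ih

lemma isLW_outer (hL : ‖qq L‖ ≠ 1) {m d : ℕ} (hm : 1 ≤ m)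
    (hγ : ∀ l, 1 ≤ l → l ≤ m + d → 1 / 2 < γ l) {j : ℕ → ℕ} {z : Fock}
    (hz : IsLW L γ 1 m (psum j (m - 1)) fun t => (opUp L γ 1 m ^ t) z) :
    IsLW L γ 1 (m + d) (psum j (m + d - 1)) (outer L γ m j d z) := by
  induction d with
  | zero => exact hz
  | succ d ih =>
    have h1 := ih fun l hl1 hl2 => hγ l hl1 (by omega)
    have e : outer L γ m j (d + 1) z = coupleStep L γ 0 (m + d + 1) j (outer L γ m j d z) := by
      funext p; rw [outer]
    have h3 := isLW_coupleStep hL (o := 0) (m := m + d) (j := j) (f := outer L γ m j d z) (by omega)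
      (fun l h1 h2 => hγ l (by omega) (by omega)) (by simpa using h1)
    rw [e]
    simpa [← add_assoc] using h3

/-- A coupling step multiplies the bilinear form by a constant. -/
lemma exists_form_coupleStep (hL : ‖qq L‖ ≠ 1) {o m : ℕ} (hγ : 1 / 2 < γ (o + m + 1)) (j : ℕ → ℕ)
    (h : ℕ) : ∃ C : ℂ, ∀ f f' : ℕ → Fock, IsLW L γ (o + 1) (o + m) h f →
      IsLW L γ (o + 1) (o + m) h f' →
      form (coupleStep L γ o (m + 1) j f 0) (coupleStep L γ o (m + 1) j f' 0)
        = C * form (f 0) (f' 0) := by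
  refine ⟨∑ p ∈ Finset.range (j m + 1), stepCoeff L γ o m j p * (stepCoeff L γ o m j p
    * ((∏ l ∈ Finset.range p, sigma L (l + 1) (h + gsum γ (o + 1) (o + m)))
      * form (psi L γ (o + m) 1 j (j m - p)) (psi L γ (o + m) 1 j (j m - p)))),
    fun f f' hf hf' => ?_⟩
  have hu := isLW_psi_one L γ (o + m) j
  rw [coupleStep_eq hL hγ, coupleStep_eq hL hγ, pow_zero, Module.End.one_apply,
    Module.End.one_apply, coupled, coupled, map_sum, Finset.sum_mul]
  refine Finset.sum_congr rfl fun p hp => ?_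
  rw [map_sum, LinearMap.sum_apply, Finset.sum_eq_single p]
  · rw [map_smul, map_smul, LinearMap.smul_apply, form_mul (hf.mem p) (hf'.mem p) (hu.mem _)
      (hu.mem _), hf.form_eq hf', smul_eq_mul, smul_eq_mul]
    ring
  · intro p' _ hp'
    rw [map_smul, map_smul, LinearMap.smul_apply, form_mul (hf.mem p') (hf'.mem p) (hu.mem _)
      (hu.mem _), form_level_ne (by omega) (hf.mem p') (hf'.mem p), zero_mul, smul_zero, smul_zero]
  · exact fun hn => absurd hp hn

/-- The outer coupling steps multiply the bilinear form by a constant. -/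
lemma exists_form_outer (hL : ‖qq L‖ ≠ 1) {m d : ℕ} (hm : 1 ≤ m)
    (hγ : ∀ l, 1 ≤ l → l ≤ m + d → 1 / 2 < γ l) (j : ℕ → ℕ) :
    ∃ C : ℂ, ∀ z z' : Fock, IsLW L γ 1 m (psum j (m - 1)) (fun t => (opUp L γ 1 m ^ t) z) →
      IsLW L γ 1 m (psum j (m - 1)) (fun t => (opUp L γ 1 m ^ t) z') →
      form (outer L γ m j d z 0) (outer L γ m j d z' 0) = C * form z z' := by
  induction d with
  | zero => exact ⟨1, fun z z' _ _ => by simp [outer]⟩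
  | succ d ih =>
    obtain ⟨C, hC⟩ := ih fun l hl1 hl2 => hγ l hl1 (by omega)
    obtain ⟨C', hC'⟩ := exists_form_coupleStep hL (o := 0) (m := m + d) (hγ _ (by omega) (by omega)) j
      (psum j (m + d - 1))
    refine ⟨C' * C, fun z z' hz hz' => ?_⟩
    have h1 := isLW_outer (d := d) hL hm (fun l hl1 hl2 => hγ l hl1 (by omega)) hz
    have h2 := isLW_outer (d := d) hL hm (fun l hl1 hl2 => hγ l hl1 (by omega)) hz'
    rw [outer, outer, hC' _ _ (by simpa using h1) (by simpa using h2), hC z z' hz hz', mul_assoc]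

lemma opUp_mem_trip {a c e b h₁ h₂ : ℕ} {v u t : ℕ → Fock} (hv : IsLW L γ a c h₁ v)
    (hu : IsLW L γ (c + 1) e h₂ u) (ht : IsLW L γ (e + 1) b 0 t) {N : ℕ} {z : Fock}
    (hz : z ∈ trip v u t N) : opUp L γ a b z ∈ trip v u t (N + 1) := by
  have hle1 := hv.le
  have hle2 := hu.le
  have hle3 := ht.le
  refine (Submodule.span_le.2 ?_ : trip v u t N ≤ (trip v u t (N + 1)).comap (opUp L γ a b)) hz
  rintro _ ⟨x, y, w, h, rfl⟩
  have h1 := mul_mem_prods v u (p := x) (r := y) rfl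
  rw [SetLike.mem_coe, Submodule.mem_comap, opUp_mul L γ (by omega) (by omega)
    (prods_le_level hv hu _ h1) (ht.mem w), ht.up]
  exact add_mem (Submodule.smul_mem _ _ (mul_mem_trip_left v u t (by omega)
    (opUp_mem_prods hv hu h1))) (Submodule.smul_mem _ _ (mul_mem_trip_left v u t (by omega) h1))

lemma trip_le_level {a c e b h₁ h₂ : ℕ} {v u t : ℕ → Fock} (hv : IsLW L γ a c h₁ v)
    (hu : IsLW L γ (c + 1) e h₂ u) (ht : IsLW L γ (e + 1) b 0 t) (N : ℕ) :
    trip v u t N ≤ level a b (h₁ + h₂ + N) := by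
  have hle1 := hv.le
  have hle2 := hu.le
  have hle3 := ht.le
  refine Submodule.span_le.2 ?_
  rintro _ ⟨x, y, w, rfl, rfl⟩
  have := mul_mem_level (by omega) (by omega)
    (prods_le_level hv hu _ (mul_mem_prods v u (p := x) (r := y) rfl)) (ht.mem w)
  rwa [show h₁ + h₂ + (x + y) + (0 + w) = h₁ + h₂ + (x + y + w) by ring] at this

lemma isLW_of_mem_lowestTrip {a c e b h₁ h₂ : ℕ} {v u t : ℕ → Fock} (hv : IsLW L γ a c h₁ v)
    (hu : IsLW L γ (c + 1) e h₂ u) (ht : IsLW L γ (e + 1) b 0 t) {N : ℕ} {z : Fock}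
    (hz : z ∈ lowestTrip L γ a b v u t N) :
    IsLW L γ a b (h₁ + h₂ + N) (fun p => (opUp L γ a b ^ p) z) where
  le := by have := hv.le; have := hu.le; have := ht.le; omega
  mem p := by
    have : (opUp L γ a b ^ p) z ∈ trip v u t (N + p) := by
      induction p with
      | zero => exact hz.1
      | succ p ih => rw [pow_succ', Module.End.mul_apply]; exact opUp_mem_trip hv hu ht ih
    have := trip_le_level hv hu ht _ this
    rwa [← add_assoc] at this
  up p := by rw [pow_succ', Module.End.mul_apply]
  down_zero := by rw [pow_zero, Module.End.one_apply]; exact LinearMap.mem_ker.1 hz.2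

end Outer

/-! ### Chains of index vectors -/

section Reindex

variable {i k : ℕ} {j : ℕ → ℕ} {x : ℕ}

lemma reindex_left (hk : 1 ≤ k) : reindex i k j x (i + k - 1) = x := by
  rw [reindex, Function.update_of_ne (by omega), Function.update_self]

lemma reindex_right : reindex i k j x (i + k) = j (i + k - 1) + j (i + k) - x := by
  rw [reindex, Function.update_self]

lemma reindex_of_ne {l : ℕ} (h1 : l ≠ i + k - 1) (h2 : l ≠ i + k) : reindex i k j x l = j l := by
  rw [reindex, Function.update_of_ne h2, Function.update_of_ne h1]

/-- Two index vectors of the same chain. -/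
lemma eq_reindex {j' : ℕ → ℕ} (h : ∀ l, l ≠ i + k - 1 → l ≠ i + k → j l = j' l)
    (hs : j (i + k - 1) + j (i + k) = j' (i + k - 1) + j' (i + k)) :
    j = reindex i k j' (j (i + k - 1)) := by
  funext l
  by_cases h2 : l = i + k
  · subst h2; rw [reindex_right]; omega
  · by_cases h1 : l = i + k - 1
    · rw [reindex, Function.update_of_ne h2, h1, Function.update_self]
    · rw [reindex_of_ne h1 h2, h l h1 h2]

lemma reindex_self : reindex i k j (j (i + k - 1)) = j :=
  (eq_reindex (fun _ _ _ => rfl) rfl).symm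

lemma reindex_sum (hk : 1 ≤ k) (hx : x ≤ j (i + k - 1) + j (i + k)) :
    reindex i k j x (i + k - 1) + reindex i k j x (i + k) = j (i + k - 1) + j (i + k) := by
  rw [reindex_left hk, reindex_right]; omega

lemma reindex_reindex (hk : 1 ≤ k) (hx : x ≤ j (i + k - 1) + j (i + k)) (y : ℕ) :
    reindex i k (reindex i k j x) y = reindex i k j y := by
  have h := reindex_sum (i := i) hk hx
  funext l
  by_cases h2 : l = i + k
  · subst h2; rw [reindex_right, h, reindex_right]
  · by_cases h1 : l = i + k - 1
    · subst h1; rw [reindex_left hk, reindex_left hk]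
    · rw [reindex_of_ne h1 h2, reindex_of_ne h1 h2, reindex_of_ne h1 h2]

lemma psum_reindex_of_le {m : ℕ} (hm : m + 2 ≤ i + k) : psum (reindex i k j x) m = psum j m :=
  psum_congr fun l _ h2 => reindex_of_ne (by omega) (by omega)

lemma psum_reindex_left (hi : 1 ≤ i) (hk : 1 ≤ k) :
    psum (reindex i k j x) (i + k - 1) = psum j (i + k - 2) + x := by
  rw [show i + k - 1 = i + k - 2 + 1 by omega, psum_succ, psum_reindex_of_le (by omega),
    show i + k - 2 + 1 = i + k - 1 by omega, reindex_left hk]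

lemma psum_pair (j : ℕ → ℕ) (hi : 1 ≤ i) (hk : 1 ≤ k) :
    psum j (i + k) = psum j (i + k - 2) + (j (i + k - 1) + j (i + k)) := by
  obtain ⟨m, hm⟩ : ∃ m, i + k = m + 2 := ⟨i + k - 2, by omega⟩
  rw [hm, psum_succ, psum_succ, Nat.add_sub_cancel, show m + 2 - 1 = m + 1 by omega]
  ring

lemma psum_reindex_of_ge (hi : 1 ≤ i) (hk : 1 ≤ k) (hx : x ≤ j (i + k - 1) + j (i + k)) {m : ℕ}
    (hm : i + k ≤ m) : psum (reindex i k j x) m = psum j m := by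
  rw [psum_add _ hm, psum_add j hm, psum_pair _ hi hk, psum_pair j hi hk, reindex_sum hk hx,
    psum_reindex_of_le (by omega)]
  congr 1
  exact Finset.sum_congr rfl fun l hl => by
    rw [Finset.mem_Icc] at hl
    exact reindex_of_ne (by omega) (by omega)

end Reindex

section Chain

variable {L : ℂ} {γ : ℕ → ℝ}

/-- The first three lowest weight sequences of a chain. -/
lemma isLW_chain (hL : ‖qq L‖ ≠ 1) {i k : ℕ} (hi : 1 ≤ i) (hk : 1 ≤ k)
    (hγ : ∀ l, 1 ≤ l → l ≤ i + k + 1 → 1 / 2 < γ l) (j : ℕ → ℕ) :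
    IsLW L γ 1 i (psum j (i - 1)) (psi L γ 0 i j) ∧
    IsLW L γ (i + 1) (i + k) (psum (fun l => j (i - 1 + l)) (k - 1))
      (psi L γ i k (fun l => j (i - 1 + l))) ∧
    IsLW L γ (i + k + 1) (i + k + 1) 0 (psi L γ (i + k) 1 j) := by
  obtain ⟨h1, h2, -⟩ := isLW_bigPsi hL hi hk (fun l h1 h2 => hγ l h1 (by omega)) j
  exact ⟨h1, h2, isLW_psi_one L γ (i + k) j⟩

/-- The vector `Θ^{(i,k,1)}`, coupled with the position `i + k + 1`, is a lowest weight vector of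
the three coupled modules and diagonalizes `Γ` on the first two. -/
lemma theta_one_mem (hL : ‖qq L‖ ≠ 1) {i k : ℕ} (hi : 1 ≤ i) (hk : 1 ≤ k)
    (hγ : ∀ l, 1 ≤ l → l ≤ i + k + 1 → 1 / 2 < γ l) (j : ℕ → ℕ) :
    theta L γ i k j 1 0 ∈ lowestTrip L γ 1 (i + k + 1) (psi L γ 0 i j)
      (psi L γ i k (fun l => j (i - 1 + l))) (psi L γ (i + k) 1 j) (j (i + k - 1) + j (i + k)) ∧
    opGamma L γ 1 (i + k) (theta L γ i k j 1 0) = ((-1) ^ psum j (i + k - 1)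
      * qnum L ((psum j (i + k - 1) : ℂ) + gsum γ 1 (i + k) - 1 / 2)) • theta L γ i k j 1 0 := by
  obtain ⟨hv, hu, hc, he, hV, -⟩ := isLW_bigPsi hL hi hk (fun l h1 h2 => hγ l h1 (by omega)) j
  have ht := isLW_psi_one L γ (i + k) j
  have e : theta L γ i k j 1 0 = coupled (bigPsi L γ i k j) (psi L γ (i + k) 1 j) (j (i + k))
      (stepCoeff L γ 0 (i + k) j) := by
    have h := coupleStep_eq hL (o := 0) (m := i + k) (γ := γ) (hγ _ (by omega) (by omega)) j
      (bigPsi L γ i k j) 0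
    rw [pow_zero, Module.End.one_apply, zero_add] at h
    have e0 : theta L γ i k j 0 = bigPsi L γ i k j := by funext p; rw [theta]
    rw [← h, theta, e0, add_zero]
  refine ⟨⟨?_, ?_⟩, ?_⟩
  · rw [e, he]
    exact coupled_left_mem_trip hv hu rfl _ _
  · exact (isLW_theta hL hi hk 1 hγ j).1.down_zero
  · rw [e]
    exact opGamma_coupled_left (a := 0) hV ht _ _

/-- The vector of the second family is a lowest weight vector of the same three coupled modules and
diagonalizes `Γ` on the last two. -/
lemma bigPsi_succ_mem (hL : ‖qq L‖ ≠ 1) {i k : ℕ} (hi : 1 ≤ i) (hk : 1 ≤ k)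
    (hγ : ∀ l, 1 ≤ l → l ≤ i + k + 1 → 1 / 2 < γ l) (j : ℕ → ℕ) :
    bigPsi L γ i (k + 1) j 0 ∈ lowestTrip L γ 1 (i + k + 1) (psi L γ 0 i j)
      (psi L γ i k (fun l => j (i - 1 + l))) (psi L γ (i + k) 1 j) (j (i + k - 1) + j (i + k)) ∧
    opGamma L γ (i + 1) (i + k + 1) (bigPsi L γ i (k + 1) j 0)
      = ((-1) ^ (psum (fun l => j (i - 1 + l)) (k - 1) + j (i + k - 1))
        * qnum L (((psum (fun l => j (i - 1 + l)) (k - 1) + j (i + k - 1) : ℕ) : ℂ)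
          + gsum γ (i + 1) (i + k + 1) - 1 / 2)) • bigPsi L γ i (k + 1) j 0 := by
  obtain ⟨hv, hU, hc, he, hV, -⟩ := isLW_bigPsi hL hi (r := k + 1) (by omega) hγ j
  obtain ⟨-, hu, ht⟩ := isLW_chain hL hi hk hγ j
  have e : bigPsi L γ i (k + 1) j 0 = _ := congrFun he 0
  simp only [pow_zero, Module.End.one_apply] at e
  have e1 : psum (fun l => j (i - 1 + l)) (k + 1 - 1)
      = psum (fun l => j (i - 1 + l)) (k - 1) + j (i + k - 1) := by
    obtain ⟨k, rfl⟩ : ∃ k', k = k' + 1 := ⟨k - 1, by omega⟩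
    rw [Nat.add_sub_cancel, psum_succ, Nat.add_sub_cancel,
      show i - 1 + (k + 1) = i + (k + 1) - 1 by omega]
  refine ⟨⟨?_, ?_⟩, ?_⟩
  · have e2 : psi L γ i (k + 1) (fun l => j (i - 1 + l)) = fun p =>
        (opUp L γ (i + 1) (i + k + 1) ^ p) (coupled (psi L γ i k (fun l => j (i - 1 + l)))
          (psi L γ (i + k) 1 j) (j (i + k - 1)) (stepCoeff L γ i k (fun l => j (i - 1 + l)))) := by
      obtain ⟨k, rfl⟩ : ∃ k', k = k' + 1 := ⟨k - 1, by omega⟩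
      funext p
      rw [psi, coupleStep_eq hL (hγ _ (by omega) (by omega)),
        psi_congr (m := 1) (j' := j) fun l h1 h2 => by omega,
        show i - 1 + (k + 1) = i + (k + 1) - 1 by omega]
    rw [e, e2]
    exact coupled_right_mem_trip hu ht (by
      rw [show i + (k + 1) - 1 = i + k by omega]) _ _
  · exact hV.down_zero
  · rw [e, ← e1]
    exact opGamma_coupled_right hv hU _ _

end Chain

/-! ### The tridiagonal action along a chain -/

/-- The Racah parameter that belongs to the positions `1, …, i`. -/
def chainU (L : ℂ) (γ : ℕ → ℝ) (i : ℕ) (j : ℕ → ℕ) : ℂ :=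
  (-qq L) ^ psum j (i - 1) * qpow L (gsum γ 1 i)

/-- The Racah parameter that belongs to the position `i + k + 1`. -/
def chainV (L : ℂ) (γ : ℕ → ℝ) (i k : ℕ) : ℂ := qpow L (gsum γ (i + k + 1) (i + k + 1))

/-- The Racah parameter that belongs to the positions `i + 1, …, i + k`. -/
def chainM (L : ℂ) (γ : ℕ → ℝ) (i k : ℕ) (j : ℕ → ℕ) : ℂ :=
  (-qq L) ^ psum (fun l => j (i - 1 + l)) (k - 1) * qpow L (gsum γ (i + 1) (i + k) - 1 / 2)

/-- The normalized vectors of a chain, transported to the positions `1, …, i + k + 1`, where the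
outer coupling steps are removed. -/
lemma exists_chain {L : ℂ} (hL : ‖qq L‖ ≠ 1) {γ : ℕ → ℝ} {n i k : ℕ} (hi : 1 ≤ i) (hk : 1 ≤ k)
    (hn : i + k + 1 ≤ n) (hγ : ∀ l, 1 ≤ l → l ≤ n → 1 / 2 < γ l) {η : (ℕ → ℕ) → ℂ}
    (hη : IsNormalization L γ n i k η) (j : ℕ → ℕ) :
    ∃ (M : Submodule ℂ Fock) (ζ : ℕ → Fock →ₗ[ℂ] ℂ) (w : ℕ → Fock) (θ r θs l : ℕ → ℂ),
      IsRacahData (-qq L) (qq L - (qq L)⁻¹) (chainU L γ i j) (chainV L γ i k) (chainM L γ i k j)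
        (j (i + k - 1) + j (i + k)) θ r θs l ∧
      SplitPair form M (opGamma L γ 1 (i + k)) (opGamma L γ (i + 1) (i + k + 1))
        (j (i + k - 1) + j (i + k)) ζ w θ r θs l ∧
      (∀ x ≤ j (i + k - 1) + j (i + k), ∀ y ≤ j (i + k - 1) + j (i + k),
        pair (ket L γ n i k η (reindex i k j x))
          (opGamma L γ (i + 1) (i + k + 1) (ket L γ n i k η (reindex i k j y)))
          = form (w x) (opGamma L γ (i + 1) (i + k + 1) (w y))) ∧
      ∀ η' : (ℕ → ℕ) → ℂ, IsNormalization L γ n i (k + 1) η' → ∃ y ∈ M, ∃ μ : ℂ,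
        opGamma L γ (i + 1) (i + k + 1) y = μ • y ∧
        (qq L - (qq L)⁻¹) * μ = chainM L γ i k j * chainV L γ i k * (-qq L) ^ j (i + k - 1)
          - (chainM L γ i k j * chainV L γ i k * (-qq L) ^ j (i + k - 1))⁻¹ ∧
        form y y = 1 ∧
        ∀ x ≤ j (i + k - 1) + j (i + k),
          pair (ket L γ n i (k + 1) η' j) (ket L γ n i k η (reindex i k j x)) = form y (w x) := by
  obtain ⟨d, rfl⟩ : ∃ d, n = i + k + 1 + d := ⟨n - (i + k + 1), by omega⟩
  set N := j (i + k - 1) + j (i + k) with hN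
  have hγ' : ∀ l, 1 ≤ l → l ≤ i + k + 1 → 1 / 2 < γ l := fun l h1 h2 => hγ l h1 (by omega)
  obtain ⟨hv, hu, ht⟩ := isLW_chain hL hi hk hγ' j
  have g1 := half_lt_gsum (γ := γ) hi fun l h1 h2 => hγ l h1 (by omega)
  have g2 := half_lt_gsum (γ := γ) (a := i + 1) (b := i + k) (by omega)
    fun l h1 h2 => hγ l (by omega) (by omega)
  have g3 := half_lt_gsum (γ := γ) (a := i + k + 1) (b := i + k + 1) le_rfl
    fun l h1 h2 => hγ l (by omega) (by omega)
  have g12 := half_lt_gsum (γ := γ) (a := 1) (b := i + k) (by omega)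
    fun l h1 h2 => hγ l (by omega) (by omega)
  set M := lowestTrip L γ 1 (i + k + 1) (psi L γ 0 i j) (psi L γ i k (fun l => j (i - 1 + l)))
    (psi L γ (i + k) 1 j) N with hM
  have hpN : psum j (i + k + 1 - 1)
      = psum j (i - 1) + psum (fun l => j (i - 1 + l)) (k - 1) + N := by
    rw [Nat.add_sub_cancel, psum_pair j hi hk, psum_block j hi hk]
  obtain ⟨C, hC⟩ := exists_form_outer hL (m := i + k + 1) (d := d) (by omega) hγ j
  have hCM : ∀ z ∈ M, ∀ z' ∈ M, form (outer L γ (i + k + 1) j d z 0)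
      (outer L γ (i + k + 1) j d z' 0) = C * form z z' := fun z hz z' hz' =>
    hC z z' (by rw [hpN]; exact isLW_of_mem_lowestTrip hv hu ht hz)
      (by rw [hpN]; exact isLW_of_mem_lowestTrip hv hu ht hz')
  obtain ⟨ε, hε⟩ : ∃ ε, ε * ε = C := ⟨_, sqrt_mul_sqrt C⟩
  have hTM : ∀ z ∈ M, opGamma L γ (i + 1) (i + k + 1) z ∈ M := fun z hz =>
    opGamma_right_mem_lowestTrip hv hu ht hz
  -- the vectors of the chain before the outer coupling steps
  obtain ⟨z, hz⟩ : ∃ z : ℕ → Fock, ∀ x, z x = theta L γ i k (reindex i k j x) 1 0 :=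
    ⟨_, fun _ => rfl⟩
  have hzM : ∀ x ≤ N, z x ∈ M ∧ opGamma L γ 1 (i + k) (z x)
      = ((-1) ^ (psum j (i - 1) + psum (fun l => j (i - 1 + l)) (k - 1) + x)
        * qnum L (((psum j (i - 1) + psum (fun l => j (i - 1 + l)) (k - 1) + x : ℕ) : ℂ)
          + gsum γ 1 (i + k) - 1 / 2)) • z x := fun x hx => by
    have h := theta_one_mem hL hi hk hγ' (reindex i k j x)
    rw [← hz, reindex_sum hk hx, psum_reindex_left hi hk, psum_block j hi hk,
      psi_congr (j' := j) (m := i) fun l h1 h2 => reindex_of_ne (by omega) (by omega),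
      psi_congr (j' := j) (m := 1) fun l h1 h2 => by omega,
      psi_congr (j := fun l => reindex i k j x (i - 1 + l)) (j' := fun l => j (i - 1 + l)) (m := k)
        fun l h1 h2 => reindex_of_ne (by omega) (by omega)] at h
    exact h
  have hket : ∀ x ≤ N, ket L γ (i + k + 1 + d) i k η (reindex i k j x)
      = η (reindex i k j x) • outer L γ (i + k + 1) j d (z x) 0 := fun x hx => by
    rw [ket, show i + k + 1 + d - i - k = d + 1 by omega, theta_succ_eq_outer, ← hz,
      outer_congr (j' := j) (fun l hl => reindex_of_ne (by omega) (by omega))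
        (fun l hl => psum_reindex_of_ge hi hk hx (by omega))]
  obtain ⟨w, hw⟩ : ∃ w : ℕ → Fock, ∀ x, w x = (ε * η (reindex i k j x)) • z x :=
    ⟨_, fun _ => rfl⟩
  have hnorm : ∀ x ≤ N, form (w x) (w x) = 1 := fun x hx => by
    have h := hη (reindex i k j x)
    rw [pair_eq_form, hket x hx, map_smul, map_smul, LinearMap.smul_apply,
      hCM _ (hzM x hx).1 _ (hzM x hx).1, ← hε] at h
    rw [hw, map_smul, map_smul, LinearMap.smul_apply, ← h]
    simp only [smul_eq_mul]
    ring
  have hwM : ∀ x ≤ N, w x ∈ M := fun x hx => by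
    rw [hw]; exact M.smul_mem _ (hzM x hx).1
  have hsplit := splitPair_lowestTrip (a := 0) hL hv hu ht g12 (N := N) (w := w) hwM
    (fun x hx => by rw [hw, map_smul, (hzM x hx).2, smul_comm]) hnorm
  have hdata := isRacahData hL (γ := γ) (a := 1) (c := i) (e := i + k) (b := i + k + 1) (by omega)
    (by omega) (by omega) (psum j (i - 1)) (psum (fun l => j (i - 1 + l)) (k - 1)) N g1 g2 g3
  refine ⟨M, _, w, _, _, _, _, hdata, hsplit, fun x hx y hy => ?_, fun η' hη' => ?_⟩
  · rw [pair_eq_form, hket x hx, hket y hy, map_smul, map_smul, map_smul, LinearMap.smul_apply,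
      opGamma_outer (by omega) le_rfl, hCM _ (hzM x hx).1 _ (hTM _ (hzM y hy).1), ← hε, hw, hw,
      map_smul, map_smul, map_smul, LinearMap.smul_apply]
    simp only [smul_eq_mul]
    ring
  · obtain ⟨hy1, hy2⟩ := bigPsi_succ_mem hL hi hk hγ' j
    have hket' : ket L γ (i + k + 1 + d) i (k + 1) η' j
        = η' j • outer L γ (i + k + 1) j d (bigPsi L γ i (k + 1) j 0) 0 := by
      rw [ket, show i + k + 1 + d - i - (k + 1) = d by omega, theta_eq_outer]
      rfl
    refine ⟨(ε * η' j) • bigPsi L γ i (k + 1) j 0, M.smul_mem _ hy1,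
      (-1) ^ (psum (fun l => j (i - 1 + l)) (k - 1) + j (i + k - 1))
        * qnum L (((psum (fun l => j (i - 1 + l)) (k - 1) + j (i + k - 1) : ℕ) : ℂ)
          + gsum γ (i + 1) (i + k + 1) - 1 / 2), ?_, ?_, ?_, fun x hx => ?_⟩
    · rw [map_smul, hy2, smul_comm]
    · have h := neg_one_pow_mul_qnum L ((gsum γ (i + 1) (i + k + 1) : ℂ) - 1 / 2)
        (psum (fun l => j (i - 1 + l)) (k - 1) + j (i + k - 1))
      rw [← add_sub_assoc] at h
      rw [h, mul_div_cancel₀ _ (qq_sub_inv_ne_zero hL)]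
      have e : (-qq L) ^ (psum (fun l => j (i - 1 + l)) (k - 1) + j (i + k - 1))
          * qpow L ((gsum γ (i + 1) (i + k + 1) : ℂ) - 1 / 2)
          = chainM L γ i k j * chainV L γ i k * (-qq L) ^ j (i + k - 1) := by
        rw [chainM, chainV, gsum_split γ (a := i + 1) (c := i + k) (b := i + k + 1) (by omega)
          (by omega), Complex.ofReal_add, add_sub_right_comm, qpow_add, pow_add]
        ring
      rw [e]
    · have h := hη' j
      rw [pair_eq_form, hket', map_smul, map_smul, LinearMap.smul_apply, hCM _ hy1 _ hy1, ← hε] at h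
      rw [map_smul, map_smul, LinearMap.smul_apply, ← h]
      simp only [smul_eq_mul]
      ring
    · rw [pair_eq_form, hket', hket x hx, map_smul, map_smul, LinearMap.smul_apply,
        hCM _ hy1 _ (hzM x hx).1, ← hε, hw, map_smul, map_smul, LinearMap.smul_apply]
      simp only [smul_eq_mul]
      ring

/-! ### The Racah parameters -/

section

variable {L : ℂ} {γ : ℕ → ℝ} {i k : ℕ}

lemma parN_eq (j : ℕ → ℕ) (hi : 1 ≤ i) (hk : 1 ≤ k) : parN i k j = j (i + k - 1) + j (i + k) := by
  rw [parN, psum_pair j hi hk, Nat.add_sub_cancel_left]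

lemma parA_eq (j : ℕ → ℕ) (hi : 1 ≤ i) (hk : 1 ≤ k) :
    parA L γ i k j = chainM L γ i k j * chainV L γ i k := by
  rw [parA, chainM, chainV, psum_block j hi hk,
    gsum_split γ (a := i + 1) (c := i + k) (b := i + k + 1) (by omega) (by omega), Complex.ofReal_add,
    add_sub_right_comm, qpow_add, Nat.cast_add, add_sub_cancel_left, zpow_natCast, mul_assoc]

lemma parB_eq (j : ℕ → ℕ) (hi : 1 ≤ i) (hk : 1 ≤ k) :
    parB L γ i k j
      = -((-qq L) ^ (j (i + k - 1) + j (i + k)) * (chainM L γ i k j * chainV L γ i k))⁻¹ := by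
  have hp : -qq L ≠ 0 := neg_ne_zero.2 (qq_ne_zero L)
  rw [← parA_eq j hi hk, parA, parB, mul_inv, mul_inv, ← qpow_neg, neg_sub, ← zpow_neg,
    ← zpow_natCast, ← zpow_neg, ← mul_assoc, ← zpow_add₀ hp, psum_pair j hi hk, neg_mul]
  congr 3
  · push_cast; ring
  · ring

lemma parC_eq (j : ℕ → ℕ) (hi : 1 ≤ i) (hk : 1 ≤ k) :
    parC L γ i k j = -((-qq L) ^ (j (i + k - 1) + j (i + k)) * chainU L γ i j ^ 2
      * (chainM L γ i k j * chainV L γ i k)) := by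
  have hp : -qq L ≠ 0 := neg_ne_zero.2 (qq_ne_zero L)
  have h : (2 * (gsum γ 1 i : ℂ) + (gsum γ (i + 1) (i + k + 1) : ℂ) - 1 / 2)
      = gsum γ 1 i + gsum γ 1 i + ((gsum γ (i + 1) (i + k + 1) : ℂ) - 1 / 2) := by ring
  have h' : ((psum j (i + k) : ℤ) + (psum j (i - 1) : ℤ)) = (j (i + k - 1) + j (i + k) : ℕ)
      + ((psum j (i + k - 2) : ℤ) - (psum j (i - 1) : ℤ)) + (psum j (i - 1) : ℤ)
      + (psum j (i - 1) : ℤ) := by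
    rw [psum_pair j hi hk]; push_cast; ring
  rw [← parA_eq j hi hk, parA, parC, chainU, h, h', qpow_add, qpow_add, zpow_add₀ hp, zpow_add₀ hp,
    zpow_add₀ hp, zpow_natCast, zpow_natCast]
  ring

lemma parD_eq (j : ℕ → ℕ) (hi : 1 ≤ i) (hk : 1 ≤ k) :
    parD L γ i k j = -(chainM L γ i k j * -qq L / chainV L γ i k) := by
  have h : ((gsum γ (i + 1) (i + k) : ℂ) - (γ (i + k + 1) : ℂ) + 1 / 2)
      = gsum γ (i + 1) (i + k) - 1 / 2 + 1 - γ (i + k + 1) := by ring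
  rw [parD, chainM, chainV, psum_block j hi hk, gsum_self, h, qpow_sub, qpow_add, qpow_one,
    Nat.cast_add, add_sub_cancel_left, zpow_natCast]
  ring

lemma chainU_reindex (j : ℕ → ℕ) (x : ℕ) (hk : 1 ≤ k) :
    chainU L γ i (reindex i k j x) = chainU L γ i j := by
  unfold chainU
  cases i with
  | zero => rfl
  | succ i => rw [psum_reindex_of_le (by omega)]

lemma chainM_reindex (j : ℕ → ℕ) (x : ℕ) (hi : 1 ≤ i) (hk : 1 ≤ k) :
    chainM L γ i k (reindex i k j x) = chainM L γ i k j := by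
  unfold chainM
  rw [psum_congr (j' := fun l => j (i - 1 + l)) fun l h1 h2 =>
    reindex_of_ne (by omega) (by omega)]

end

namespace IsRacahData

variable {p Q u v m : ℂ} {N : ℕ} {θ r θs l : ℕ → ℂ}

lemma coefA_eq (h : IsRacahData p Q u v m N θ r θs l) (s : ℕ) :
    coefA p (m * v) (-(p ^ N * (m * v))⁻¹) (-(p ^ N * u ^ 2 * (m * v))) (-(m * p / v)) s
      = dataA p u v m N (p ^ s) := by
  have h1 := h.p_ne
  have h2 := h.u_ne
  have h3 := h.v_ne
  have h4 := h.m_ne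
  have hn : p ^ N ≠ 0 := pow_ne_zero _ h1
  have e1 : p ^ ((s : ℤ) - 1) = p ^ s / p := by rw [zpow_sub₀ h1, zpow_natCast, zpow_one]
  have e2 : p ^ (2 * (s : ℤ)) = (p ^ s) ^ 2 := by
    rw [← pow_mul', ← zpow_natCast]; norm_cast
  have e3 : p ^ (2 * (s : ℤ) - 1) = (p ^ s) ^ 2 / p := by rw [zpow_sub₀ h1, e2, zpow_one]
  rw [dataA_eq, coefA, e1, e2, e3, zpow_natCast, neg_div]
  generalize p ^ s = Y at *
  generalize p ^ N = n at *
  congr 2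
  · field_simp
    ring
  · field_simp
    ring

lemma coefC_eq (h : IsRacahData p Q u v m N θ r θs l) (s : ℕ) :
    coefC p (m * v) (-(p ^ N * (m * v))⁻¹) (-(p ^ N * u ^ 2 * (m * v))) (-(m * p / v)) s
      = dataC p u v m N (p ^ s) := by
  have h1 := h.p_ne
  have h2 := h.u_ne
  have h3 := h.v_ne
  have h4 := h.m_ne
  have hn : p ^ N ≠ 0 := pow_ne_zero _ h1
  have hX : p ^ s ≠ 0 := pow_ne_zero _ h1
  have e1 : p ^ ((s : ℤ) - 1) = p ^ s / p := by rw [zpow_sub₀ h1, zpow_natCast, zpow_one]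
  have e2 : p ^ (2 * (s : ℤ)) = (p ^ s) ^ 2 := by
    rw [← pow_mul', ← zpow_natCast]; norm_cast
  have e3 : p ^ (2 * (s : ℤ) - 1) = (p ^ s) ^ 2 / p := by rw [zpow_sub₀ h1, e2, zpow_one]
  have e4 : p ^ (2 * (s : ℤ) - 2) = (p ^ s) ^ 2 / p ^ 2 := by
    rw [zpow_sub₀ h1, e2]; norm_cast
  rw [h.dataC_eq hX, coefC, e1, e3, e4, zpow_natCast]
  generalize p ^ s = Y at *
  generalize p ^ N = n at *
  have d1 : 1 - Y ^ 2 / p ^ 2 * (m * v) * -(n * (m * v))⁻¹ * -(n * u ^ 2 * (m * v)) * -(m * p / v)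
      = (p + u ^ 2 * m ^ 2 * Y ^ 2) / p := by
    field_simp
    ring
  have d2 : 1 - Y ^ 2 / p * (m * v) * -(n * (m * v))⁻¹ * -(n * u ^ 2 * (m * v)) * -(m * p / v)
      = 1 + u ^ 2 * m ^ 2 * Y ^ 2 := by
    field_simp
    ring
  rw [d1, d2, div_mul_eq_mul_div (p + u ^ 2 * m ^ 2 * Y ^ 2), div_div_eq_mul_div]
  congr 1
  field_simp

end IsRacahData

lemma parGamma_eq {L : ℂ} {γ : ℕ → ℝ} {i k : ℕ} (j : ℕ → ℕ) (hi : 1 ≤ i) (hk : 1 ≤ k) :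
    parGamma L γ i k j = -chainM L γ i k j ^ 2 := by
  have hq := qq_ne_zero L
  have hv : chainV L γ i k ≠ 0 := qpow_ne_zero _ _
  rw [parGamma, parA_eq j hi hk, parD_eq j hi hk]
  field_simp

lemma parDelta_eq {L : ℂ} {γ : ℕ → ℝ} {i k : ℕ} (j : ℕ → ℕ) (hi : 1 ≤ i) (hk : 1 ≤ k) :
    parDelta L γ i k j = chainV L γ i k ^ 2 / -qq L := by
  have hq := qq_ne_zero L
  have hv : chainV L γ i k ≠ 0 := qpow_ne_zero _ _
  have hm : chainM L γ i k j ≠ 0 :=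
    mul_ne_zero (pow_ne_zero _ (neg_ne_zero.2 hq)) (qpow_ne_zero _ _)
  rw [parDelta, parA_eq j hi hk, parD_eq j hi hk]
  field_simp

lemma parBeta_eq {L : ℂ} {γ : ℕ → ℝ} {i k : ℕ} (j : ℕ → ℕ) (hi : 1 ≤ i) (hk : 1 ≤ k) :
    parBeta L γ i k j = -((-qq L) ^ (j (i + k - 1) + j (i + k))
      * (chainU L γ i j ^ 2 * chainM L γ i k j ^ 2)) := by
  have hq := qq_ne_zero L
  have hv : chainV L γ i k ≠ 0 := qpow_ne_zero _ _
  rw [parBeta, parC_eq j hi hk, parD_eq j hi hk]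
  generalize (-qq L) ^ (j (i + k - 1) + j (i + k)) = P
  field_simp

/-- The number `A_{s-1} C_s` of the index vector with entry `s = x + 1` in a chain. -/
lemma prodAC_reindex {L : ℂ} {γ : ℕ → ℝ} {i k : ℕ} (hi : 1 ≤ i) (hk : 1 ≤ k) {j : ℕ → ℕ}
    {Q : ℂ} {θ r θs l : ℕ → ℂ} (h : IsRacahData (-qq L) Q (chainU L γ i j) (chainV L γ i k)
      (chainM L γ i k j) (j (i + k - 1) + j (i + k)) θ r θs l) {x : ℕ}
    (hx : x + 1 ≤ j (i + k - 1) + j (i + k)) :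
    prodAC L γ i k (reindex i k j (x + 1))
      = dataA (-qq L) (chainU L γ i j) (chainV L γ i k) (chainM L γ i k j)
          (j (i + k - 1) + j (i + k)) ((-qq L) ^ x)
        * dataC (-qq L) (chainU L γ i j) (chainV L γ i k) (chainM L γ i k j)
          (j (i + k - 1) + j (i + k)) ((-qq L) ^ (x + 1)) := by
  rw [← h.coefA_eq, ← h.coefC_eq, prodAC, parA_eq _ hi hk, parB_eq _ hi hk, parC_eq _ hi hk,
    parD_eq _ hi hk, reindex_sum hk hx, chainU_reindex j _ hk, chainM_reindex j _ hi hk,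
    reindex_left hk, Nat.cast_add, Nat.cast_one, add_sub_cancel_right]

/-! ### Square roots and connection coefficients -/

section

variable {L : ℂ} {γ : ℕ → ℝ} {n i k : ℕ} {η η' : (ℕ → ℕ) → ℂ}

lemma poch_ne_zero {p a : ℂ} {m : ℕ} (h : ∀ t < m, 1 - a * p ^ t ≠ 0) : poch p a m ≠ 0 :=
  Finset.prod_ne_zero_iff.2 fun t ht => h t (Finset.mem_range.1 ht)

/-- The numbers `rootAC` of the chain of `j`, through the data of `exists_chain`. -/
lemma rootAC_reindex (hk : 1 ≤ k) {j : ℕ → ℕ} {w : ℕ → Fock}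
    (hw : ∀ x ≤ j (i + k - 1) + j (i + k), ∀ y ≤ j (i + k - 1) + j (i + k),
      pair (ket L γ n i k η (reindex i k j x))
        (opGamma L γ (i + 1) (i + k + 1) (ket L γ n i k η (reindex i k j y)))
        = form (w x) (opGamma L γ (i + 1) (i + k + 1) (w y)))
    {x : ℕ} (hx : x ≤ j (i + k - 1) + j (i + k)) :
    rootAC L γ n i k η (reindex i k j x)
      = (qq L - (qq L)⁻¹) * form (w (x - 1)) (opGamma L γ (i + 1) (i + k + 1) (w x)) := by
  rw [rootAC, reindex_left hk, reindex_reindex hk hx, hw _ (by omega) _ hx]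

/-- The off-diagonal entry of the tridiagonal action is a square root of `A_{s-1} C_s`. -/
theorem rootAC_sq (hL : ‖qq L‖ ≠ 1) (hi : 1 ≤ i) (hk : 1 ≤ k) (hn : i + k + 1 ≤ n)
    (hγ : ∀ l, 1 ≤ l → l ≤ n → 1 / 2 < γ l) (hη : IsNormalization L γ n i k η) {j : ℕ → ℕ}
    (hj : 1 ≤ j (i + k - 1)) :
    rootAC L γ n i k η j ^ 2 = prodAC L γ i k j ∧ prodAC L γ i k j ≠ 0 := by
  obtain ⟨M, ζ, w, θ, r, θs, l, hd, hs, hw, -⟩ := exists_chain hL hi hk hn hγ hη j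
  obtain ⟨x, hx⟩ : ∃ x, j (i + k - 1) = x + 1 := ⟨j (i + k - 1) - 1, by omega⟩
  have hx' : x + 1 ≤ j (i + k - 1) + j (i + k) := by omega
  have h1 := rootAC_reindex hk hw hx'
  have h2 := prodAC_reindex hi hk hd hx'
  rw [show reindex i k j (x + 1) = j by rw [← hx, reindex_self]] at h1 h2
  rw [h1, h2, Nat.add_sub_cancel, hd.matrix_succ_sq hs hx']
  exact ⟨rfl, hd.off_ne x hx'⟩

/-- Every choice of the square roots is realized: along a chain, the sign of each vector is changed
relative to the one before it. -/
theorem exists_rootAC_eq (hL : ‖qq L‖ ≠ 1) (hi : 1 ≤ i) (hk : 1 ≤ k) (hn : i + k + 1 ≤ n)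
    (hγ : ∀ l, 1 ≤ l → l ≤ n → 1 / 2 < γ l) {R : (ℕ → ℕ) → ℂ}
    (hR : ∀ j : ℕ → ℕ, 1 ≤ j (i + k - 1) → R j ^ 2 = prodAC L γ i k j) :
    ∃ η : (ℕ → ℕ) → ℂ, IsNormalization L γ n i k η ∧
      ∀ j : ℕ → ℕ, 1 ≤ j (i + k - 1) → rootAC L γ n i k η j = R j := by
  obtain ⟨η, hη⟩ := exists_isNormalization hL hi hk (Nat.le_of_succ_le hn) hγ
  have hη0 : ∀ j : ℕ → ℕ, 1 ≤ j (i + k - 1) → rootAC L γ n i k η j ≠ 0 := fun j hj e => by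
    obtain ⟨h1, h2⟩ := rootAC_sq hL hi hk hn hγ hη hj
    exact h2 (by rw [← h1, e]; ring)
  obtain ⟨τ, hτ⟩ : ∃ τ : (ℕ → ℕ) → ℂ, ∀ j, τ j = R j / rootAC L γ n i k η j := ⟨_, fun _ => rfl⟩
  have hτ2 : ∀ j : ℕ → ℕ, 1 ≤ j (i + k - 1) → τ j ^ 2 = 1 := fun j hj => by
    obtain ⟨h1, h2⟩ := rootAC_sq hL hi hk hn hγ hη hj
    rw [hτ, div_pow, hR j hj, h1, div_self h2]
  obtain ⟨σ, hσ⟩ : ∃ σ : (ℕ → ℕ) → ℂ, ∀ j,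
      σ j = ∏ l ∈ Finset.Icc 1 (j (i + k - 1)), τ (reindex i k j l) := ⟨_, fun _ => rfl⟩
  have hσ2 : ∀ j, σ j ^ 2 = 1 := fun j => by
    rw [hσ, ← Finset.prod_pow]
    refine Finset.prod_eq_one fun l hl => hτ2 _ ?_
    rw [reindex_left hk]
    exact (Finset.mem_Icc.1 hl).1
  have hket : ∀ j, ket L γ n i k (fun j => η j * σ j) j = σ j • ket L γ n i k η j := fun j => by
    rw [ket, ket, smul_smul, mul_comm]
  refine ⟨fun j => η j * σ j, fun j => ?_, fun j hj => ?_⟩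
  · have h := hη j
    rw [pair_eq_form] at h
    rw [hket, pair_eq_form, map_smul, map_smul, LinearMap.smul_apply, h]
    rw [smul_eq_mul, smul_eq_mul, mul_one, ← pow_two, hσ2]
  · obtain ⟨x, hx⟩ : ∃ x, j (i + k - 1) = x + 1 := ⟨j (i + k - 1) - 1, by omega⟩
    have hσ1 : σ j = σ (reindex i k j x) * τ j := by
      rw [hσ, hσ, hx, Finset.prod_Icc_succ_top (by omega), ← hx, reindex_self, reindex_left hk]
      congr 1
      exact Finset.prod_congr rfl fun l _ => by rw [reindex_reindex hk (by omega)]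
    have h1 := hσ2 (reindex i k j x)
    have h2 : τ j * rootAC L γ n i k η j = R j := by rw [hτ, div_mul_cancel₀ _ (hη0 j hj)]
    rw [← h2, rootAC, rootAC, hket, hket, pair_eq_form, pair_eq_form, map_smul, map_smul, map_smul,
      LinearMap.smul_apply, hx, Nat.add_sub_cancel, hσ1]
    simp only [smul_eq_mul]
    linear_combination τ j * ((qq L - (qq L)⁻¹) * form (ket L γ n i k η (reindex i k j x))
      (opGamma L γ (i + 1) (i + k + 1) (ket L γ n i k η j))) * h1

/-- The renormalized connection coefficients are values of `p`-Racah polynomials at `p = -q`. -/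
theorem connGhat_eq (hL : ‖qq L‖ ≠ 1) (hi : 1 ≤ i) (hk : 1 ≤ k) (hn : i + k + 1 ≤ n)
    (hγ : ∀ l, 1 ≤ l → l ≤ n → 1 / 2 < γ l) (hη : IsNormalization L γ n i k η)
    (hη' : IsNormalization L γ n i (k + 1) η') {j j' : ℕ → ℕ}
    (h : ∀ l, l ≠ i + k - 1 → l ≠ i + k → j l = j' l)
    (hs : j (i + k - 1) + j (i + k) = j' (i + k - 1) + j' (i + k)) :
    omega L γ n i k η η' j' ≠ 0 ∧
      ∀ ρ : ℂ, ρ ^ 2 = parBeta L γ i k j * (-qq L) ^ (-(parN i k j : ℤ)) →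
        connGhat L γ n i k η η' (rootAC L γ n i k η) j j'
          = factorF L γ i k j j' ρ
            * racah (-qq L) (j' (i + k - 1)) (j (i + k - 1)) (parGamma L γ i k j)
              (parDelta L γ i k j) (parBeta L γ i k j) (parN i k j) ρ⁻¹ := by
  obtain ⟨M, ζ, w, θ, r, θs, l, hd, hsp, hw, H⟩ := exists_chain hL hi hk hn hγ hη j'
  obtain ⟨y, hy, μ, hμ, hQ, hyy, hpair⟩ := H η' hη'
  have hyy' : form y y ≠ 0 := by rw [hyy]; exact one_ne_zero
  have h0 : form y (w 0) ≠ 0 := hd.form_zero_ne_zero hsp hy hμ hyy'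
  have homega : omega L γ n i k η η' j' = form y (w 0) := hpair 0 (Nat.zero_le _)
  refine ⟨by rwa [homega], fun ρ hρ => ?_⟩
  set x := j (i + k - 1) with hx
  have hj : j = reindex i k j' x := eq_reindex h hs
  have hxN : x ≤ j' (i + k - 1) + j' (i + k) := by omega
  have hNx : j (i + k) = j' (i + k - 1) + j' (i + k) - x := by omega
  have key := hd.form_eq_racSum hsp hy (Nat.le_add_right (j' (i + k - 1)) _) hμ hQ h0 hxN
  have hU : chainU L γ i j = chainU L γ i j' := by rw [hj, chainU_reindex _ _ hk]
  have hM : chainM L γ i k j = chainM L γ i k j' := by rw [hj, chainM_reindex _ _ hi hk]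
  have hroot : ∏ t ∈ Finset.Icc 1 x, rootAC L γ n i k η (reindex i k j t)
      = ∏ t ∈ Finset.Icc 1 x, (qq L - (qq L)⁻¹)
        * form (w (t - 1)) (opGamma L γ (i + 1) (i + k + 1) (w t)) := by
    refine Finset.prod_congr rfl fun t ht => ?_
    have := (Finset.mem_Icc.1 ht).2
    rw [hj, reindex_reindex hk hxN, rootAC_reindex hk hw (by omega)]
  have hG : connGhat L γ n i k η η' (rootAC L γ n i k η) j j'
      = (-(chainM L γ i k j' * chainV L γ i k)) ^ x
        * (∏ t ∈ Finset.Icc 1 x, (qq L - (qq L)⁻¹)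
          * form (w (t - 1)) (opGamma L γ (i + 1) (i + k + 1) (w t)))
        * (form y (w x) / form y (w 0)) := by
    rw [connGhat, connG, homega, ← hx, hroot, hpair x hxN, parA_eq _ hi hk, hM]
  rw [hG, key]
  have n1 := hd.p_ne
  have n2 := hd.u_ne
  have n3 := hd.v_ne
  have n4 := hd.m_ne
  have hq := qq_ne_zero L
  have hle : j' (i + k - 1) ≤ j' (i + k - 1) + j' (i + k) := Nat.le_add_right _ _
  have hu := poch_ne_zero fun t ht => hd.poch_u t (lt_of_lt_of_le ht hle)
  have hv := poch_ne_zero fun t ht => hd.poch_v t (lt_of_lt_of_le ht hle)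
  have hw' := poch_ne_zero fun t ht => hd.poch_w t (lt_of_lt_of_le ht hle)
  rw [factorF, ← hx, hNx, parN_eq j hi hk, hs, parGamma_eq j hi hk, parDelta_eq j hi hk,
    parBeta_eq j hi hk, hU, hM, hs]
  rw [parN_eq j hi hk, hs, parBeta_eq j hi hk, hU, hM, hs] at hρ
  clear_value x
  generalize chainU L γ i j' = u at *
  generalize chainV L γ i k = v at *
  generalize chainM L γ i k j' = m at *
  generalize j' (i + k - 1) + j' (i + k) = N at *
  obtain ⟨p, hp⟩ : ∃ p, p = -qq L := ⟨_, rfl⟩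
  have hqp : qq L = -p := by rw [hp, neg_neg]
  rw [← hp] at n1 hu hv hw' hρ ⊢
  rw [hqp]
  have hP : p ^ N ≠ 0 := pow_ne_zero _ n1
  have hpN : p ^ (-(N : ℤ)) = (p ^ N)⁻¹ := by rw [zpow_neg, zpow_natCast]
  have hpx : p ^ (-((N - x : ℕ) : ℤ)) = p ^ x / p ^ N := by
    rw [Nat.cast_sub hxN, neg_sub, zpow_sub₀ n1, zpow_natCast, zpow_natCast]
  have hB : -(p ^ N * (u ^ 2 * m ^ 2)) * (p ^ N)⁻¹ = -(u ^ 2 * m ^ 2) := by field_simp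
  rw [racah_eq_racSum (a := m * v) (u := -(m ^ 2 * p)) (v := -(p ^ N * u ^ 2 * (m * v) ^ 2))
    (w := (p ^ N)⁻¹) (B := -(u ^ 2 * m ^ 2)) n1 (by ring) (by field_simp) hpN (by field_simp) hB]
  have hρ0 : ρ ≠ 0 := fun e => by
    rw [hpN, hB, e] at hρ
    have : -(u ^ 2 * m ^ 2) ≠ 0 := by simp [n2, n4]
    exact this (by rw [← hρ]; ring)
  simp only [hpN, hpx]
  have e1 : - -m ^ 2 * -p = -(m ^ 2 * p) := by ring
  have e2 : - -(p ^ N * (u ^ 2 * m ^ 2)) * (v ^ 2 / p) * -p = -(p ^ N * u ^ 2 * (m * v) ^ 2) := by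
    field_simp
  have e3 : -(p ^ N * (u ^ 2 * m ^ 2)) * (p ^ x / p ^ N) = -(u ^ 2 * m ^ 2) * p ^ x := by
    field_simp
  rw [e1, e2, e3, inv_pow]
  have hr := pow_ne_zero (j' (i + k - 1)) hρ0
  generalize poch p (-(u ^ 2 * m ^ 2) * p ^ x) x = D
  generalize racSum _ _ _ _ _ _ _ _ = S
  generalize poch p _ (j' (i + k - 1)) = a₁ at *
  generalize poch p (-(p ^ N * u ^ 2 * (m * v) ^ 2)) (j' (i + k - 1)) = a₂ at *
  generalize poch p (p ^ N)⁻¹ (j' (i + k - 1)) = a₃ at *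
  generalize poch p _ x = b₁
  generalize poch p (-(p ^ N * u ^ 2 * (m * v) ^ 2)) x = b₂
  generalize poch p (p ^ N)⁻¹ x = b₃
  field_simp

end

end QBI

end

theorem mainTheorem4 (q L : ℂ) (hL : Complex.exp L = q) (hq : ‖q‖ ≠ 1)
    (n i k : ℕ) (hi : 1 ≤ i) (hk : 1 ≤ k) (hn : i + k + 1 ≤ n)
    (γ : ℕ → ℝ) (hγ : ∀ l, 1 ≤ l → l ≤ n → 1 / 2 < γ l) :
    -- whatever square roots of the numbers `A_{s-1} C_s` are prescribed, the basis vectors can be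
    -- normalized such that these are the roots in the tridiagonal action
    (∀ R : (ℕ → ℕ) → ℂ,
      (∀ j : ℕ → ℕ, 1 ≤ j (i + k - 1) → R j ^ 2 = QBI.prodAC L γ i k j) →
      ∃ η : (ℕ → ℕ) → ℂ, QBI.IsNormalization L γ n i k η ∧
        ∀ j : ℕ → ℕ, 1 ≤ j (i + k - 1) → QBI.rootAC L γ n i k η j = R j) ∧
    (∃ η' : (ℕ → ℕ) → ℂ, QBI.IsNormalization L γ n i (k + 1) η') ∧
    -- for all normalizations of the two bases
    (∀ η η' : (ℕ → ℕ) → ℂ,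
      QBI.IsNormalization L γ n i k η → QBI.IsNormalization L γ n i (k + 1) η' →
      -- the two families consist of joint eigenvectors
      (∀ j : ℕ → ℕ, QBI.IsJointEigenvector L γ n i k j (QBI.ket L γ n i k η j)) ∧
      (∀ j' : ℕ → ℕ,
        QBI.IsJointEigenvector L γ n i (k + 1) j' (QBI.ket L γ n i (k + 1) η' j')) ∧
      -- the tridiagonal action provides a square root of each number `A_{s-1} C_s`
      (∀ j : ℕ → ℕ, 1 ≤ j (i + k - 1) →
        QBI.rootAC L γ n i k η j ^ 2 = QBI.prodAC L γ i k j) ∧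
      -- and with these square roots `Ĝ` is `F` times a `(-q)`-Racah polynomial
      (∀ j j' : ℕ → ℕ,
        (∀ l, l ≠ i + k - 1 → l ≠ i + k → j l = j' l) →
        j (i + k - 1) + j (i + k) = j' (i + k - 1) + j' (i + k) →
        QBI.omega L γ n i k η η' j' ≠ 0 ∧
        ∀ ρ : ℂ, ρ ^ 2 = QBI.parBeta L γ i k j * (-q) ^ (-(QBI.parN i k j : ℤ)) →
          QBI.connGhat L γ n i k η η' (QBI.rootAC L γ n i k η) j j'
            = QBI.factorF L γ i k j j' ρ
              * QBI.racah (-q) (j' (i + k - 1)) (j (i + k - 1))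
                  (QBI.parGamma L γ i k j) (QBI.parDelta L γ i k j) (QBI.parBeta L γ i k j)
                  (QBI.parN i k j) ρ⁻¹)) := by
  subst hL
  replace hq : ‖QBI.qq L‖ ≠ 1 := hq
  have hn' : i + k ≤ n := Nat.le_of_succ_le hn
  refine ⟨fun R hR => QBI.exists_rootAC_eq hq hi hk hn hγ hR,
    QBI.exists_isNormalization hq hi (Nat.succ_le_succ (Nat.zero_le k)) hn hγ, fun η η' hη hη' =>
    ⟨fun j => QBI.isJointEigenvector_ket hq hi hk hn' hγ η j,
      fun j' => QBI.isJointEigenvector_ket hq hi (Nat.succ_le_succ (Nat.zero_le k)) hn hγ η' j',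
      fun j hj => (QBI.rootAC_sq hq hi hk hn hγ hη hj).1,
      fun j j' h hs => QBI.connGhat_eq hq hi hk hn hγ hη hη' h hs⟩⟩
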